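/- Let $M$ be a Liouville sector of dimension $2n\ge 2$, with Liouville form $\theta$, symplectic form $\omega=d\theta$ and compact contact boundary $\partial_\infty M$. Let $\mathrm{Liouaut}^0(M)$ be the space of diffeomorphisms $\phi$ of $M$ with $\phi^*\theta=\theta+df$ for some compactly supported smooth $f$, with the smallest topology that contains the weak Whitney ($C^\infty$ compact-open) topology and makes the induced map to the space of contact diffeomorphisms of $\partial_\infty M$ continuous. Fix an $\omega$-compatible almost complex structure on $M$ and a map $M\to BU(1)$ classifying the complex line bundle $\det^2(TM)$; a *grading* $gr$ is a null-homotopy of this map. Fix also a *background class* $b\in H^2(M;\mathbb Z/2)$, represented by a map $\tilde b\colon M\to K(\mathbb Z/2,2)$. For a space $B$ and a map $p\colon M\to B$ let $\mathrm{End}_{/B}(M)$ denote the space of pairs of a continuous map $\psi\colon M\to M$ and a homotopy from $p\circ\psi$ to $p$, and let $\mathrm{End}_{/(*\to BU(1))}(M)$ be the space of such pairs for $B=BU(1)$ together with compatibility data with the null-homotopy $gr$. Choosing homotopies of compatible almost complex structures from $\phi^*J$ to $J$ (a contractible choice) defines a map $\mathrm{Liouaut}^0(M)\to\mathrm{End}_{/BU(1)}(M)$.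 Define, as homotopy pullbacks, $$\mathrm{Liouaut}^{gr}(M)=\mathrm{Liouaut}^0(M)\times^h_{\mathrm{End}_{/BU(1)}(M)}\mathrm{End}_{/(*\to BU(1))}(M),$$ $$\mathrm{Liouaut}^{b}(M)=\mathrm{Liouaut}^0(M)\times^h_{\mathrm{Map}(M,M)}\mathrm{End}_{/K(\mathbb Z/2,2)}(M),$$ $$\mathrm{Liouaut}^{gr,b}(M)=\mathrm{Liouaut}^{gr}(M)\times^h_{\mathrm{Liouaut}^0(M)}\mathrm{Liouaut}^{b}(M).$$ Then, at every base point, the forgetful map $\mathrm{Liouaut}^{gr,b}(M)\to\mathrm{Liouaut}^0(M)$ induces an isomorphism on homotopy groups $\pi_k$ for all $k\ge 3$, and the induced map on $\pi_2$ is injective. -/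

import Mathlib

open scoped Manifold ContDiff Topology unitInterval

noncomputable section

namespace Liouville

universe u v w

/-! ### Homotopy theory -/

section Homotopy

/-- The map of homotopy groups `π_k(X, x) → π_k(Y, f x)` induced by a continuous map. -/
def piMap {X : Type u} {Y : Type v} [TopologicalSpace X] [TopologicalSpace Y] (k : ℕ)
    (f : C(X, Y)) (x : X) : HomotopyGroup.Pi k X x → HomotopyGroup.Pi k Y (f x) :=
  Quotient.map
    (fun p => ⟨f.comp p.1, fun t ht => congrArg f (p.2 t ht)⟩)
    (fun _ _ h => h.map fun H => H.compContinuousMap f)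

/-- In positive degrees the induced map is a group homomorphism. -/
theorem piMap_mul {X : Type u} {Y : Type v} [TopologicalSpace X] [TopologicalSpace Y] (k : ℕ)
    [Nonempty (Fin k)] (f : C(X, Y)) (x : X) (a b : HomotopyGroup.Pi k X x) :
    piMap k f x (a * b) = piMap k f x a * piMap k f x b := by
  induction a using Quotient.inductionOn with | _ p => ?_
  induction b using Quotient.inductionOn with | _ q => ?_
  let F : GenLoop (Fin k) X x → GenLoop (Fin k) Y (f x) := fun p =>
    ⟨f.comp p.1, fun t ht => congrArg f (p.2 t ht)⟩
  let i : Fin k := Classical.arbitrary (Fin k)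
  have h₁ : ((· * ·) : _ → _ → HomotopyGroup.Pi k X x) ⟦p⟧ ⟦q⟧ = ⟦GenLoop.transAt i q p⟧ :=
    HomotopyGroup.mul_spec
  have h₂ : ((· * ·) : _ → _ → HomotopyGroup.Pi k Y (f x)) ⟦F p⟧ ⟦F q⟧ =
      ⟦GenLoop.transAt i (F q) (F p)⟧ := HomotopyGroup.mul_spec
  have h₃ : F (GenLoop.transAt i q p) = GenLoop.transAt i (F q) (F p) := by
    apply GenLoop.ext
    intro t
    change f (if _ then _ else _) = if _ then _ else _
    split_ifs <;> rfl
  refine (congrArg (piMap k f x) h₁).trans (Eq.trans ?_ h₂.symm)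
  exact congrArg (fun z => (⟦z⟧ : HomotopyGroup.Pi k Y (f x))) h₃

/-- `K` is an Eilenberg–MacLane space `K(A, n)`, where `n ≥ 1`: it is path connected, its `n`-th
homotopy group is `A` and all other homotopy groups vanish. -/
structure IsEilenbergMacLane (A : Type u) [Group A] (n : ℕ) [Nonempty (Fin n)]
    (K : Type v) [TopologicalSpace K] : Prop where
  pathConnected : PathConnectedSpace K
  pi_eq : ∀ x : K, Nonempty (HomotopyGroup.Pi n K x ≃* A)
  pi_ne : ∀ (k : ℕ), k ≠ n → ∀ x : K, Subsingleton (HomotopyGroup.Pi k K x)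

/-- The homotopy pullback of `f : A → C` and `g : B → C`: triples of a point of `A`, a point of `B`
and a path in `C` between their images. -/
@[ext] structure HomotopyPullback {A : Type u} {B : Type v} {C : Type w} [TopologicalSpace C]
    (f : A → C) (g : B → C) where
  fst : A
  snd : B
  path : C(I, C)
  path_zero : path 0 = f fst
  path_one : path 1 = g snd

instance {A : Type u} {B : Type v} {C : Type w} [TopologicalSpace A] [TopologicalSpace B]
    [TopologicalSpace C] (f : A → C) (g : B → C) : TopologicalSpace (HomotopyPullback f g) :=
  TopologicalSpace.induced (fun z => (z.fst, z.snd, z.path)) inferInstance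

theorem HomotopyPullback.continuous_fst {A : Type u} {B : Type v} {C : Type w}
    [TopologicalSpace A] [TopologicalSpace B] [TopologicalSpace C] (f : A → C) (g : B → C) :
    Continuous (HomotopyPullback.fst : HomotopyPullback f g → A) :=
  have h : Continuous fun z : HomotopyPullback f g => (z.fst, z.snd, z.path) :=
    continuous_induced_dom
  _root_.continuous_fst.comp h

/-- The endomorphism space of the object `p : X → B` in the slice `∞`-category of spaces over `B`:
a self-map `map` of `X` together with a homotopy from `p ∘ map` to `p`. -/
@[ext] structure SliceEnd {X : Type u} {B : Type v} [TopologicalSpace X] [TopologicalSpace B]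
    (p : C(X, B)) where
  map : C(X, X)
  homotopy : C(I, C(X, B))
  homotopy_zero : homotopy 0 = p.comp map
  homotopy_one : homotopy 1 = p

instance {X : Type u} {B : Type v} [TopologicalSpace X] [TopologicalSpace B] (p : C(X, B)) :
    TopologicalSpace (SliceEnd p) :=
  TopologicalSpace.induced (fun z => (z.map, z.homotopy)) inferInstance

/-- Postcomposition with `e : E → B` sends endomorphisms over `E` to endomorphisms over `B`. -/
def SliceEnd.push {X : Type u} {E : Type v} {B : Type w} [TopologicalSpace X]
    [TopologicalSpace E] [TopologicalSpace B] (e : C(E, B)) {q : C(X, E)} {p : C(X, B)}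
    (h : e.comp q = p) (z : SliceEnd q) : SliceEnd p where
  map := z.map
  homotopy := (⟨fun a => e.comp a, e.continuous_postcomp⟩ : C(C(X, E), C(X, B))).comp z.homotopy
  homotopy_zero := by
    simp only [ContinuousMap.comp_apply, ContinuousMap.coe_mk, z.homotopy_zero, ← h]
    rfl
  homotopy_one := by
    simp only [ContinuousMap.comp_apply, ContinuousMap.coe_mk, z.homotopy_one, ← h]

/-- Paths in `B` which end at `pt`. A map `X → PathsTo pt` is a map `X → B` together with a
null-homotopy of it. -/
abbrev PathsTo {B : Type u} [TopologicalSpace B] (pt : B) : Type u := {γ : C(I, B) // γ 1 = pt}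

/-- The starting point of a path. -/
def PathsTo.start {B : Type u} [TopologicalSpace B] (pt : B) : C(PathsTo pt, B) where
  toFun γ := γ.1 0
  continuous_toFun := (continuous_eval_const (0 : I)).comp continuous_subtype_val

/-- The Hilbert space of square summable complex sequences. -/
abbrev Hilb : Type := lp (fun _ : ℕ => ℂ) 2

/-- The classifying space `BU(1)`: the space of complex lines in the Hilbert space, that is, the
quotient of the (contractible) space of nonzero vectors by the scalars. -/
def BUOne : Type := Projectivization ℂ Hilb

instance : TopologicalSpace BUOne :=
  inferInstanceAs (TopologicalSpace (Quotient (projectivizationSetoid ℂ Hilb)))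

/-- The fibre of the tautological line bundle over a point of `BU(1)`. -/
def BUOne.line (ℓ : BUOne) : Submodule ℂ Hilb := Projectivization.submodule ℓ

end Homotopy

/-! ### The weak Whitney topology -/

section Whitney

variable {E : Type*} [NormedAddCommGroup E] [NormedSpace ℝ E] {H : Type*} [TopologicalSpace H]
  (J : ModelWithCorners ℝ E H) {M : Type*} [TopologicalSpace M] [ChartedSpace H M]
  {E' : Type*} [NormedAddCommGroup E'] [NormedSpace ℝ E'] {H' : Type*} [TopologicalSpace H']
  (J' : ModelWithCorners ℝ E' H') {N : Type*} [TopologicalSpace N] [ChartedSpace H' N]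

/-- The maps `g` which send `K` into the domain of the chart `d` and whose coordinate
representation in the charts `c` and `d` is `ε`-close to that of `f` on `K`, together with all
derivatives of order at most `r`. -/
def whitneyBasic (f : M → N) (c : OpenPartialHomeomorph M H) (d : OpenPartialHomeomorph N H')
    (K : Set M) (r : ℕ) (ε : ℝ) : Set (M → N) :=
  {g | Set.MapsTo g K d.source ∧ ∀ x ∈ K, ∀ k ≤ r,
    ‖iteratedFDerivWithin ℝ k (d.extend J' ∘ g ∘ (c.extend J).symm) (Set.range J) (c.extend J x) -
      iteratedFDerivWithin ℝ k (d.extend J' ∘ f ∘ (c.extend J).symm) (Set.range J) (c.extend J x)‖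
      < ε}

/-- The weak Whitney (compact-open `C^∞`) topology. It is only used for families of smooth maps. -/
@[reducible] def weakWhitney : TopologicalSpace (M → N) :=
  TopologicalSpace.generateFrom
    {U | ∃ (f : M → N) (c : OpenPartialHomeomorph M H) (d : OpenPartialHomeomorph N H') (K : Set M)
        (r : ℕ) (ε : ℝ), ContMDiff J J' ∞ f ∧ c ∈ IsManifold.maximalAtlas J ∞ M ∧
        d ∈ IsManifold.maximalAtlas J' ∞ N ∧ IsCompact K ∧ K ⊆ c.source ∧
        Set.MapsTo f K d.source ∧ 0 < ε ∧ U = whitneyBasic J J' f c d K r ε}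

end Whitney

/-! ### One-forms -/

section Forms

variable {E : Type*} [NormedAddCommGroup E] [NormedSpace ℝ E] {H : Type*} [TopologicalSpace H]
  (J : ModelWithCorners ℝ E H) (M : Type*) [TopologicalSpace M] [ChartedSpace H M]

/-- A (not necessarily continuous) differential one-form on a manifold. -/
abbrev OneForm : Type _ := ∀ x : M, TangentSpace J x →L[ℝ] ℝ

variable {J M}

/-- A one-form is smooth if it is smooth as a function on the tangent bundle. -/
def OneForm.IsSmooth [IsManifold J ∞ M] (θ : OneForm J M) : Prop :=
  ContMDiff J.tangent 𝓘(ℝ, ℝ) ∞ (fun p : TangentBundle J M => θ p.proj p.snd)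

/-- The expression of a one-form in the preferred chart at `x`. -/
def OneForm.inChart (θ : OneForm J M) (x : M) (y : E) : E →L[ℝ] ℝ :=
  (θ ((extChartAt J x).symm y)).comp
    (mfderivWithin 𝓘(ℝ, E) J (extChartAt J x).symm (Set.range J) y)

/-- The exterior derivative of a one-form, `dθ(v, w) = (D_v θ)(w) - (D_w θ)(v)`, computed at `x` in
the preferred chart at `x` (whose derivative at `x` identifies `T_x M` with the model space). -/
def OneForm.d (θ : OneForm J M) (x : M) (v w : TangentSpace J x) : ℝ :=
  (fderivWithin ℝ (θ.inChart x) (Set.range J) (extChartAt J x x) : E →L[ℝ] E →L[ℝ] ℝ) v w -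
    (fderivWithin ℝ (θ.inChart x) (Set.range J) (extChartAt J x x) : E →L[ℝ] E →L[ℝ] ℝ) w v

/-- The differential of a real function, as a one-form. -/
def dFun (J : ModelWithCorners ℝ E H) (f : M → ℝ) : OneForm J M := fun x => mfderiv J 𝓘(ℝ, ℝ) f x

end Forms

/-! ### Liouville sectors and their automorphisms -/

section Sectors

/-- A Liouville sector structure, of dimension `2 * m + 2`, on a smooth manifold `M` with (possibly
empty) boundary, with contact boundary `∂_∞ M = Y`. -/
structure LiouvilleSector (m : ℕ) (M : Type u) [TopologicalSpace M]
    [ChartedSpace (EuclideanHalfSpace (2 * m + 2)) M] [IsManifold (𝓡∂ (2 * m + 2)) ∞ M]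
    (Y : Type v) [TopologicalSpace Y] [ChartedSpace (EuclideanHalfSpace (2 * m + 1)) Y]
    [IsManifold (𝓡∂ (2 * m + 1)) ∞ Y] where
  /-- The Liouville form; the symplectic form is its exterior derivative. -/
  form : OneForm (𝓡∂ (2 * m + 2)) M
  form_smooth : form.IsSmooth
  nondegenerate : ∀ (x : M) (v : TangentSpace (𝓡∂ (2 * m + 2)) x),
    (∀ w, form.d x v w = 0) → v = 0
  /-- The contact form on the contact boundary. -/
  contactForm : OneForm (𝓡∂ (2 * m + 1)) Y
  contactForm_smooth : contactForm.IsSmooth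
  /-- The cylindrical end `Y × (0, ∞) → M`, a diffeomorphism onto an open subset. -/
  cylinder : OpenPartialHomeomorph (Y × ℝ) M
  cylinder_source : cylinder.source = Set.univ ×ˢ Set.Ioi 0
  cylinder_smooth : ContMDiffOn ((𝓡∂ (2 * m + 1)).prod 𝓘(ℝ, ℝ)) (𝓡∂ (2 * m + 2)) ∞ cylinder
    cylinder.source
  cylinder_symm_smooth : ContMDiffOn (𝓡∂ (2 * m + 2)) ((𝓡∂ (2 * m + 1)).prod 𝓘(ℝ, ℝ)) ∞
    cylinder.symm cylinder.target
  /-- On the end, the Liouville form is `e^s α`, the Liouville form of the symplectization. -/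
  cylinder_form : ∀ (y : Y) (s : ℝ), 0 < s →
    ∀ (v : TangentSpace (𝓡∂ (2 * m + 1)) y) (τ : ℝ),
      form (cylinder (y, s)) (mfderiv ((𝓡∂ (2 * m + 1)).prod 𝓘(ℝ, ℝ)) (𝓡∂ (2 * m + 2))
        cylinder (y, s) ((v, τ) : EuclideanSpace ℝ (Fin (2 * m + 1)) × ℝ)) =
        Real.exp s * contactForm y v
  /-- The end is a neighbourhood of infinity. -/
  cylinder_compl : ∀ r : ℝ, 0 < r → IsCompact (cylinder '' (Set.univ ×ˢ Set.Ioi r))ᶜ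
  /-- The end is proper: it leaves every compact set. -/
  cylinder_proper : ∀ K : Set M, IsCompact K →
    ∃ r : ℝ, 0 < r ∧ ∀ (y : Y) (s : ℝ), r < s → cylinder (y, s) ∉ K
  /-- The barrier condition at the boundary: there is a function `F` on the boundary
  (written as the restriction of a smooth function on `M`) with `Z F = a F` near infinity for the
  Liouville vector field `Z`, where `a > 0`, and with `dF > 0` along the characteristic foliation
  `(T ∂M)^ω`, oriented by `ω(N, C) > 0` for inward pointing `N`. In the preferred chart at a
  boundary point, the tangent space of the boundary is `{v | v 0 = 0}` and the inward
  pointing vectors are those with `0 < v 0`. -/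
  barrier : ∃ (a : ℝ) (F : M → ℝ), 0 < a ∧ ContMDiff (𝓡∂ (2 * m + 2)) 𝓘(ℝ, ℝ) ∞ F ∧
    (∃ K : Set M, IsCompact K ∧ ∀ x ∈ (𝓡∂ (2 * m + 2)).boundary M, x ∉ K →
      ∀ Z : TangentSpace (𝓡∂ (2 * m + 2)) x, (∀ w, form.d x Z w = form x w) →
        dFun (𝓡∂ (2 * m + 2)) F x Z = a * F x) ∧
    ∀ x ∈ (𝓡∂ (2 * m + 2)).boundary M, ∀ C : EuclideanSpace ℝ (Fin (2 * m + 2)),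
      C 0 = 0 → (∀ w : EuclideanSpace ℝ (Fin (2 * m + 2)), w 0 = 0 → form.d x C w = 0) →
      (∀ N : EuclideanSpace ℝ (Fin (2 * m + 2)), 0 < N 0 → 0 < form.d x N C) →
      0 < dFun (𝓡∂ (2 * m + 2)) F x C

variable {m : ℕ} {M : Type u} [TopologicalSpace M]
  [ChartedSpace (EuclideanHalfSpace (2 * m + 2)) M] [IsManifold (𝓡∂ (2 * m + 2)) ∞ M]
  {Y : Type v} [TopologicalSpace Y] [ChartedSpace (EuclideanHalfSpace (2 * m + 1)) Y]
  [IsManifold (𝓡∂ (2 * m + 1)) ∞ Y]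

/-- Liouville automorphisms: diffeomorphisms `φ` of `M` with `φ^* θ = θ + df`, where `f` is smooth
with compact support. -/
structure LiouAut (S : LiouvilleSector m M Y) where
  toDiffeo : Diffeomorph (𝓡∂ (2 * m + 2)) (𝓡∂ (2 * m + 2)) M M ∞
  pullback_form : ∃ f : M → ℝ, ContMDiff (𝓡∂ (2 * m + 2)) 𝓘(ℝ, ℝ) ∞ f ∧ HasCompactSupport f ∧
    ∀ (x : M) (v : TangentSpace (𝓡∂ (2 * m + 2)) x),
      S.form (toDiffeo x) (mfderiv (𝓡∂ (2 * m + 2)) (𝓡∂ (2 * m + 2)) toDiffeo x v) =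
        S.form x v + dFun (𝓡∂ (2 * m + 2)) f x v

namespace LiouAut

variable {S : LiouvilleSector m M Y}

/-- The derivative of a Liouville automorphism at a point. -/
def deriv (φ : LiouAut S) (x : M) :
    TangentSpace (𝓡∂ (2 * m + 2)) x →L[ℝ] TangentSpace (𝓡∂ (2 * m + 2)) (φ.toDiffeo x) :=
  mfderiv (𝓡∂ (2 * m + 2)) (𝓡∂ (2 * m + 2)) φ.toDiffeo x

/-- The underlying self-map of `M`. -/
def toMap (φ : LiouAut S) : C(M, M) := ⟨φ.toDiffeo, φ.toDiffeo.continuous⟩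

/-- The contact diffeomorphism of `∂_∞ M = Y` induced by a Liouville automorphism. (The limit exists
because the expression is independent of `s` for large `s`.) -/
def atInfinity (φ : LiouAut S) (y : Y) : Y :=
  haveI : Nonempty Y := ⟨y⟩
  Filter.limUnder Filter.atTop fun s : ℝ => (S.cylinder.symm (φ.toDiffeo (S.cylinder (y, s)))).1

/-- The smallest topology which contains the weak Whitney topology and for which the map to the
diffeomorphisms of `∂_∞ M` is continuous. -/
instance : TopologicalSpace (LiouAut S) :=
  TopologicalSpace.induced (fun φ => (φ.toDiffeo : M → M))
      (weakWhitney (𝓡∂ (2 * m + 2)) (𝓡∂ (2 * m + 2))) ⊓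
    TopologicalSpace.induced atInfinity (weakWhitney (𝓡∂ (2 * m + 1)) (𝓡∂ (2 * m + 1)))

end LiouAut

/-! ### Almost complex structures and the classifying map of `det² TM` -/

/-- A point of `M` with two `(m + 1)`-tuples of tangent vectors. -/
structure FramePair (m : ℕ) (M : Type u) [TopologicalSpace M]
    [ChartedSpace (EuclideanHalfSpace (2 * m + 2)) M] where
  pt : M
  fst : Fin (m + 1) → TangentSpace (𝓡∂ (2 * m + 2)) pt
  snd : Fin (m + 1) → TangentSpace (𝓡∂ (2 * m + 2)) pt

instance : TopologicalSpace (FramePair m M) :=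
  TopologicalSpace.induced
    (fun p => ((fun i => ⟨p.pt, p.fst i⟩, fun i => ⟨p.pt, p.snd i⟩) :
      (Fin (m + 1) → TangentBundle (𝓡∂ (2 * m + 2)) M) ×
        (Fin (m + 1) → TangentBundle (𝓡∂ (2 * m + 2)) M)))
    inferInstance

/-- A smooth almost complex structure `J` on `M` compatible with the symplectic form `ω`, with a
classifying map `M → BU(1)` of the complex line bundle `det²(TM, J) = (Λ^{m+1}_ℂ TM)^{⊗ 2}`.
The latter is a continuous map `cls : M → BU(1)` covered by a map of line bundles `bundleMap` from
`det²(TM, J)` to the tautological bundle that is an isomorphism on fibres. A `ℂ`-linear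
map out of the fibre of `det²(TM, J)` is given as a form in two groups of `m + 1` tangent
vectors, alternating and complex multilinear in each group. -/
@[ext] structure ClassifiedACS (S : LiouvilleSector m M Y) where
  J : ∀ x : M, TangentSpace (𝓡∂ (2 * m + 2)) x →L[ℝ] TangentSpace (𝓡∂ (2 * m + 2)) x
  J_smooth : ContMDiff (𝓡∂ (2 * m + 2)).tangent (𝓡∂ (2 * m + 2)).tangent ∞
    (fun p : TangentBundle (𝓡∂ (2 * m + 2)) M =>
      (⟨p.proj, J p.proj p.snd⟩ : TangentBundle (𝓡∂ (2 * m + 2)) M))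
  J_sq : ∀ x v, J x (J x v) = -v
  J_symplectic : ∀ x v w, S.form.d x (J x v) (J x w) = S.form.d x v w
  J_positive : ∀ x v, v ≠ 0 → 0 < S.form.d x v (J x v)
  cls : C(M, BUOne)
  bundleMap : ∀ x : M, TangentSpace (𝓡∂ (2 * m + 2)) x [⋀^Fin (m + 1)]→ₗ[ℝ]
    (TangentSpace (𝓡∂ (2 * m + 2)) x [⋀^Fin (m + 1)]→ₗ[ℝ] Hilb)
  bundleMap_continuous : Continuous fun p : FramePair m M => bundleMap p.pt p.fst p.snd
  bundleMap_J_left : ∀ x u w i,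
    bundleMap x (Function.update u i (J x (u i))) w = Complex.I • bundleMap x u w
  bundleMap_J_right : ∀ x u w i,
    bundleMap x u (Function.update w i (J x (w i))) = Complex.I • bundleMap x u w
  bundleMap_mem : ∀ x u w, bundleMap x u w ∈ (cls x).line
  bundleMap_ne_zero : ∀ x, ∃ u w, bundleMap x u w ≠ 0

namespace ClassifiedACS

variable {S : LiouvilleSector m M Y}

/-- The almost complex structure as a self-map of the tangent bundle. -/
def toEnd (c : ClassifiedACS S) :
    C(TangentBundle (𝓡∂ (2 * m + 2)) M, TangentBundle (𝓡∂ (2 * m + 2)) M) :=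
  ⟨fun p => ⟨p.proj, c.J p.proj p.snd⟩, c.J_smooth.continuous⟩

/-- The bundle map as a function on tuples of tangent vectors. -/
def toBundleMap (c : ClassifiedACS S) : C(FramePair m M, Hilb) :=
  ⟨fun p => c.bundleMap p.pt p.fst p.snd, c.bundleMap_continuous⟩

/-- The compact-open topology on almost complex structures with classifying maps. -/
instance : TopologicalSpace (ClassifiedACS S) :=
  TopologicalSpace.induced (fun c => (c.toEnd, c.cls, c.toBundleMap)) inferInstance

theorem continuous_cls : Continuous (cls : ClassifiedACS S → C(M, BUOne)) :=
  have h : Continuous fun c : ClassifiedACS S => (c.toEnd, c.cls, c.toBundleMap) :=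
    continuous_induced_dom
  (continuous_fst.comp continuous_snd).comp h

/-- `c' = φ^* c`. -/
structure IsPullback (φ : LiouAut S) (c c' : ClassifiedACS S) : Prop where
  J_eq : ∀ x v, φ.deriv x (c'.J x v) = c.J (φ.toDiffeo x) (φ.deriv x v)
  cls_eq : c'.cls = c.cls.comp φ.toMap
  bundleMap_eq : ∀ x u w, c'.bundleMap x u w =
    c.bundleMap (φ.toDiffeo x) (fun i => φ.deriv x (u i)) (fun i => φ.deriv x (w i))

end ClassifiedACS

/-- `Liouaut^comp(M)`: Liouville automorphisms `φ` with a homotopy of `ω`-compatible almost complex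
structures (and of the maps classifying `det² TM`) from `φ^* c` to `c`. -/
structure LiouAutComp {S : LiouvilleSector m M Y} (c : ClassifiedACS S) where
  aut : LiouAut S
  homotopy : C(I, ClassifiedACS S)
  homotopy_zero : ClassifiedACS.IsPullback aut c (homotopy 0)
  homotopy_one : homotopy 1 = c

namespace LiouAutComp

variable {S : LiouvilleSector m M Y} {c : ClassifiedACS S}

instance : TopologicalSpace (LiouAutComp c) :=
  TopologicalSpace.induced (fun z => (z.aut, z.homotopy)) inferInstance

theorem continuous_aut : Continuous (aut : LiouAutComp c → LiouAut S) :=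
  have h : Continuous fun z : LiouAutComp c => (z.aut, z.homotopy) := continuous_induced_dom
  continuous_fst.comp h

/-- The map from `Liouaut^comp(M)` to the endomorphisms of `M` over `BU(1)`. -/
def toSliceEnd (z : LiouAutComp c) : SliceEnd c.cls where
  map := z.aut.toMap
  homotopy := (⟨ClassifiedACS.cls, ClassifiedACS.continuous_cls⟩ :
    C(ClassifiedACS S, C(M, BUOne))).comp z.homotopy
  homotopy_zero := z.homotopy_zero.cls_eq
  homotopy_one := congrArg ClassifiedACS.cls z.homotopy_one

end LiouAutComp

/-! ### Decorated automorphisms -/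

/-- A grading: a null-homotopy of the map `M → BU(1)` classifying `det² TM`. -/
structure Grading {S : LiouvilleSector m M Y} (c : ClassifiedACS S) where
  basepoint : BUOne
  nullHomotopy : C(M, PathsTo basepoint)
  start_eq : (PathsTo.start basepoint).comp nullHomotopy = c.cls

/-- `Liouaut^gr(M)`: the homotopy pullback of `Liouaut^comp(M) ≃ Liouaut⁰(M)` and the endomorphisms
of `M` over `* → BU(1)` (that is, over `BU(1)` and compatible with the null-homotopy), over the
endomorphisms of `M` over `BU(1)`. -/
abbrev LiouAutGr {S : LiouvilleSector m M Y} {c : ClassifiedACS S} (gr : Grading c) : Type _ :=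
  HomotopyPullback (LiouAutComp.toSliceEnd (c := c))
    (SliceEnd.push (PathsTo.start gr.basepoint) gr.start_eq)

/-- The forgetful map `Liouaut^gr(M) → Liouaut⁰(M)`. -/
def LiouAutGr.forget {S : LiouvilleSector m M Y} {c : ClassifiedACS S} (gr : Grading c) :
    C(LiouAutGr gr, LiouAut S) :=
  ⟨fun z => z.fst.aut,
    LiouAutComp.continuous_aut.comp (HomotopyPullback.continuous_fst _ _)⟩

/-- `Liouaut^b(M)`: the homotopy pullback of `Liouaut⁰(M)` and the endomorphisms of `(M, b)` over
`K`, over the self-maps of `M`. -/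
abbrev LiouAutB (S : LiouvilleSector m M Y) {K : Type w} [TopologicalSpace K] (b : C(M, K)) :
    Type _ :=
  HomotopyPullback (LiouAut.toMap (S := S)) (SliceEnd.map : SliceEnd b → C(M, M))

/-- The forgetful map `Liouaut^b(M) → Liouaut⁰(M)`. -/
def LiouAutB.forget (S : LiouvilleSector m M Y) {K : Type w} [TopologicalSpace K] (b : C(M, K)) :
    C(LiouAutB S b, LiouAut S) :=
  ⟨fun z => z.fst, HomotopyPullback.continuous_fst _ _⟩

/-- `Liouaut^{gr,b}(M)`: the homotopy pullback of `Liouaut^gr(M)` and `Liouaut^b(M)` over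
`Liouaut⁰(M)`. -/
abbrev LiouAutGrB {S : LiouvilleSector m M Y} {c : ClassifiedACS S} (gr : Grading c)
    {K : Type w} [TopologicalSpace K] (b : C(M, K)) : Type _ :=
  HomotopyPullback (LiouAutGr.forget gr) (LiouAutB.forget S b)

/-- The forgetful map `Liouaut^{gr,b}(M) → Liouaut⁰(M)`. -/
def LiouAutGrB.forget {S : LiouvilleSector m M Y} {c : ClassifiedACS S} (gr : Grading c)
    {K : Type w} [TopologicalSpace K] (b : C(M, K)) : C(LiouAutGrB gr b, LiouAut S) :=
  (LiouAutGr.forget gr).comp ⟨HomotopyPullback.fst, HomotopyPullback.continuous_fst _ _⟩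

end Sectors

end Liouville

end

/-!
A map `f` is injective on `π_k` and surjective on `π_l` if it has the right lifting property with
respect to the inclusion of the boundary of the cube `I^n` for `n = k + 1` and for `n = l`
(`piMap_injective`, `piMap_surjective`). The forgetful map has this property for all `n ≥ 3`
(`LiouAutGrB.hasLifting_forget`). It is the composition of three maps, which forget the background
class, the grading, and the path of almost complex structures.

All spaces involved are homotopy pullbacks and path spaces. A lift is therefore a collection of
families of paths and squares with prescribed boundary over `I^n`, which are given over the boundary
of `I^n`. Paths one of whose ends is free extend by the homotopy extension property of the cube
(`hasBoxRetraction_cube`). Paths with two prescribed ends, and squares, extend if maps to the target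
`Z` extend from the boundary of a cube of dimension `n + 1` or `n + 2` (`CubeExt`). The targets are
as follows.

* The space of compatible almost complex structures with a classifying map of `det²`
  (`LiouAutComp.hasLifting_forget`). It is contractible (`ClassifiedACS.contractibleSpace`): two
  compatible complex structures `a` and `b` are joined by the path `(1 - t C) a (1 - t C)⁻¹`, where
  `C = (b + a)⁻¹ (b - a)` is the Cayley transform, and the bundle maps to the Hilbert space, which
  vanish nowhere, are moved to a fixed one by means of the shifts onto the odd and the even basis
  vectors.
* The space of maps from `M` to the path space of `BU(1)` (`LiouAutGr.hasLifting_fstMap`), which is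
  contractible.
* The spaces of maps from `M` to `BU(1)`, for the dimension `n + 2`, and from `M` to `K`, for the
  dimension `n + 1`. These dimensions are at least `4`, and both `BU(1)` and `K` have no homotopy
  groups of degree at least `3`, so that maps to them extend from the boundaries of cubes of
  dimension at least `4` (`CubeExt.of_subsingleton_pi`). By obstruction theory, this property is
  inherited by the spaces of maps from a manifold (`CubeExt.continuousMap`); the extension is
  constructed on one coordinate cube of `M` after the other.

To lift a family of automorphisms `φ` to paths of almost complex structures, `φ^* J` has to be a
compatible almost complex structure which depends continuously on `φ`. The compatibility holds
because `φ^* θ - θ` is exact, and hence `φ` preserves `dθ` (`OneForm.IsSmooth.d_mfderiv`). For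
the continuity (`ClassifiedACS.continuous_pullback`), the weak Whitney topology controls the first
derivatives of `φ`, uniformly on compact subsets of the charts.
-/

noncomputable section

namespace Liouville

/-! ### Extension problems on cubes -/

section Extension

variable {X : Type*} {Y : Type*} {Z : Type*} [TopologicalSpace X] [TopologicalSpace Y]
  [TopologicalSpace Z]

/-- Every map to `Z` defined and continuous on the subset `S` of `X` extends to all of `X`. -/
def Extends (S : Set X) (Z : Type*) [TopologicalSpace Z] : Prop :=
  ∀ f : X → Z, ContinuousOn f S → ∃ g : C(X, Z), Set.EqOn g f S

/-- Maps to `Z` extend from the boundary of the `n`-cube to the `n`-cube. -/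
abbrev CubeExt (n : ℕ) (Z : Type*) [TopologicalSpace Z] : Prop :=
  Extends (Cube.boundary (Fin n)) Z

/-- The boundary of the prism `X × I`, where `S` is regarded as the boundary of `X`. -/
def prism (S : Set X) : Set (X × I) := {p | p.1 ∈ S ∨ p.2 = 0 ∨ p.2 = 1}

/-- The union of the bottom and of the sides of the prism `X × I`. -/
def box (S : Set X) : Set (X × I) := {p | p.1 ∈ S ∨ p.2 = 0}

/-- The prism `X × I` retracts onto the union of its bottom and its sides: this is the homotopy
extension property of the pair `(X, S)`. -/
def HasBoxRetraction (S : Set X) : Prop :=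
  ∃ ρ : C(X × I, X × I), (∀ p, ρ p ∈ box S) ∧ ∀ p ∈ box S, ρ p = p

theorem isClosed_box {S : Set X} (hS : IsClosed S) : IsClosed (box S) :=
  (hS.preimage continuous_fst).union (isClosed_singleton.preimage continuous_snd)

theorem isClosed_prism {S : Set X} (hS : IsClosed S) : IsClosed (prism S) :=
  (hS.preimage continuous_fst).union ((isClosed_singleton.preimage continuous_snd).union
    (isClosed_singleton.preimage continuous_snd))

theorem HasBoxRetraction.extends {S : Set X} (h : HasBoxRetraction S) : Extends (box S) Z := by
  obtain ⟨ρ, h₁, h₂⟩ := h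
  intro f hf
  exact ⟨⟨fun p => f (ρ p), hf.comp_continuous ρ.continuous h₁⟩, fun p hp => congrArg f (h₂ p hp)⟩

theorem Extends.of_homeomorph {S : Set X} {T : Set Y} (e : X ≃ₜ Y) (he : ∀ x, e x ∈ T ↔ x ∈ S)
    (h : Extends S Z) : Extends T Z := by
  intro f hf
  obtain ⟨g, hg⟩ := h (f ∘ e) (hf.comp e.continuous.continuousOn fun x hx => (he x).2 hx)
  refine ⟨g.comp ⟨e.symm, e.symm.continuous⟩, fun y hy => ?_⟩
  have := hg ((he (e.symm y)).1 (by simpa using hy))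
  simpa using this

theorem HasBoxRetraction.of_homeomorph {S : Set X} {T : Set Y} (e : X ≃ₜ Y)
    (he : ∀ x, e x ∈ T ↔ x ∈ S) (h : HasBoxRetraction S) : HasBoxRetraction T := by
  obtain ⟨ρ, h₁, h₂⟩ := h
  let E := e.prodCongr (Homeomorph.refl I)
  refine ⟨⟨fun p => E (ρ (E.symm p)), by fun_prop⟩, fun p => ?_, fun p hp => ?_⟩
  · rcases h₁ (E.symm p) with h | h
    · exact Or.inl ((he _).2 h)
    · exact Or.inr h
  · have : E.symm p ∈ box S := by
      rcases hp with h | h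
      · exact Or.inl ((he _).1 (by simpa [E] using h))
      · exact Or.inr h
    change E (ρ (E.symm p)) = p
    rw [h₂ _ this, Homeomorph.apply_symm_apply]

/-- The `n + 1`-cube as a prism over the `n`-cube. -/
def cubeSucc (n : ℕ) : (Fin n → I) × I ≃ₜ (Fin (n + 1) → I) where
  toFun p := Fin.cons p.2 p.1
  invFun y := (Fin.tail y, y 0)
  left_inv p := by simp
  right_inv y := by simp
  continuous_toFun := by
    refine continuous_pi fun i => ?_
    refine Fin.cases ?_ (fun j => ?_) i
    · simpa using continuous_snd
    · simpa using (by fun_prop : Continuous fun p : (Fin n → I) × I => p.1 j)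
  continuous_invFun := by
    refine Continuous.prodMk (continuous_pi fun j => continuous_apply _) (continuous_apply _)

theorem cubeSucc_mem_boundary {n : ℕ} (p : (Fin n → I) × I) :
    cubeSucc n p ∈ Cube.boundary (Fin (n + 1)) ↔ p ∈ prism (Cube.boundary (Fin n)) := by
  change (∃ i : Fin (n + 1), (Fin.cons p.2 p.1 : Fin (n + 1) → I) i = 0 ∨
    (Fin.cons p.2 p.1 : Fin (n + 1) → I) i = 1) ↔ (∃ i, p.1 i = 0 ∨ p.1 i = 1) ∨ _
  rw [Fin.exists_fin_succ]
  simp [or_comm]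

theorem CubeExt.prism {n : ℕ} (h : CubeExt (n + 1) Z) :
    Extends (prism (Cube.boundary (Fin n))) Z :=
  Extends.of_homeomorph (cubeSucc n).symm
    (fun x => by rw [← cubeSucc_mem_boundary, Homeomorph.apply_symm_apply]) h

theorem isClosed_cube_boundary (n : ℕ) : IsClosed (Cube.boundary (Fin n)) := by
  have : Cube.boundary (Fin n) = ⋃ i, {y | y i = 0} ∪ {y | y i = 1} := by
    ext y
    simp [Cube.boundary]
  rw [this]
  exact isClosed_iUnion_of_finite fun i =>
    (isClosed_singleton.preimage (continuous_apply i)).union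
      (isClosed_singleton.preimage (continuous_apply i))

/-- The distance, in the supremum norm, from the centre of the cube. -/
def cubeRadius {n : ℕ} (x : Fin n → I) : ℝ := ‖fun i => (x i : ℝ) - 1 / 2‖

theorem continuous_cubeRadius {n : ℕ} : Continuous (cubeRadius : (Fin n → I) → ℝ) := by
  unfold cubeRadius
  fun_prop

theorem abs_le_cubeRadius {n : ℕ} (x : Fin n → I) (i : Fin n) :
    |(x i : ℝ) - 1 / 2| ≤ cubeRadius x := norm_le_pi_norm (fun i => (x i : ℝ) - 1 / 2) i

theorem cubeRadius_le {n : ℕ} (x : Fin n → I) : cubeRadius x ≤ 1 / 2 := by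
  refine (pi_norm_le_iff_of_nonneg (by norm_num)).2 fun i => ?_
  have h := (x i).2
  rw [Real.norm_eq_abs, abs_le]
  constructor <;> linarith [h.1, h.2]

theorem exists_cubeRadius_eq {n : ℕ} (x : Fin n → I) (h : 0 < cubeRadius x) :
    ∃ i, |(x i : ℝ) - 1 / 2| = cubeRadius x := by
  by_contra! hne
  have := (pi_norm_lt_iff (x := fun i => (x i : ℝ) - 1 / 2) h).2 fun i =>
    lt_of_le_of_ne (abs_le_cubeRadius x i) (hne i)
  exact lt_irrefl _ this

theorem cubeRadius_eq_of_mem_boundary {n : ℕ} {x : Fin n → I} (hx : x ∈ Cube.boundary (Fin n)) :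
    cubeRadius x = 1 / 2 := by
  refine le_antisymm (cubeRadius_le x) ?_
  obtain ⟨i, hi⟩ := hx
  refine le_trans ?_ (abs_le_cubeRadius x i)
  rcases hi with hi | hi <;> rw [hi] <;> norm_num [abs_of_nonneg, abs_of_neg]

/-- The boundary of the cube has the homotopy extension property. The retraction of the prism
`[-1, 1]ⁿ × I` onto its bottom and sides is the projection from the point `(0, 2)`: it maps `(y, t)`
to `(y / a, 2 - (2 - t) / a)` where `a = max ‖y‖ (1 - t / 2)`. -/
theorem hasBoxRetraction_cube (n : ℕ) : HasBoxRetraction (Cube.boundary (Fin n)) := by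
  let a : (Fin n → I) × I → ℝ := fun p => max (2 * cubeRadius p.1) (1 - (p.2 : ℝ) / 2)
  have ha : Continuous a := by
    have := continuous_cubeRadius (n := n)
    fun_prop
  have ha0 : ∀ p, 0 < a p := fun p =>
    lt_of_lt_of_le (by linarith [p.2.2.2]) (le_max_right _ _)
  have ha1 : ∀ p, a p ≤ 1 := fun p =>
    max_le (by linarith [cubeRadius_le p.1]) (by linarith [p.2.2.1])
  have hI : ∀ {t : ℝ} {s : I}, t = s → Set.projIcc (0 : ℝ) 1 zero_le_one t = s := by
    rintro t s rfl
    exact Set.projIcc_val _ _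
  let ρ : C((Fin n → I) × I, (Fin n → I) × I) :=
    ⟨fun p => (fun i => Set.projIcc 0 1 zero_le_one (1 / 2 + ((p.1 i : ℝ) - 1 / 2) / a p),
      Set.projIcc 0 1 zero_le_one (2 - (2 - (p.2 : ℝ)) / a p)), by
      refine Continuous.prodMk (continuous_pi fun i => continuous_projIcc.comp ?_)
        (continuous_projIcc.comp ?_)
      · exact continuous_const.add (Continuous.div (by fun_prop) ha fun p => (ha0 p).ne')
      · exact continuous_const.sub (Continuous.div (by fun_prop) ha fun p => (ha0 p).ne')⟩
  refine ⟨ρ, fun p => ?_, fun p hp => ?_⟩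
  · rcases le_total (2 * cubeRadius p.1) (1 - (p.2 : ℝ) / 2) with h | h
    · right
      have : a p = 1 - (p.2 : ℝ) / 2 := max_eq_right h
      refine hI (s := 0) ?_
      have h0 := ha0 p
      rw [this] at h0
      rw [this]
      rw [Set.Icc.coe_zero, show 2 - (p.2 : ℝ) = 2 * (1 - (p.2 : ℝ) / 2) by ring,
        mul_div_assoc, div_self h0.ne']
      norm_num
    · left
      have hap : a p = 2 * cubeRadius p.1 := max_eq_left h
      have h0 := ha0 p
      obtain ⟨i, hi⟩ := exists_cubeRadius_eq p.1 (by linarith)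
      refine ⟨i, ?_⟩
      rcases abs_choice ((p.1 i : ℝ) - 1 / 2) with hc | hc
      · right
        refine hI (s := 1) ?_
        rw [← hc, hi, hap]
        rw [hap] at h0
        simp only [Set.Icc.coe_one]
        have : cubeRadius p.1 ≠ 0 := by linarith
        field_simp
        ring
      · left
        refine hI (s := 0) ?_
        have : (p.1 i : ℝ) - 1 / 2 = - cubeRadius p.1 := by rw [← hi, hc]; ring
        rw [this, hap]
        rw [hap] at h0
        simp only [Set.Icc.coe_zero]
        have : cubeRadius p.1 ≠ 0 := by linarith
        field_simp
        ring
  · have hap : a p = 1 := by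
      refine le_antisymm (ha1 p) ?_
      rcases hp with h | h
      · refine le_trans ?_ (le_max_left _ _)
        rw [cubeRadius_eq_of_mem_boundary h]
        norm_num
      · refine le_trans ?_ (le_max_right _ _)
        rw [h]
        norm_num
    refine Prod.ext (funext fun i => hI ?_) (hI ?_)
    · rw [hap]; ring
    · rw [hap]; ring

theorem hasBoxRetraction_prism (n : ℕ) : HasBoxRetraction (prism (Cube.boundary (Fin n))) :=
  HasBoxRetraction.of_homeomorph (cubeSucc n).symm
    (fun x => by rw [← cubeSucc_mem_boundary, Homeomorph.apply_symm_apply])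
    (hasBoxRetraction_cube (n + 1))

/-- Homotopy extension: a homotopy over `S` of the restriction of `g` extends to a homotopy of `g`
over `X`. -/
theorem HasBoxRetraction.exists_extension_of_homotopy {S : Set X} (hS : IsClosed S)
    (hB : HasBoxRetraction S) (g : C(X, Z)) (h : X × I → Z)
    (hh : ContinuousOn h (S ×ˢ Set.univ)) (h₀ : ∀ x ∈ S, h (x, 0) = g x) :
    ∃ H : C(X × I, Z), (∀ x, H (x, 0) = g x) ∧ ∀ x ∈ S, ∀ t, H (x, t) = h (x, t) := by
  classical
  let k : X × I → Z := fun p => if p.2 = 0 then g p.1 else h p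
  have hk₁ : ∀ p : X × I, p.1 ∈ S → k p = h p := by
    rintro ⟨x, t⟩ hx
    by_cases ht : t = 0
    · subst ht
      simp [k, h₀ x hx]
    · simp [k, ht]
  have hk₂ : ∀ p : X × I, p.2 = 0 → k p = g p.1 := fun p hp => by simp [k, hp]
  have hk : ContinuousOn k (box S) := by
    refine ContinuousOn.union_of_isClosed (s := {p : X × I | p.1 ∈ S}) (t := {p | p.2 = 0}) ?_ ?_
      (hS.preimage continuous_fst) (isClosed_singleton.preimage continuous_snd)
    · exact (hh.mono fun p hp => ⟨hp, trivial⟩).congr fun p hp => hk₁ p hp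
    · exact (g.continuous.comp continuous_fst).continuousOn.congr fun p hp => hk₂ p hp
  obtain ⟨H, hH⟩ := hB.extends k hk
  exact ⟨H, fun x => (hH (Or.inr rfl)).trans (hk₂ _ rfl),
    fun x hx t => (hH (Or.inl hx)).trans (hk₁ _ hx)⟩

theorem Extends.of_contractible [ContractibleSpace Z] {S : Set X} (hS : IsClosed S)
    (hB : HasBoxRetraction S) : Extends S Z := by
  intro f hf
  obtain ⟨z, ⟨F⟩⟩ := id_nullhomotopic Z
  obtain ⟨H, -, hH⟩ := hB.exists_extension_of_homotopy hS (ContinuousMap.const X z)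
    (fun p => F (σ p.2, f p.1))
    (F.continuous.comp_continuousOn (ContinuousOn.prodMk (by fun_prop)
      (hf.comp continuous_fst.continuousOn fun p hp => hp.1))) (fun x hx => by simp)
  exact ⟨⟨fun x => H (x, 1), by fun_prop⟩, fun x hx => by simpa using hH x hx 1⟩

/-- If the `n`-th homotopy groups of `K` vanish then maps to `K` extend from the boundary of the
`n + 1`-cube: the union of all faces but one is contractible, so that a map on the boundary is
homotopic to one which is constant on this union. The remaining face then gives an element of the
homotopy group. -/
theorem CubeExt.of_subsingleton_pi {K : Type*} [TopologicalSpace K] {n : ℕ}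
    (hK : ∀ y : K, Subsingleton (HomotopyGroup.Pi n K y)) : CubeExt (n + 1) K := by
  classical
  refine Extends.of_homeomorph (S := Liouville.prism (Cube.boundary (Fin n))) (cubeSucc n)
    cubeSucc_mem_boundary ?_
  intro f hf
  obtain ⟨ρ, hρ₁, hρ₂⟩ := hasBoxRetraction_cube n
  have hbox : box (Cube.boundary (Fin n)) ⊆ Liouville.prism (Cube.boundary (Fin n)) := by
    rintro p (h | h)
    · exact Or.inl h
    · exact Or.inr (Or.inl h)
  have hfρ : Continuous (f ∘ ρ) := hf.comp_continuous ρ.continuous fun p => hbox (hρ₁ p)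
  -- the scaling of the box towards the vertex `0`
  let c : ((Fin n → I) × I) × I → (Fin n → I) × I := fun q =>
    (fun i => σ q.2 * q.1.1 i, σ q.2 * q.1.2)
  have hc : Continuous c := by
    refine Continuous.prodMk (continuous_pi fun i => ?_) ?_ <;> fun_prop
  have hc0 : ∀ p, c (p, 0) = p := fun p => by simp [c]
  have hc1 : ∀ p, c (p, 1) = 0 := fun p => by
    simp only [c, unitInterval.symm_one, zero_mul]
    rfl
  let y : K := f (ρ 0)
  have hB := hasBoxRetraction_cube n
  have hcl := isClosed_cube_boundary n
  -- the homotopy on the top face, compatible with the contraction of the box on its boundary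
  obtain ⟨T, hT₀, hT₁⟩ := hB.exists_extension_of_homotopy hcl
    ⟨fun x => f (x, 1), hf.comp_continuous (by fun_prop) fun x => Or.inr (Or.inr rfl)⟩
    (fun q => f (ρ (c ((q.1, 1), q.2))))
    ((hfρ.comp (hc.comp (by fun_prop))).continuousOn) (fun x hx => by
      simp only [hc0]
      exact congrArg f (hρ₂ _ (Or.inl hx)))
  let h : ((Fin n → I) × I) × I → K := fun q =>
    if q.1.2 = 1 then T (q.1.1, q.2) else f (ρ (c q))
  have hh₁ : ∀ p ∈ box (Cube.boundary (Fin n)), ∀ t, h (p, t) = f (ρ (c (p, t))) := by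
    rintro ⟨x, s⟩ hp t
    by_cases hs : s = 1
    · subst hs
      have hx : x ∈ Cube.boundary (Fin n) := by
        rcases hp with hp | hp
        · exact hp
        · exact absurd hp (by simp)
      simp [h, hT₁ x hx]
    · simp [h, hs]
  have hh₂ : ∀ x t, h ((x, 1), t) = T (x, t) := fun x t => by simp [h]
  have hhc : ContinuousOn h (Liouville.prism (Cube.boundary (Fin n)) ×ˢ Set.univ) := by
    have : Liouville.prism (Cube.boundary (Fin n)) ×ˢ (Set.univ : Set I) =
        (box (Cube.boundary (Fin n)) ×ˢ Set.univ) ∪ {q | q.1.2 = 1} := by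
      ext ⟨⟨x, s⟩, t⟩
      simp [Liouville.prism, box, or_assoc]
    rw [this]
    refine ContinuousOn.union_of_isClosed ?_ ?_ ((isClosed_box hcl).prod isClosed_univ)
      (isClosed_singleton.preimage (continuous_snd.comp continuous_fst))
    · exact (hfρ.comp hc).continuousOn.congr fun q hq => hh₁ q.1 hq.1 q.2
    · refine (Continuous.continuousOn (f := fun q : ((Fin n → I) × I) × I => T (q.1.1, q.2))
        (by fun_prop)).congr ?_
      rintro ⟨⟨x, s⟩, t⟩ (rfl : s = 1)
      exact hh₂ x t
  -- at the end of the homotopy, the map is constant on the box and equal to `ℓ` on the top face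
  let ℓ : GenLoop (Fin n) K y := ⟨⟨fun x => T (x, 1), by fun_prop⟩, fun x hx => by
    change T (x, 1) = y
    rw [hT₁ x hx]
    simp only [hc1]
    rfl⟩
  have hℓ : GenLoop.Homotopic ℓ GenLoop.const :=
    Quotient.exact ((hK y).elim (⟦ℓ⟧ : HomotopyGroup.Pi n K y) ⟦GenLoop.const⟧)
  obtain ⟨F⟩ := hℓ
  let g : C((Fin n → I) × I, K) := ⟨fun p => F (σ p.2, p.1), by fun_prop⟩
  have hF : ∀ s, ∀ x ∈ Cube.boundary (Fin n), F (s, x) = y := fun s x hx =>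
    (F.eq_fst s hx).trans (ℓ.2 x hx)
  have hg : ∀ p ∈ Liouville.prism (Cube.boundary (Fin n)), h (p, 1) = g p := by
    rintro ⟨x, s⟩ hp
    have hb : (x, s) ∈ box (Cube.boundary (Fin n)) → h ((x, s), 1) = y := fun hb => by
      rw [hh₁ _ hb, hc1]
    rcases hp with hp | rfl | rfl
    · rw [hb (Or.inl hp)]
      exact (hF _ x hp).symm
    · rw [hb (Or.inr rfl)]
      change y = F (σ 0, x)
      rw [unitInterval.symm_zero, F.apply_one]
      rfl
    · rw [hh₂]
      change _ = F (σ 1, x)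
      rw [unitInterval.symm_one, F.apply_zero]
      rfl
  obtain ⟨H, -, hH⟩ := (hasBoxRetraction_prism n).exists_extension_of_homotopy
    (isClosed_prism hcl) g (fun q => h (q.1, σ q.2))
    (hhc.comp (Continuous.continuousOn (by fun_prop)) fun q hq => ⟨hq.1, trivial⟩)
    (fun p hp => by simpa using hg p hp)
  refine ⟨⟨fun p => H (p, 1), by fun_prop⟩, fun p hp => ?_⟩
  change H (p, 1) = f p
  rw [hH p hp 1]
  simp only [unitInterval.symm_one]
  obtain ⟨x, s⟩ := p
  by_cases hs : s = 1
  · subst hs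
    rw [hh₂, hT₀]
    rfl
  · have hb : (x, s) ∈ box (Cube.boundary (Fin n)) := by
      rcases hp with hp | hp | hp
      · exact Or.inl hp
      · exact Or.inr hp
      · exact absurd hp hs
    rw [hh₁ _ hb, hc0, hρ₂ _ hb]

end Extension

/-! ### Lifting problems on cubes -/

section Lifting

variable {X : Type*} {Y : Type*} {E : Type*} {B : Type*} [TopologicalSpace X] [TopologicalSpace Y]
  [TopologicalSpace E] [TopologicalSpace B]

/-- Every lift along `p` of a map `h : X → B` which is given on the subset `S` of `X` extends to a
lift on `X`. -/
def HasLifting (S : Set X) (p : C(E, B)) : Prop :=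
  ∀ (h : C(X, B)) (l : X → E), ContinuousOn l S → (∀ x ∈ S, p (l x) = h x) →
    ∃ L : C(X, E), (∀ x, p (L x) = h x) ∧ Set.EqOn L l S

theorem HasLifting.comp {C : Type*} [TopologicalSpace C] {S : Set X} {p : C(E, B)} {q : C(B, C)}
    (hq : HasLifting S q) (hp : HasLifting S p) : HasLifting S (q.comp p) := by
  intro h l hl hlS
  obtain ⟨M, hM, hMS⟩ := hq h (p ∘ l) (p.continuous.comp_continuousOn hl) hlS
  obtain ⟨L, hL, hLS⟩ := hp M l hl fun x hx => (hMS hx).symm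
  exact ⟨L, fun x => by simp [hL, hM], hLS⟩

theorem HasLifting.of_homeomorph {S : Set X} {T : Set Y} {p : C(E, B)} (e : X ≃ₜ Y)
    (he : ∀ x, e x ∈ T ↔ x ∈ S) (h : HasLifting S p) : HasLifting T p := by
  intro f l hl hlT
  obtain ⟨L, hL, hLS⟩ := h (f.comp ⟨e, e.continuous⟩) (l ∘ e)
    (hl.comp e.continuous.continuousOn fun x hx => (he x).2 hx) fun x hx => hlT _ ((he x).2 hx)
  refine ⟨L.comp ⟨e.symm, e.symm.continuous⟩, fun y => by simp [hL], fun y hy => ?_⟩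
  have := hLS ((he (e.symm y)).1 (by simpa using hy))
  simpa using this

theorem piMap_surjective {k : ℕ} {f : C(X, Y)} (x : X)
    (h : HasLifting (Cube.boundary (Fin k)) f) : Function.Surjective (piMap k f x) := by
  intro a
  induction a using Quotient.inductionOn with | _ p => ?_
  obtain ⟨L, hL, hLS⟩ := h p.1 (fun _ => x) continuousOn_const fun y hy => (p.2 y hy).symm
  refine ⟨⟦⟨L, fun y hy => hLS hy⟩⟧, ?_⟩
  refine congrArg (fun z => (⟦z⟧ : HomotopyGroup.Pi k Y (f x))) ?_
  exact GenLoop.ext _ _ hL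

/-- A homotopy between the images of two spheres is a map from a prism, which is lifted over the
bottom and the top by the two spheres, and over the sides by the constant map. -/
theorem piMap_injective {k : ℕ} {f : C(X, Y)} (x : X)
    (h : HasLifting (Cube.boundary (Fin (k + 1))) f) : Function.Injective (piMap k f x) := by
  classical
  intro a b hab
  induction a using Quotient.inductionOn with | _ p => ?_
  induction b using Quotient.inductionOn with | _ q => ?_
  obtain ⟨F⟩ := Quotient.exact hab
  have h' : HasLifting (prism (Cube.boundary (Fin k))) f :=
    HasLifting.of_homeomorph (cubeSucc k).symm
      (fun x => by rw [← cubeSucc_mem_boundary, Homeomorph.apply_symm_apply]) h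
  let l : (Fin k → I) × I → X := fun z => if z.2 = 0 then p z.1 else q z.1
  have hl₀ : ∀ z : (Fin k → I) × I, z.2 = 0 → l z = p z.1 := fun z hz => by simp [l, hz]
  have hl₁ : ∀ z : (Fin k → I) × I, z.2 = 1 → l z = q z.1 := fun z hz => by simp [l, hz]
  have hlb : ∀ z : (Fin k → I) × I, z.1 ∈ Cube.boundary (Fin k) → l z = x := by
    intro z hz
    by_cases h0 : z.2 = 0
    · rw [hl₀ z h0]
      exact p.2 _ hz
    · simp only [l, h0, if_false]
      exact q.2 _ hz
  have hcont : ContinuousOn l (prism (Cube.boundary (Fin k))) := by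
    have c0 : IsClosed {z : (Fin k → I) × I | z.2 = 0} := isClosed_singleton.preimage continuous_snd
    have c1 : IsClosed {z : (Fin k → I) × I | z.2 = 1} := isClosed_singleton.preimage continuous_snd
    refine ContinuousOn.union_of_isClosed ?_ (ContinuousOn.union_of_isClosed ?_ ?_ c0 c1)
      ((isClosed_cube_boundary k).preimage continuous_fst) (c0.union c1)
    · exact continuousOn_const.congr fun z hz => hlb z hz
    · exact (p.1.continuous.comp continuous_fst).continuousOn.congr fun z hz => hl₀ z hz
    · exact (q.1.continuous.comp continuous_fst).continuousOn.congr fun z hz => hl₁ z hz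
  have hF : ∀ s, ∀ y ∈ Cube.boundary (Fin k), F (s, y) = f x := fun s y hy =>
    (F.eq_fst s hy).trans (congrArg f (p.2 y hy))
  obtain ⟨L, hL, hLS⟩ := h' ⟨fun z => F (z.2, z.1), by fun_prop⟩ l hcont (by
    rintro ⟨y, s⟩ (hy | hs | hs)
    · rw [hlb _ hy]
      exact (hF s y hy).symm
    · rw [hl₀ _ hs]
      obtain rfl : s = 0 := hs
      exact (F.apply_zero y).symm
    · rw [hl₁ _ hs]
      obtain rfl : s = 1 := hs
      exact (F.apply_one y).symm)
  refine Quotient.sound ⟨⟨⟨⟨fun z => L (z.2, z.1), by fun_prop⟩, fun y => ?_, fun y => ?_⟩, ?_⟩⟩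
  · exact (hLS (Or.inr (Or.inl rfl))).trans (hl₀ _ rfl)
  · exact (hLS (Or.inr (Or.inr rfl))).trans (hl₁ _ rfl)
  · intro t y hy
    refine ((hLS (Or.inl hy)).trans (hlb (y, t) hy)).trans ?_
    exact (p.2 y hy).symm

/-- Maps on the bottom, on the top and on the sides of a prism fit together. -/
theorem continuousOn_prism_ite {X Z : Type*} [TopologicalSpace X] [TopologicalSpace Z]
    {S : Set X} (hS : IsClosed S) {p₀ p₁ g : X × I → Z} (h₀ : Continuous p₀) (h₁ : Continuous p₁)
    (hg : ContinuousOn g (S ×ˢ Set.univ)) (e₀ : ∀ x ∈ S, p₀ (x, 0) = g (x, 0))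
    (e₁ : ∀ x ∈ S, p₁ (x, 1) = g (x, 1)) :
    ContinuousOn (fun z => if z.2 = 0 then p₀ z else if z.2 = 1 then p₁ z else g z) (prism S) := by
  have c0 : IsClosed {z : X × I | z.2 = 0} := isClosed_singleton.preimage continuous_snd
  have c1 : IsClosed {z : X × I | z.2 = 1} := isClosed_singleton.preimage continuous_snd
  refine ContinuousOn.union_of_isClosed ?_ (ContinuousOn.union_of_isClosed ?_ ?_ c0 c1)
    (hS.preimage continuous_fst) (c0.union c1)
  · refine (hg.mono fun z hz => ⟨hz, trivial⟩).congr ?_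
    rintro ⟨x, t⟩ hx
    change (if t = 0 then _ else if t = 1 then _ else _) = _
    split_ifs with h h
    · rw [h]; exact e₀ x hx
    · rw [h]; exact e₁ x hx
    · rfl
  · exact h₀.continuousOn.congr fun z hz => by simp [show z.2 = 0 from hz]
  · exact h₁.continuousOn.congr fun z hz => by simp [show z.2 = 1 from hz]

/-- A family of paths with prescribed end points, given over `S`, extends to `X` if maps to `Z`
extend from the boundary of the prism over `X`. -/
theorem Extends.exists_family_of_paths {Z : Type*} [TopologicalSpace Z] {S : Set X}
    (hS : IsClosed S) (hZ : Extends (prism S) Z) (p₀ p₁ : C(X, Z)) (g : X × I → Z)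
    (hg : ContinuousOn g (S ×ˢ Set.univ)) (hg₀ : ∀ x ∈ S, g (x, 0) = p₀ x)
    (hg₁ : ∀ x ∈ S, g (x, 1) = p₁ x) :
    ∃ G : C(X × I, Z), (∀ x, G (x, 0) = p₀ x) ∧ (∀ x, G (x, 1) = p₁ x) ∧
      ∀ x ∈ S, ∀ t, G (x, t) = g (x, t) := by
  classical
  obtain ⟨G, hG⟩ := hZ _ (continuousOn_prism_ite hS (p₀.continuous.comp continuous_fst)
    (p₁.continuous.comp continuous_fst) hg (fun x hx => (hg₀ x hx).symm)
    fun x hx => (hg₁ x hx).symm)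
  refine ⟨G, fun x => (hG (Or.inr (Or.inl rfl))).trans (by simp),
    fun x => (hG (Or.inr (Or.inr rfl))).trans (by simp), fun x hx t => (hG (Or.inl hx)).trans ?_⟩
  simp only [Function.comp_apply]
  split_ifs with h h
  · rw [h, hg₀ x hx]
  · rw [h, hg₁ x hx]
  · rfl

/-- A family of squares with prescribed boundary, given over `S`, extends to `X` if maps to `Z`
extend from the boundary of the prism over the prism over `X`. -/
theorem Extends.exists_family_of_squares {Z : Type*} [TopologicalSpace Z] {S : Set X}
    (hS : IsClosed S) (hZ : Extends (prism (prism S)) Z) (p₀ p₁ q₀ q₁ : C(X × I, Z))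
    (g : (X × I) × I → Z) (hg : ContinuousOn g ((S ×ˢ Set.univ) ×ˢ Set.univ))
    (hpq : ∀ x, p₀ (x, 0) = q₀ (x, 0) ∧ p₀ (x, 1) = q₁ (x, 0) ∧ p₁ (x, 0) = q₀ (x, 1) ∧
      p₁ (x, 1) = q₁ (x, 1))
    (hg₀ : ∀ x ∈ S, ∀ s, g ((x, s), 0) = p₀ (x, s)) (hg₁ : ∀ x ∈ S, ∀ s, g ((x, s), 1) = p₁ (x, s))
    (hg₀' : ∀ x ∈ S, ∀ t, g ((x, 0), t) = q₀ (x, t))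
    (hg₁' : ∀ x ∈ S, ∀ t, g ((x, 1), t) = q₁ (x, t)) :
    ∃ G : C((X × I) × I, Z), (∀ x s, G ((x, s), 0) = p₀ (x, s)) ∧
      (∀ x s, G ((x, s), 1) = p₁ (x, s)) ∧ (∀ x t, G ((x, 0), t) = q₀ (x, t)) ∧
      (∀ x t, G ((x, 1), t) = q₁ (x, t)) ∧ ∀ x ∈ S, ∀ s t, G ((x, s), t) = g ((x, s), t) := by
  classical
  let k : (X × I) × I → Z := fun z =>
    if z.1.2 = 0 then q₀ (z.1.1, z.2) else if z.1.2 = 1 then q₁ (z.1.1, z.2) else g z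
  have hk₀ : ∀ x t, k ((x, 0), t) = q₀ (x, t) := fun x t => by simp [k]
  have hk₁ : ∀ x t, k ((x, 1), t) = q₁ (x, t) := fun x t => by simp [k]
  have hkS : ∀ x ∈ S, ∀ s t, k ((x, s), t) = g ((x, s), t) := by
    intro x hx s t
    simp only [k]
    split_ifs with h h
    · rw [h, hg₀' x hx]
    · rw [h, hg₁' x hx]
    · rfl
  have hk : ContinuousOn k (prism S ×ˢ Set.univ) := by
    have := (continuousOn_prism_ite (X := X × I) (S := S ×ˢ Set.univ) (hS.prod isClosed_univ)
      (p₀ := fun q => q₀ q.1) (p₁ := fun q => q₁ q.1) (g := fun q => g ((q.1.1, q.2), q.1.2))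
      (by fun_prop) (by fun_prop) (hg.comp (by fun_prop) fun q hq => ⟨⟨hq.1.1, trivial⟩, trivial⟩)
      (fun q hq => (hg₀' q.1 hq.1 q.2).symm) (fun q hq => (hg₁' q.1 hq.1 q.2).symm)).comp
      (f := fun z : (X × I) × I => ((z.1.1, z.2), z.1.2)) (s := prism S ×ˢ Set.univ)
      (by fun_prop) fun z hz => hz.1.imp_left fun h => ⟨h, trivial⟩
    exact this
  have hcase : ∀ {P : I → Prop} {x : X} {s : I}, (x, s) ∈ prism S → (x ∈ S → P s) → P 0 → P 1 →
      P s := by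
    rintro P x s (h | h | h) hS h₀ h₁
    · exact hS h
    · exact (show s = 0 from h) ▸ h₀
    · exact (show s = 1 from h) ▸ h₁
  obtain ⟨G, hG₀, hG₁, hG⟩ := hZ.exists_family_of_paths (isClosed_prism hS) p₀ p₁ k hk
    (fun z hz => hcase (P := fun s => k ((z.1, s), 0) = p₀ (z.1, s)) hz
      (fun h => (hkS _ h _ _).trans (hg₀ _ h _)) ((hk₀ _ _).trans (hpq _).1.symm)
      ((hk₁ _ _).trans (hpq _).2.1.symm))
    (fun z hz => hcase (P := fun s => k ((z.1, s), 1) = p₁ (z.1, s)) hz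
      (fun h => (hkS _ h _ _).trans (hg₁ _ h _)) ((hk₀ _ _).trans (hpq _).2.2.1.symm)
      ((hk₁ _ _).trans (hpq _).2.2.2.symm))
  exact ⟨G, fun x s => hG₀ _, fun x s => hG₁ _,
    fun x t => (hG _ (Or.inr (Or.inl rfl)) t).trans (hk₀ x t),
    fun x t => (hG _ (Or.inr (Or.inr rfl)) t).trans (hk₁ x t),
    fun x hx s t => (hG _ (Or.inl hx) t).trans (hkS x hx s t)⟩

theorem CubeExt.prism_prism {n : ℕ} {Z : Type*} [TopologicalSpace Z] (hZ : CubeExt (n + 2) Z) :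
    Extends (Liouville.prism (Liouville.prism (Cube.boundary (Fin n)))) Z :=
  Extends.of_homeomorph ((cubeSucc n).symm.prodCongr (Homeomorph.refl I))
    (fun p => by
      refine or_congr_left ?_
      rw [← cubeSucc_mem_boundary]
      simp) hZ.prism

end Lifting

/-! ### Extension of families over cubes -/

section LocalObstruction

/-- The point `(i + τ) / N` of the unit interval, truncated at `1`. -/
def slabPoint (N i : ℕ) (τ : I) : I := Set.projIcc 0 1 zero_le_one (((i : ℝ) + τ) / N)

theorem continuous_slabPoint (N i : ℕ) : Continuous (slabPoint N i) :=
  continuous_projIcc.comp (by fun_prop)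

theorem slabPoint_one (N i : ℕ) : slabPoint N i 1 = slabPoint N (i + 1) 0 := by
  simp [slabPoint]

theorem dist_slabPoint_le {N : ℕ} (i : ℕ) (τ τ' : I) :
    dist (slabPoint N i τ) (slabPoint N i τ') ≤ 1 / N := by
  have h : |(τ : ℝ) - τ'| ≤ 1 := by
    rw [abs_le]
    constructor <;> linarith [τ.2.1, τ.2.2, τ'.2.1, τ'.2.2]
  refine (Set.abs_projIcc_sub_projIcc (h := zero_le_one)).trans ?_
  rw [← sub_div, add_sub_add_left_eq_sub, abs_div, Nat.abs_cast]
  gcongr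

theorem slabPoint_projIcc {N : ℕ} (hN : 0 < N) {i : ℕ} {t : I} (h₁ : (i : ℝ) ≤ N * t)
    (h₂ : N * (t : ℝ) ≤ i + 1) :
    slabPoint N i (Set.projIcc 0 1 zero_le_one (N * (t : ℝ) - i)) = t := by
  have hN' : (N : ℝ) ≠ 0 := by positivity
  rw [Set.projIcc_of_mem (x := N * (t : ℝ) - i) zero_le_one ⟨by linarith, by linarith⟩, slabPoint]
  convert Set.projIcc_val zero_le_one t using 2
  field_simp
  ring

variable {K : Type*} [TopologicalSpace K]

/-- The extension property of families of maps on an `m`-cube which are parametrized by `X`,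
relative to a neighbourhood of a closed set of parameters. -/
def FamilyExt (X : Type*) [TopologicalSpace X] (m : ℕ) (K : Type*) [TopologicalSpace K] : Prop :=
  ∀ (A U : Set X) (f : X × (Fin m → I) → K), IsClosed A → U ∈ 𝓝ˢ A →
    ContinuousOn f (U ×ˢ Set.univ) → ContinuousOn f (Set.univ ×ˢ Cube.boundary (Fin m)) →
    ∃ g : C(X × (Fin m → I), K), Set.EqOn g f (A ×ˢ Set.univ) ∧
      Set.EqOn g f (Set.univ ×ˢ Cube.boundary (Fin m))

theorem FamilyExt.of_homeomorph {X Y : Type*} [TopologicalSpace X] [TopologicalSpace Y] {m : ℕ}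
    (e : X ≃ₜ Y) (h : FamilyExt X m K) : FamilyExt Y m K := by
  intro A U f hA hU hf₁ hf₂
  let E := e.prodCongr (Homeomorph.refl (Fin m → I))
  obtain ⟨g, hg₁, hg₂⟩ := h (e ⁻¹' A) (e ⁻¹' U) (f ∘ E) (hA.preimage e.continuous)
    (e.continuous.tendsto_nhdsSet (fun x hx => hx) hU)
    (hf₁.comp E.continuous.continuousOn fun p hp => ⟨hp.1, trivial⟩)
    (hf₂.comp E.continuous.continuousOn fun p hp => ⟨trivial, hp.2⟩)
  refine ⟨g.comp ⟨E.symm, E.symm.continuous⟩, fun p hp => ?_, fun p hp => ?_⟩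
  · have := hg₁ (show E.symm p ∈ _ from ⟨by simpa [E] using hp.1, trivial⟩)
    simpa using this
  · have := hg₂ (show E.symm p ∈ _ from ⟨trivial, hp.2⟩)
    simpa using this

/-- The induction on the dimension of the parameter cube: `I^d × I` is cut into thin slabs
`I^d × [i / N, (i + 1) / N]`. The extension is first constructed on the walls between the slabs, and
then on the slabs, where the coordinate of `I` is regarded as a coordinate of the fibre. -/
theorem FamilyExt.prod_unitInterval {X : Type*} [MetricSpace X] [CompactSpace X] {m : ℕ}
    (h₀ : FamilyExt X m K) (h₁ : FamilyExt X (m + 1) K) : FamilyExt (X × I) m K := by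
  intro A U f hA hU hf₁ hf₂
  -- The map `f` is kept on the `2 ε`-neighbourhood of `A` in the walls. Since the slabs are thinner
  -- than `ε`, this suffices to keep it, in the slabs, in a neighbourhood of `A`.
  obtain ⟨δ, hδ, hδU⟩ := hA.isCompact.exists_cthickening_subset_open isOpen_interior
    (subset_interior_iff_mem_nhdsSet.2 hU)
  replace hδU := hδU.trans interior_subset
  obtain ⟨ε, hε, hεδ⟩ : ∃ ε : ℝ, 0 < ε ∧ 3 * ε = δ := ⟨δ / 3, by positivity, by ring⟩
  obtain ⟨N, hN⟩ := exists_nat_one_div_lt hε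
  replace hN : 1 / ((N + 1 : ℕ) : ℝ) < ε := by exact_mod_cast hN
  generalize hN' : N + 1 = N' at hN
  have hNpos : 0 < N' := by omega
  have hf : ∀ {T : Type _} [TopologicalSpace T] {s : Set T} (u : T → (X × I) × (Fin m → I)),
      ContinuousOn u s → (∀ t ∈ s, (u t).1 ∈ Metric.cthickening (3 * ε) A) →
        ContinuousOn (fun t => f (u t)) s := fun u hu h =>
    hf₁.comp hu fun t ht => ⟨hδU (hεδ ▸ h t ht), trivial⟩
  have hf' : ∀ {T : Type _} [TopologicalSpace T] {s : Set T} (u : T → (X × I) × (Fin m → I)),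
      ContinuousOn u s → (∀ t ∈ s, (u t).2 ∈ Cube.boundary (Fin m)) →
        ContinuousOn (fun t => f (u t)) s := fun u hu h =>
    hf₂.comp hu fun t ht => ⟨trivial, h t ht⟩
  -- the walls
  have hwall : ∀ i : ℕ, ∃ g : C(X × (Fin m → I), K),
      (∀ y z, (y, slabPoint N' i 0) ∈ Metric.cthickening (2 * ε) A →
        g (y, z) = f ((y, slabPoint N' i 0), z)) ∧
      ∀ y, ∀ z ∈ Cube.boundary (Fin m), g (y, z) = f ((y, slabPoint N' i 0), z) := by
    intro i
    have hc : Continuous fun y : X => (y, slabPoint N' i 0) := by fun_prop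
    obtain ⟨g, hg₁, hg₂⟩ := h₀ ((fun y => (y, slabPoint N' i 0)) ⁻¹' Metric.cthickening (2 * ε) A)
      ((fun y => (y, slabPoint N' i 0)) ⁻¹' Metric.thickening (3 * ε) A)
      (fun p => f ((p.1, slabPoint N' i 0), p.2))
      (Metric.isClosed_cthickening.preimage hc)
      ((Metric.isOpen_thickening.preimage hc).mem_nhdsSet.2 (Set.preimage_mono
        (Metric.cthickening_subset_thickening' (by positivity) (by linarith) A)))
      (hf _ (by fun_prop) fun p hp => Metric.thickening_subset_cthickening _ _ hp.1)
      (hf' _ (by fun_prop) fun p hp => hp.2)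
    exact ⟨g, fun y z hy => hg₁ (show (y, z) ∈ _ from ⟨hy, trivial⟩),
      fun y z hz => hg₂ (show (y, z) ∈ _ from ⟨trivial, hz⟩)⟩
  choose g hg₁ hg₂ using hwall
  -- the slabs
  have hslab : ∀ i : ℕ, ∃ h : C(X × (Fin (m + 1) → I), K),
      (∀ y z, h (y, cubeSucc m (z, 0)) = g i (y, z)) ∧
      (∀ y z, h (y, cubeSucc m (z, 1)) = g (i + 1) (y, z)) ∧
      (∀ y z τ, (y, slabPoint N' i τ) ∈ A →
        h (y, cubeSucc m (z, τ)) = f ((y, slabPoint N' i τ), z)) ∧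
      ∀ y τ, ∀ z ∈ Cube.boundary (Fin m),
        h (y, cubeSucc m (z, τ)) = f ((y, slabPoint N' i τ), z) := by
    intro i
    have hsc := continuous_slabPoint N' i
    let B : Set X := Prod.fst '' ((fun p : X × I => (p.1, slabPoint N' i p.2)) ⁻¹' A)
    have hB : IsClosed B :=
      ((hA.preimage (by fun_prop)).isCompact.image continuous_fst).isClosed
    have hBA : ∀ y ∈ Metric.thickening ε B, ∀ τ,
        (y, slabPoint N' i τ) ∈ Metric.cthickening (2 * ε) A := by
      intro y hy τ
      obtain ⟨_, ⟨⟨y', τ'⟩, hA', rfl⟩, hd⟩ := Metric.mem_thickening_iff.1 hy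
      refine Metric.mem_cthickening_of_dist_le _ _ _ _ hA' ?_
      refine max_le ?_ ?_
      · change dist y y' ≤ _
        linarith
      · exact (dist_slabPoint_le i τ τ').trans (by linarith)
    let k : X × ((Fin m → I) × I) → K := fun p =>
      if p.2.2 = 0 then g i (p.1, p.2.1) else
        if p.2.2 = 1 then g (i + 1) (p.1, p.2.1) else f ((p.1, slabPoint N' i p.2.2), p.2.1)
    have hk₀ : ∀ y z, k (y, z, 0) = g i (y, z) := fun y z => by simp [k]
    have hk₁ : ∀ y z, k (y, z, 1) = g (i + 1) (y, z) := fun y z => by simp [k]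
    have hk : ∀ y z τ, ((y, slabPoint N' i τ) ∈ Metric.cthickening (2 * ε) A ∨
        z ∈ Cube.boundary (Fin m)) → k (y, z, τ) = f ((y, slabPoint N' i τ), z) := by
      intro y z τ hyz
      by_cases h0 : τ = 0
      · subst h0
        rw [hk₀]
        exact hyz.elim (hg₁ i y z) (hg₂ i y z)
      · by_cases h1 : τ = 1
        · subst h1
          rw [hk₁]
          rw [slabPoint_one] at hyz ⊢
          exact hyz.elim (hg₁ (i + 1) y z) (hg₂ (i + 1) y z)
        · simp [k, h0, h1]
    have hcont : ContinuousOn k {p | p.2 ∈ prism (Cube.boundary (Fin m))} := by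
      have := (continuousOn_prism_ite (X := X × (Fin m → I)) (Z := K)
        (S := {q | q.2 ∈ Cube.boundary (Fin m)})
        (p₀ := fun q => g i q.1) (p₁ := fun q => g (i + 1) q.1)
        (g := fun q => f ((q.1.1, slabPoint N' i q.2), q.1.2))
        ((isClosed_cube_boundary m).preimage continuous_snd) (by fun_prop) (by fun_prop)
        (hf' _ (by fun_prop) fun p hp => hp.1)
        (fun q hq => hg₂ i q.1 q.2 hq)
        (fun q hq => by
          rw [slabPoint_one]
          exact hg₂ (i + 1) q.1 q.2 hq)).comp
        (f := fun p : X × ((Fin m → I) × I) => ((p.1, p.2.1), p.2.2))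
        (s := {p | p.2 ∈ prism (Cube.boundary (Fin m))}) (by fun_prop) (fun p hp => hp)
      exact this
    obtain ⟨h, hh₁, hh₂⟩ := h₁ B (Metric.thickening ε B)
      (fun p => k (p.1, (cubeSucc m).symm p.2)) hB
      (Metric.isOpen_thickening.mem_nhdsSet.2 (Metric.self_subset_thickening hε B))
      ((hf (fun p : X × (Fin (m + 1) → I) =>
          ((p.1, slabPoint N' i ((cubeSucc m).symm p.2).2), ((cubeSucc m).symm p.2).1))
          (by fun_prop) (fun p hp =>
            Metric.cthickening_mono (by linarith) A (hBA p.1 hp.1 _))).congr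
        (fun p hp => hk _ _ _ (Or.inl (hBA p.1 hp.1 _))))
      (hcont.comp (by fun_prop) fun p hp => by
        have : cubeSucc m ((cubeSucc m).symm p.2) ∈ Cube.boundary (Fin (m + 1)) := by
          simpa using hp.2
        exact (cubeSucc_mem_boundary _).1 this)
    have hb : ∀ y z τ, (z, τ) ∈ prism (Cube.boundary (Fin m)) →
        h (y, cubeSucc m (z, τ)) = k (y, z, τ) := by
      intro y z τ hzτ
      have := hh₂ (show (y, cubeSucc m (z, τ)) ∈ _ from
        ⟨trivial, (cubeSucc_mem_boundary _).2 hzτ⟩)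
      simpa using this
    refine ⟨h, fun y z => ?_, fun y z => ?_, fun y z τ hy => ?_, fun y τ z hz => ?_⟩
    · rw [hb _ _ _ (Or.inr (Or.inl rfl)), hk₀]
    · rw [hb _ _ _ (Or.inr (Or.inr rfl)), hk₁]
    · have := hh₁ (show (y, cubeSucc m (z, τ)) ∈ _ from ⟨⟨(y, τ), hy, rfl⟩, trivial⟩)
      rw [this]
      simpa using hk y z τ (Or.inl (Metric.self_subset_cthickening A hy))
    · rw [hb _ _ _ (Or.inl hz), hk _ _ _ (Or.inr hz)]
  choose h hh₀ hh₁ hhA hhb using hslab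
  let H : ℕ → (X × I) × (Fin m → I) → K := fun i p =>
    h i (p.1.1, cubeSucc m (p.2, Set.projIcc 0 1 zero_le_one (N' * (p.1.2 : ℝ) - i)))
  have hHc : ∀ i, Continuous (H i) := fun i => by
    have : Continuous fun p : (X × I) × (Fin m → I) =>
        Set.projIcc (0 : ℝ) 1 zero_le_one (N' * (p.1.2 : ℝ) - i) :=
      continuous_projIcc.comp (by fun_prop)
    fun_prop
  let S : ℕ → Set ((X × I) × (Fin m → I)) := fun i =>
    {p | (i : ℝ) ≤ N' * (p.1.2 : ℝ) ∧ N' * (p.1.2 : ℝ) ≤ i + 1}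
  have hSc : ∀ i, IsClosed (S i) := fun i => by
    have hc : Continuous fun p : (X × I) × (Fin m → I) => N' * (p.1.2 : ℝ) := by fun_prop
    exact (isClosed_le continuous_const hc).inter (isClosed_le hc continuous_const)
  have hSlt : ∀ i j p, i < j → p ∈ S i → p ∈ S j → H i p = H j p := by
    intro i j p hij hi hj
    have hij' : (i : ℝ) + 1 ≤ j := by exact_mod_cast hij
    have hj' : (j : ℝ) ≤ i + 1 := hj.1.trans hi.2
    obtain rfl : j = i + 1 := by
      have : j ≤ i + 1 := by exact_mod_cast hj'
      omega
    have ht : N' * (p.1.2 : ℝ) = i + 1 := le_antisymm hi.2 (by simpa using hj.1)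
    have e₁ : Set.projIcc (0 : ℝ) 1 zero_le_one (N' * (p.1.2 : ℝ) - i) = 1 := by
      rw [ht]
      simp
    have e₂ : Set.projIcc (0 : ℝ) 1 zero_le_one (N' * (p.1.2 : ℝ) - (i + 1 : ℕ)) = 0 := by
      rw [ht]
      simp
    simp only [H]
    rw [e₁, e₂, hh₁, hh₀]
  have hSeq : ∀ i j p, p ∈ S i → p ∈ S j → H i p = H j p := by
    intro i j p hi hj
    rcases lt_trichotomy i j with hij | rfl | hij
    · exact hSlt i j p hij hi hj
    · rfl
    · exact (hSlt j i p hij hj hi).symm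
  let idx : (X × I) × (Fin m → I) → ℕ := fun p => ⌊N' * (p.1.2 : ℝ)⌋₊
  have hidx : ∀ p, p ∈ S (idx p) := fun p =>
    ⟨Nat.floor_le (mul_nonneg (Nat.cast_nonneg _) p.1.2.2.1), (Nat.lt_floor_add_one _).le⟩
  have hidxN : ∀ p, idx p < N' + 1 := fun p => by
    refine Nat.lt_succ_of_le (Nat.floor_le_of_le ?_)
    have := p.1.2.2.2
    have : (N' : ℝ) * p.1.2 ≤ N' * 1 := by gcongr
    linarith
  have hG : Continuous fun p => H (idx p) p := by
    refine LocallyFinite.continuous (f := fun i : Fin (N' + 1) => S i) (locallyFinite_of_finite _)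
      (Set.eq_univ_of_forall fun p => Set.mem_iUnion.2 ⟨⟨idx p, hidxN p⟩, hidx p⟩)
      (fun i => hSc i) fun i => ?_
    exact (hHc i).continuousOn.congr fun p hp => hSeq _ _ p (hidx p) hp
  have hpt : ∀ p, slabPoint N' (idx p) (Set.projIcc 0 1 zero_le_one (N' * (p.1.2 : ℝ) - idx p)) =
      p.1.2 := fun p => slabPoint_projIcc hNpos (hidx p).1 (hidx p).2
  refine ⟨⟨_, hG⟩, fun p hp => ?_, fun p hp => ?_⟩
  · have := hhA (idx p) p.1.1 p.2 (Set.projIcc 0 1 zero_le_one (N' * (p.1.2 : ℝ) - idx p))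
      (by rw [hpt]; exact hp.1)
    rw [hpt] at this
    exact this
  · have := hhb (idx p) p.1.1 (Set.projIcc 0 1 zero_le_one (N' * (p.1.2 : ℝ) - idx p)) p.2 hp.2
    rw [hpt] at this
    exact this

/-- If maps to `K` extend over all cubes of large dimension, then so do families of maps
parametrized by a cube. For a single parameter, this is the extension property itself. -/
theorem familyExt_cube {N : ℕ} (hK : ∀ m, N ≤ m → CubeExt m K) (d : ℕ) :
    ∀ m, N ≤ m → FamilyExt (Fin d → I) m K := by
  induction d with
  | zero =>
    intro m hm A U f hA hU hf₁ hf₂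
    rcases A.eq_empty_or_nonempty with rfl | ⟨a, ha⟩
    · obtain ⟨g, hg⟩ := hK m hm (fun z => f (0, z))
        (hf₂.comp (by fun_prop) fun z hz => ⟨trivial, hz⟩)
      exact ⟨⟨fun p => g p.2, by fun_prop⟩, fun p hp => hp.1.elim, fun p hp => by
        refine (hg hp.2).trans ?_
        rw [Subsingleton.elim 0 p.1]⟩
    · have hUu : U = Set.univ := Set.eq_univ_of_forall fun x => by
        rw [Subsingleton.elim x a]
        exact subset_of_mem_nhdsSet hU ha
      subst hUu
      rw [Set.univ_prod_univ] at hf₁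
      exact ⟨⟨f, continuousOn_univ.1 hf₁⟩, fun p _ => rfl, fun p _ => rfl⟩
  | succ d ih =>
    intro m hm
    exact (FamilyExt.prod_unitInterval (ih m hm) (ih (m + 1) (by omega))).of_homeomorph
      (cubeSucc d)

end LocalObstruction

/-! ### Extension of families over manifolds -/

section GlobalObstruction

/-- Every point of `M` has a neighbourhood which is homeomorphic to the `d`-cube. -/
def HasCubeNhds (d : ℕ) (M : Type*) [TopologicalSpace M] : Prop :=
  ∀ x : M, ∃ e : C(Fin d → I, M), Function.Injective e ∧ Set.range e ∈ 𝓝 x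

variable {M : Type*} [TopologicalSpace M] [T2Space M] {K : Type*} [TopologicalSpace K]

theorem continuousOn_range_of_comp {X Y Z : Type*} [TopologicalSpace X] [TopologicalSpace Y]
    [TopologicalSpace Z] {e : X → Y} (he : Topology.IsEmbedding e) {f : Y → Z}
    (h : Continuous (f ∘ e)) :
    ContinuousOn f (Set.range e) := by
  rw [continuousOn_iff_continuous_domRestrict]
  have : (Set.range e).domRestrict f = (f ∘ e) ∘ he.toHomeomorph.symm := by
    ext y
    obtain ⟨x, rfl⟩ := he.toHomeomorph.surjective y
    simp
  rw [this]
  exact h.comp he.toHomeomorph.symm.continuous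

/-- An extension over a neighbourhood of the compact set `C` can be enlarged to a neighbourhood of
`C ∪ B`, when `B` is contained in the interior of a cube. -/
theorem exists_extension_union [LocallyCompactSpace M] {d m : ℕ}
    (hK : FamilyExt (Fin d → I) m K) (F : M × (Fin m → I) → K)
    (hF : ContinuousOn F (Set.univ ×ˢ Cube.boundary (Fin m))) {C U : Set M} (hC : IsCompact C)
    (hU : U ∈ 𝓝ˢ C) {f : M × (Fin m → I) → K} (hf : ContinuousOn f (U ×ˢ Set.univ))
    (hfF : Set.EqOn f F (Set.univ ×ˢ Cube.boundary (Fin m))) (e : C(Fin d → I, M))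
    (he : Function.Injective e) {B : Set M} (hB : Set.range e ∈ 𝓝ˢ B) :
    ∃ (U' : Set M) (f' : M × (Fin m → I) → K), U' ∈ 𝓝ˢ (C ∪ B) ∧
      ContinuousOn f' (U' ×ˢ Set.univ) ∧ Set.EqOn f' F (Set.univ ×ˢ Cube.boundary (Fin m)) ∧
      Set.EqOn f' f (C ×ˢ Set.univ) := by
  classical
  obtain ⟨V, hV, hCV, hVU⟩ := exists_compact_between hC isOpen_interior
    (subset_interior_iff_mem_nhdsSet.2 hU)
  let E : (Fin d → I) × (Fin m → I) → M × (Fin m → I) := fun p => (e p.1, p.2)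
  have hEc : Continuous E := by fun_prop
  have hEinj : Function.Injective E := fun p q h =>
    Prod.ext (he (congrArg Prod.fst h)) (congrArg Prod.snd h :)
  have hE : Topology.IsClosedEmbedding E := hEc.isClosedEmbedding hEinj
  have hEr : Set.range E = Set.range e ×ˢ Set.univ := by
    ext ⟨x, z⟩
    simp [E]
  obtain ⟨g, hg₁, hg₂⟩ := hK (e ⁻¹' V) (e ⁻¹' U) (f ∘ E) (hV.isClosed.preimage e.continuous)
    (e.continuous.tendsto_nhdsSet (fun x hx => hx) (subset_interior_iff_mem_nhdsSet.1 hVU))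
    (hf.comp hEc.continuousOn fun p hp => ⟨hp.1, trivial⟩)
    ((hF.comp hEc.continuousOn fun p hp => ⟨trivial, hp.2⟩).congr fun p hp =>
      hfF ⟨trivial, hp.2⟩)
  let f' : M × (Fin m → I) → K := fun p => if h : ∃ q, E q = p then g h.choose else f p
  have hf'E : ∀ q, f' (E q) = g q := fun q => by
    have h : ∃ q', E q' = E q := ⟨q, rfl⟩
    simp only [f', dif_pos h]
    exact congrArg g (hEinj h.choose_spec)
  have hf' : ∀ p, (p.1 ∈ V ∨ p.2 ∈ Cube.boundary (Fin m)) → f' p = f p := by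
    intro p hp
    by_cases h : ∃ q, E q = p
    · obtain ⟨q, rfl⟩ := h
      rw [hf'E]
      rcases hp with hp | hp
      · exact hg₁ ⟨hp, trivial⟩
      · exact hg₂ ⟨trivial, hp⟩
    · simp only [f', dif_neg h]
  refine ⟨V ∪ Set.range e, f', ?_, ?_, fun p hp => (hf' p (Or.inr hp.2)).trans (hfF hp),
    fun p hp => hf' p (Or.inl (interior_subset (hCV hp.1)))⟩
  · rw [nhdsSet_union]
    exact ⟨Filter.mem_of_superset (subset_interior_iff_mem_nhdsSet.1 hCV) Set.subset_union_left,
      Filter.mem_of_superset hB Set.subset_union_right⟩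
  · rw [Set.union_prod]
    refine ContinuousOn.union_of_isClosed ?_ ?_ (hV.isClosed.prod isClosed_univ)
      (hEr ▸ hE.isClosed_range)
    · exact (hf.mono (Set.prod_mono (hVU.trans interior_subset) le_rfl)).congr fun p hp =>
        hf' p (Or.inl hp.1)
    · rw [← hEr]
      refine continuousOn_range_of_comp hE.isEmbedding ?_
      rw [show f' ∘ E = g from funext hf'E]
      exact g.continuous

/-- The extension is constructed successively on the members of a countable family of compact sets
whose interiors cover `M`, and it is not changed any more on the previous ones. -/
theorem exists_extension_of_hasCubeNhds [SecondCountableTopology M] [LocallyCompactSpace M]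
    {d m : ℕ} (hM : HasCubeNhds d M) (hK : FamilyExt (Fin d → I) m K) (F : M × (Fin m → I) → K)
    (hF : ContinuousOn F (Set.univ ×ˢ Cube.boundary (Fin m))) :
    ∃ g : C(M × (Fin m → I), K), Set.EqOn g F (Set.univ ×ˢ Cube.boundary (Fin m)) := by
  choose e he hex using hM
  have hBx : ∀ x, ∃ B : Set M, IsCompact B ∧ x ∈ interior B ∧ B ⊆ interior (Set.range (e x)) :=
    fun x => exists_compact_subset isOpen_interior (mem_interior_iff_mem_nhds.2 (hex x))
  choose B hB hxB hBe using hBx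
  obtain ⟨s, hs, hsU⟩ := TopologicalSpace.countable_cover_nhds
    (f := fun x => interior (B x)) fun x => isOpen_interior.mem_nhds (hxB x)
  rcases isEmpty_or_nonempty M with hM | ⟨⟨x₀⟩⟩
  · exact ⟨⟨F, continuous_iff_continuousAt.2 fun p => hM.elim p.1⟩, fun p _ => rfl⟩
  have hne : s.Nonempty := by
    have : x₀ ∈ ⋃ x ∈ s, interior (B x) := hsU ▸ trivial
    obtain ⟨x, hx, -⟩ := Set.mem_iUnion₂.1 this
    exact ⟨x, hx⟩
  obtain ⟨u, rfl⟩ := hs.exists_eq_range hne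
  -- the extensions to a neighbourhood of a compact set
  let St : Type _ := {t : Set M × Set M × (M × (Fin m → I) → K) //
    IsCompact t.1 ∧ t.2.1 ∈ 𝓝ˢ t.1 ∧ ContinuousOn t.2.2 (t.2.1 ×ˢ Set.univ) ∧
      Set.EqOn t.2.2 F (Set.univ ×ˢ Cube.boundary (Fin m))}
  have hstep : ∀ (n : ℕ) (t : St), ∃ t' : St, t'.1.1 = t.1.1 ∪ B (u n) ∧
      Set.EqOn t'.1.2.2 t.1.2.2 (t.1.1 ×ˢ Set.univ) := by
    rintro n ⟨⟨C, U, f⟩, hC, hU, hf, hfF⟩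
    obtain ⟨U', f', h₁, h₂, h₃, h₄⟩ := exists_extension_union hK F hF hC hU hf hfF (e (u n))
      (he (u n)) (subset_interior_iff_mem_nhdsSet.1 (hBe (u n)))
    exact ⟨⟨(C ∪ B (u n), U', f'), hC.union (hB _), h₁, h₂, h₃⟩, rfl, h₄⟩
  choose step hstep₁ hstep₂ using hstep
  let t : ℕ → St := fun n => Nat.rec ⟨(∅, ∅, F), isCompact_empty, by simp, by simp, fun p _ => rfl⟩
    step n
  have ht : ∀ n, t (n + 1) = step n (t n) := fun n => rfl
  have htm : Monotone fun n => (t n).1.1 := monotone_nat_of_le_succ fun n => by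
    rw [ht, hstep₁]
    exact Set.subset_union_left
  have htB : ∀ n, B (u n) ⊆ (t (n + 1)).1.1 := fun n => by
    rw [ht, hstep₁]
    exact Set.subset_union_right
  have hteq : ∀ k j p, k ≤ j → p.1 ∈ (t k).1.1 → (t j).1.2.2 p = (t k).1.2.2 p := by
    intro k j p hkj hp
    induction j, hkj using Nat.le_induction with
    | base => rfl
    | succ j hkj ih =>
      rw [← ih, ht]
      exact hstep₂ j (t j) ⟨htm hkj hp, trivial⟩
  have hcover : ∀ x : M, ∃ n, x ∈ interior (B (u n)) := fun x => by
    have : x ∈ ⋃ y ∈ Set.range u, interior (B y) := hsU ▸ trivial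
    simpa using this
  choose k hk using hcover
  have hkt : ∀ n x, x ∈ interior (B (u n)) → x ∈ (t (n + 1)).1.1 := fun n x hx =>
    htB n (interior_subset hx)
  let g : M × (Fin m → I) → K := fun p => (t (k p.1 + 1)).1.2.2 p
  have hg : ∀ n p, p.1 ∈ interior (B (u n)) → g p = (t (n + 1)).1.2.2 p := by
    intro n p hp
    rw [← hteq _ (max (n + 1) (k p.1 + 1)) p (le_max_left _ _) (hkt _ _ hp),
      hteq _ (max (n + 1) (k p.1 + 1)) p (le_max_right _ _) (hkt _ _ (hk p.1))]
  refine ⟨⟨g, continuous_iff_continuousAt.2 fun p => ?_⟩, fun p hp =>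
    (t (k p.1 + 1)).2.2.2.2 hp⟩
  have hev : g =ᶠ[𝓝 p] (t (k p.1 + 1)).1.2.2 := by
    filter_upwards [(isOpen_interior.preimage continuous_fst).mem_nhds (hk p.1)] with q hq
    exact hg _ q hq
  refine ContinuousAt.congr ?_ hev.symm
  refine (t (k p.1 + 1)).2.2.2.1.continuousAt ?_
  have : (t (k p.1 + 1)).1.2.1 ∈ 𝓝 p.1 :=
    nhds_le_nhdsSet (hkt _ _ (hk p.1)) (t (k p.1 + 1)).2.2.1
  rw [nhds_prod_eq]
  exact Filter.prod_mem_prod this Filter.univ_mem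

/-- Obstruction theory: if maps to `K` extend from the boundaries of cubes of dimension at least `N`
then so do maps to the space of maps from a manifold to `K`. -/
theorem CubeExt.continuousMap [SecondCountableTopology M] [LocallyCompactSpace M]
    {d N : ℕ} (hM : HasCubeNhds d M) (hK : ∀ m, N ≤ m → CubeExt m K) {m : ℕ} (hm : N ≤ m) :
    CubeExt m C(M, K) := by
  intro f hf
  obtain ⟨g, hg⟩ := exists_extension_of_hasCubeNhds hM (familyExt_cube hK d m hm)
    (fun p => f p.2 p.1) (by
      have hf' : ContinuousOn (fun p : M × (Fin m → I) => f p.2)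
          (Set.univ ×ˢ Cube.boundary (Fin m)) :=
        hf.comp continuous_snd.continuousOn fun p hp => hp.2
      exact hf'.eval continuous_fst.continuousOn)
  refine ⟨(g.comp ContinuousMap.prodSwap).curry, fun z hz => ?_⟩
  ext x
  exact hg (show (x, z) ∈ _ from ⟨trivial, hz⟩)

end GlobalObstruction

/-- A manifold with boundary is covered by the interiors of cubes. -/
theorem hasCubeNhds_of_halfSpace {n : ℕ} [NeZero n] {M : Type*} [TopologicalSpace M]
    [ChartedSpace (EuclideanHalfSpace n) M] : HasCubeNhds n M := by
  intro x
  let c := chartAt (EuclideanHalfSpace n) x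
  let p : EuclideanHalfSpace n := c x
  have hp : p ∈ c.target := mem_chart_target _ x
  obtain ⟨O, hO, hOc⟩ := isOpen_induced_iff.1 c.open_target
  have hO' : IsOpen ((WithLp.toLp 2 : (Fin n → ℝ) → EuclideanSpace ℝ (Fin n)) ⁻¹' O) :=
    hO.preimage (PiLp.continuous_toLp 2 _)
  have hpO : (p.1 : Fin n → ℝ) ∈
      (WithLp.toLp 2 : (Fin n → ℝ) → EuclideanSpace ℝ (Fin n)) ⁻¹' O := by
    have : p ∈ Subtype.val ⁻¹' O := hOc ▸ hp
    exact this
  obtain ⟨δ, hδ, hδO⟩ := Metric.nhds_basis_closedBall.mem_iff.1 (hO'.mem_nhds hpO)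
  -- The cube has the sides `[l i, p i + δ]`, where that of the coordinate `0` is cut off at the
  -- boundary of the half-space.
  let l : Fin n → ℝ := fun i => if i = 0 then max (p.1 i - δ) 0 else p.1 i - δ
  have hl : ∀ i, p.1 i - δ ≤ l i := fun i => by
    by_cases h : i = 0 <;> simp [l, h]
  have hlp : ∀ i, l i ≤ p.1 i := fun i => by
    by_cases h : i = 0
    · subst h
      simp only [l, if_true]
      exact max_le (by linarith) p.2
    · simp only [l, h, if_false]
      linarith
  have hl0 : 0 ≤ l 0 := by simp [l]
  let w : Fin n → ℝ := fun i => p.1 i + δ - l i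
  have hw : ∀ i, 0 < w i := fun i => by
    have := hlp i
    simp only [w]
    linarith
  let q₀ : (Fin n → I) → Fin n → ℝ := fun y i => l i + y i * w i
  let q : (Fin n → I) → EuclideanHalfSpace n := fun y =>
    ⟨WithLp.toLp 2 (q₀ y), add_nonneg hl0 (mul_nonneg (y 0).2.1 (hw 0).le)⟩
  have hq : Continuous q := by
    refine Continuous.subtype_mk ((PiLp.continuous_toLp 2 _).comp ?_) _
    fun_prop
  have hqinj : Function.Injective q := by
    intro y y' h
    funext i
    have h1 : l i + y i * w i = l i + y' i * w i :=
      congrArg (fun z : EuclideanHalfSpace n => z.1 i) h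
    have h2 : (y i : ℝ) * w i = y' i * w i := by linarith
    exact Subtype.ext (mul_right_cancel₀ (hw i).ne' h2)
  have hqt : ∀ y, q y ∈ c.target := by
    intro y
    rw [← hOc]
    refine hδO (Metric.mem_closedBall.2 ((dist_pi_le_iff hδ.le).2 fun i => ?_))
    have h1 := hl i
    have h2 := (y i).2.1
    have h3 := (y i).2.2
    have h4 := hw i
    have h5 := hlp i
    rw [Real.dist_eq, abs_le]
    simp only [q₀, w] at *
    constructor <;> nlinarith
  have hqr : Set.range q ∈ 𝓝 p := by
    have : IsOpen {z : EuclideanHalfSpace n | ∀ i, |z.1 i - p.1 i| < δ} := by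
      rw [Set.ofPred_forall]
      refine isOpen_iInter_of_finite fun i => isOpen_lt ?_ continuous_const
      have : Continuous fun z : EuclideanHalfSpace n => z.1 i :=
        ((continuous_apply i).comp (PiLp.continuous_ofLp 2 _)).comp continuous_subtype_val
      fun_prop
    refine Filter.mem_of_superset (this.mem_nhds (fun i => by simpa using hδ)) fun z hz => ?_
    have hlz : ∀ i, l i ≤ z.1 i := fun i => by
      have := (abs_lt.1 (hz i)).1
      by_cases h : i = 0
      · subst h
        simp only [l, if_true]
        exact max_le (by linarith) z.2
      · simp only [l, h, if_false]
        linarith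
    have hzu : ∀ i, z.1 i - l i ≤ w i := fun i => by
      have := (abs_lt.1 (hz i)).2
      simp only [w]
      linarith
    refine ⟨fun i => ⟨(z.1 i - l i) / w i, div_nonneg (by linarith [hlz i]) (hw i).le,
      (div_le_one (hw i)).2 (hzu i)⟩, ?_⟩
    refine Subtype.ext (PiLp.ext fun i => ?_)
    change l i + (z.1 i - l i) / w i * w i = z.1 i
    rw [div_mul_cancel₀ _ (hw i).ne']
    ring
  refine ⟨⟨fun y => c.symm (q y), c.continuousOn_symm.comp_continuous hq hqt⟩, ?_, ?_⟩
  · intro y y' h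
    exact hqinj (c.symm.injOn (hqt y) (hqt y') h)
  · have h1 : c.symm '' Set.range q ∈ 𝓝 (c.symm p) := c.symm.image_mem_nhds hp hqr
    rw [c.left_inv (mem_chart_source _ x)] at h1
    convert h1
    exact Set.range_comp c.symm q

/-! ### Isometries of the Hilbert space -/

section Spread

theorem hasSum_norm_extend (k : ℕ → ℕ) (hk : Function.Injective k) (v : Hilb) :
    HasSum (fun n => ‖Function.extend k (v : ℕ → ℂ) 0 n‖ ^ (2 : ENNReal).toReal)
      (‖v‖ ^ (2 : ENNReal).toReal) := by
  have hp : 0 < (2 : ENNReal).toReal := by norm_num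
  refine (hk.hasSum_iff (fun n hn => ?_)).1 ?_
  · rw [Function.extend_apply' _ _ _ (by simpa using hn)]
    simp
  · convert lp.hasSum_norm hp v using 2 with n
    simp [hk.extend_apply]

/-- The isometry of the Hilbert space which maps the `n`-th basis vector to the `k n`-th one. -/
def spread (k : ℕ → ℕ) (hk : Function.Injective k) : Hilb →L[ℂ] Hilb :=
  LinearMap.mkContinuous
    { toFun := fun v => ⟨Function.extend k (v : ℕ → ℂ) 0,
        memℓp_gen (hasSum_norm_extend k hk v).summable⟩
      map_add' := fun v w => by
        ext n
        change Function.extend k (fun i => v i + w i) 0 n =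
          Function.extend k (v : ℕ → ℂ) 0 n + Function.extend k (w : ℕ → ℂ) 0 n
        by_cases h : ∃ a, k a = n
        · obtain ⟨a, rfl⟩ := h
          simp [hk.extend_apply]
        · simp [Function.extend_apply' _ _ _ h]
      map_smul' := fun c v => by
        ext n
        change Function.extend k (fun i => c * v i) 0 n = c * Function.extend k (v : ℕ → ℂ) 0 n
        by_cases h : ∃ a, k a = n
        · obtain ⟨a, rfl⟩ := h
          simp [hk.extend_apply]
        · simp [Function.extend_apply' _ _ _ h] }
    1 (fun v => by
      have hp : 0 < (2 : ENNReal).toReal := by norm_num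
      have h := (lp.hasSum_norm hp (⟨Function.extend k (v : ℕ → ℂ) 0,
        memℓp_gen (hasSum_norm_extend k hk v).summable⟩ : Hilb)).unique
          (hasSum_norm_extend k hk v)
      rw [one_mul]
      exact le_of_eq ((Real.rpow_left_inj (norm_nonneg _) (norm_nonneg _) hp.ne').1 h))

theorem spread_apply (k : ℕ → ℕ) (hk : Function.Injective k) (v : Hilb) (n : ℕ) :
    spread k hk v (k n) = v n := hk.extend_apply _ _ _

theorem spread_apply_of_notMem (k : ℕ → ℕ) (hk : Function.Injective k) (v : Hilb) {n : ℕ}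
    (hn : ∀ a, k a ≠ n) : spread k hk v n = 0 :=
  Function.extend_apply' _ _ _ (by rintro ⟨a, ha⟩; exact hn a ha)

theorem spread_injective (k : ℕ → ℕ) (hk : Function.Injective k) :
    Function.Injective (spread k hk) := by
  intro v w h
  ext n
  rw [← spread_apply k hk v, ← spread_apply k hk w, h]

/-- The isometry onto the span of the even basis vectors. -/
def evenShift : Hilb →L[ℂ] Hilb := spread (fun n => 2 * n) fun a b h => by simpa using h

/-- The isometry onto the span of the odd basis vectors. -/
def oddShift : Hilb →L[ℂ] Hilb := spread (fun n => 2 * n + 1) fun a b h => by simpa using h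

/-- The straight line from the identity to `oddShift` consists of injective maps, since `oddShift`
has no eigenvectors. -/
theorem line_oddShift_ne_zero {v : Hilb} (hv : v ≠ 0) (t : ℝ) :
    ((1 - t : ℝ) : ℂ) • v + (t : ℂ) • oddShift v ≠ 0 := by
  intro h
  apply hv
  have hcoord : ∀ n, ((1 - t : ℝ) : ℂ) * v n + (t : ℂ) * oddShift v n = 0 := fun n => by
    have := congrArg (fun w : Hilb => w n) h
    simpa only [lp.coeFn_add, lp.coeFn_smul, lp.coeFn_zero, Pi.add_apply, Pi.smul_apply,
      Pi.zero_apply, smul_eq_mul] using this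
  have hodd : ∀ n, oddShift v (2 * n + 1) = v n := fun n => spread_apply _ _ v n
  have heven : ∀ n, oddShift v (2 * n) = 0 := fun n =>
    spread_apply_of_notMem _ _ v fun a => by omega
  by_cases ht : t = 0
  · subst ht
    simpa using h
  by_cases ht1 : t = 1
  · subst ht1
    ext n
    have := hcoord (2 * n + 1)
    rw [hodd] at this
    simpa using this
  have ht' : (t : ℂ) ≠ 0 := by exact_mod_cast ht
  have ht1' : ((1 - t : ℝ) : ℂ) ≠ 0 := by
    have : 1 - t ≠ 0 := fun h => ht1 (by linarith)
    exact_mod_cast this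
  ext n
  change v n = 0
  induction n using Nat.strong_induction_on with | _ n ih => ?_
  rcases Nat.even_or_odd' n with ⟨k, rfl | rfl⟩
  · have := hcoord (2 * k)
    rw [heven, mul_zero, add_zero] at this
    exact (mul_eq_zero.1 this).resolve_left ht1'
  · have := hcoord (2 * k + 1)
    rw [hodd, ih k (by omega), mul_zero, add_zero] at this
    exact (mul_eq_zero.1 this).resolve_left ht1'

/-- The ranges of `oddShift` and `evenShift` are independent. -/
theorem line_odd_even_ne_zero {v w : Hilb} (hv : v ≠ 0) (hw : w ≠ 0) (t : ℝ) :
    ((1 - t : ℝ) : ℂ) • oddShift v + (t : ℂ) • evenShift w ≠ 0 := by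
  intro h
  have hcoord : ∀ n, ((1 - t : ℝ) : ℂ) * oddShift v n + (t : ℂ) * evenShift w n = 0 := fun n => by
    have := congrArg (fun w : Hilb => w n) h
    simpa only [lp.coeFn_add, lp.coeFn_smul, lp.coeFn_zero, Pi.add_apply, Pi.smul_apply,
      Pi.zero_apply, smul_eq_mul] using this
  by_cases ht : t = 0
  · apply hv
    ext n
    have := hcoord (2 * n + 1)
    rw [show oddShift v (2 * n + 1) = v n from spread_apply _ _ v n, ht] at this
    simpa using this
  · apply hw
    ext n
    have := hcoord (2 * n)
    rw [show evenShift w (2 * n) = w n from spread_apply _ _ w n,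
      show oddShift v (2 * n) = 0 from spread_apply_of_notMem _ _ v fun a => by omega] at this
    have ht' : (t : ℂ) ≠ 0 := by exact_mod_cast ht
    simpa [ht'] using this

/-- The nonzero vectors of the Hilbert space. -/
abbrev HilbNonzero : Type := {v : Hilb // v ≠ 0}

theorem exists_hilb_ne_zero : ∃ v : Hilb, v ≠ 0 := by
  refine ⟨lp.single 2 0 (1 : ℂ), fun h => ?_⟩
  have := congrArg (fun w : Hilb => w 0) h
  simp at this

instance : ContractibleSpace HilbNonzero := by
  obtain ⟨w, hw⟩ := exists_hilb_ne_zero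
  rw [contractible_iff_id_nullhomotopic]
  have hodd : ∀ v : Hilb, v ≠ 0 → oddShift v ≠ 0 := fun v hv h =>
    hv (spread_injective _ _ (h.trans (map_zero oddShift).symm))
  have heven : evenShift w ≠ 0 := fun h =>
    hw (spread_injective _ _ (h.trans (map_zero evenShift).symm))
  refine ⟨⟨evenShift w, heven⟩, ?_⟩
  have h₁ : ContinuousMap.Homotopic (ContinuousMap.id HilbNonzero)
      ⟨fun v => ⟨oddShift v, hodd v v.2⟩, by fun_prop⟩ :=
    ⟨⟨⟨fun p => ⟨_, line_oddShift_ne_zero p.2.2 (p.1 : ℝ)⟩, by fun_prop⟩,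
      fun v => Subtype.ext (by simp), fun v => Subtype.ext (by simp)⟩⟩
  refine h₁.trans ⟨⟨⟨fun p => ⟨_, line_odd_even_ne_zero p.2.2 hw (p.1 : ℝ)⟩, by fun_prop⟩,
      fun v => Subtype.ext (by simp), fun v => Subtype.ext (by simp)⟩⟩

end Spread

/-! ### The homotopy groups of `BU(1)` -/

section CStar

theorem isPreconnected_cube_boundary {n : ℕ} (hn : 2 ≤ n) :
    IsPreconnected (Cube.boundary (Fin n)) := by
  have : Nontrivial (Fin n) := Fin.nontrivial_iff_two_le.2 hn
  have hface : ∀ (i : Fin n) (s : I), IsPreconnected {z : Fin n → I | z i = s} := by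
    intro i s
    have : {z : Fin n → I | z i = s} = Set.range fun z => Function.update z i s := by
      ext z
      constructor
      · rintro rfl
        exact ⟨z, by simp⟩
      · rintro ⟨w, rfl⟩
        simp
    rw [this]
    exact isPreconnected_range (by fun_prop)
  refine isPreconnected_of_forall (0 : Fin n → I) fun y hy => ?_
  obtain ⟨i, hi⟩ := hy
  obtain ⟨k, hk⟩ := exists_ne i
  refine ⟨{z | z k = 0} ∪ {z | z i = y i}, ?_, Or.inl rfl, Or.inr rfl, ?_⟩
  · rintro z (hz | hz)
    · exact ⟨k, Or.inl hz⟩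
    · exact ⟨i, by rwa [show z i = y i from hz]⟩
  · refine IsPreconnected.union (Function.update (0 : Fin n → I) i (y i)) ?_ ?_
      (hface k 0) (hface i (y i))
    · simp [hk]
    · simp

theorem continuous_cube_scale (n : ℕ) :
    Continuous fun p : I × (Fin n → I) => fun i => p.1 * p.2 i := by
  fun_prop

/-- The nonzero complex numbers. -/
abbrev CNonzero : Type := {z : ℂ // z ≠ 0}

/-- A map from the cube to the nonzero complex numbers lifts along the exponential map, since the
cube can be scaled to a vertex. If it is constant on the boundary then so is the lift, because the
boundary is connected. -/
theorem subsingleton_pi_CNonzero {n : ℕ} (hn : 2 ≤ n) (y : CNonzero) :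
    Subsingleton (HomotopyGroup.Pi n CNonzero y) := by
  suffices h : ∀ g : GenLoop (Fin n) CNonzero y, GenLoop.Homotopic g GenLoop.const by
    refine ⟨fun a b => ?_⟩
    induction a using Quotient.inductionOn with | _ p => ?_
    induction b using Quotient.inductionOn with | _ q => ?_
    exact Quotient.sound ((h p).trans (h q).symm)
  intro g
  have cov := Complex.isCoveringMap_exp
  obtain ⟨c, hc⟩ : ∃ c : ℂ, Complex.exp c = g 0 := ⟨Complex.log (g 0), Complex.exp_log (g 0).2⟩
  let H : C(I × (Fin n → I), CNonzero) := ⟨fun p => g fun i => p.1 * p.2 i,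
    g.1.continuous.comp (continuous_cube_scale n)⟩
  have hH0 : ∀ a, H (0, a) = ⟨Complex.exp (ContinuousMap.const _ c a), Complex.exp_ne_zero _⟩ := by
    intro a
    refine Subtype.ext ?_
    change ((g fun i => 0 * a i : CNonzero) : ℂ) = Complex.exp c
    rw [hc]
    congr 2
    funext i
    simp
  let l : C(Fin n → I, ℂ) :=
    ⟨fun x => cov.liftHomotopy H (ContinuousMap.const _ c) hH0 (1, x), by fun_prop⟩
  have hl : ∀ x, Complex.exp (l x) = g x := by
    intro x
    have := congrArg Subtype.val (congrFun (cov.liftHomotopy_lifts H (ContinuousMap.const _ c) hH0)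
      (1, x))
    refine this.trans ?_
    change ((g fun i => 1 * x i : CNonzero) : ℂ) = _
    simp
  have h0 : (0 : Fin n → I) ∈ Cube.boundary (Fin n) := ⟨⟨0, by omega⟩, Or.inl rfl⟩
  have hlb : ∀ x ∈ Cube.boundary (Fin n), l x = l 0 := fun x hx =>
    cov.isSeparatedMap.constOn_of_comp cov.isLocalHomeomorph.isLocallyInjective
      (isPreconnected_cube_boundary hn) l.continuous.continuousOn
      (fun a ha a' ha' => Subtype.ext (by
        change Complex.exp (l a) = Complex.exp (l a')
        rw [hl, hl]
        exact congrArg Subtype.val ((g.2 a ha).trans (g.2 a' ha').symm))) hx h0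
  have hl0 : Complex.exp (l 0) = y := by
    rw [hl]
    exact congrArg Subtype.val (g.2 0 h0)
  refine ⟨⟨⟨⟨fun p => ⟨Complex.exp ((1 - (p.1 : ℝ) : ℝ) * l p.2 + (p.1 : ℝ) * l 0),
    Complex.exp_ne_zero _⟩, by fun_prop⟩, fun x => Subtype.ext ?_, fun x => Subtype.ext ?_⟩, ?_⟩⟩
  · simpa using hl x
  · simpa using hl0
  · intro t x hx
    refine Subtype.ext ?_
    change Complex.exp ((1 - (t : ℝ) : ℝ) * l x + (t : ℝ) * l 0) = g x
    rw [← hl, hlb x hx]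
    congr 1
    push_cast
    ring

theorem cubeExt_CNonzero {n : ℕ} (hn : 3 ≤ n) : CubeExt n CNonzero := by
  obtain ⟨k, rfl⟩ : ∃ k, n = k + 1 := ⟨n - 1, by omega⟩
  exact CubeExt.of_subsingleton_pi fun y => subsingleton_pi_CNonzero (by omega) y

end CStar

namespace BUOne

/-- The line spanned by a nonzero vector. -/
def mk (v : HilbNonzero) : BUOne := Projectivization.mk' ℂ v

theorem mk_surjective : Function.Surjective mk := Quotient.mk_surjective

theorem mk_eq_mk_iff {v w : HilbNonzero} : mk v = mk w ↔ ∃ a : ℂ, a • (w : Hilb) = v :=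
  Projectivization.mk_eq_mk_iff' ℂ v.1 w.1 v.2 w.2

theorem mem_line (v : HilbNonzero) : (v : Hilb) ∈ (mk v).line :=
  Submodule.mem_span_singleton_self _

theorem mk_eq_of_mem_line {ℓ : BUOne} {v : HilbNonzero} (h : (v : Hilb) ∈ ℓ.line) : mk v = ℓ := by
  obtain ⟨w, rfl⟩ := mk_surjective ℓ
  exact mk_eq_mk_iff.2 (Submodule.mem_span_singleton.1 h)

theorem continuous_mk : Continuous mk := continuous_quotient_mk'

theorem isOpenMap_mk : IsOpenMap mk := by
  intro U hU
  refine isOpen_coinduced.2 ?_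
  have : (Quotient.mk'' : HilbNonzero → BUOne) ⁻¹' (mk '' U) =
      ⋃ a : ℂˣ, {v : HilbNonzero |
        (⟨a • (v : Hilb), smul_ne_zero a.ne_zero v.2⟩ : HilbNonzero) ∈ U} := by
    ext v
    simp only [Set.mem_preimage, Set.mem_iUnion]
    constructor
    · rintro ⟨u, hu, huv⟩
      obtain ⟨a, ha⟩ := (Projectivization.mk_eq_mk_iff ℂ u.1 v.1 u.2 v.2).1 huv
      refine ⟨a, ?_⟩
      have : (⟨a • (v : Hilb), smul_ne_zero a.ne_zero v.2⟩ : HilbNonzero) = u := Subtype.ext ha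
      change (⟨a • (v : Hilb), smul_ne_zero a.ne_zero v.2⟩ : HilbNonzero) ∈ U
      rw [this]
      exact hu
    · rintro ⟨a, ha⟩
      exact ⟨_, ha, (Projectivization.mk_eq_mk_iff ℂ _ v.1 _ v.2).2 ⟨a, rfl⟩⟩
  refine this ▸ isOpen_iUnion fun a => hU.preimage ?_
  exact Continuous.subtype_mk (continuous_subtype_val.const_smul _) _

/-- The orthogonal projection to a line. -/
def proj (ℓ : BUOne) (w : Hilb) : Hilb :=
  Projectivization.lift (fun v : HilbNonzero => (inner ℂ v.1 w / inner ℂ v.1 v.1) • v.1)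
    (fun a b t h => by
      have hb : inner ℂ b.1 b.1 ≠ 0 := inner_self_ne_zero.2 b.2
      have ht : t ≠ 0 := by
        rintro rfl
        exact a.2 (by simpa using h)
      simp only [h, inner_smul_left, inner_smul_right, smul_smul]
      have : (starRingEnd ℂ) t ≠ 0 := by simpa using ht
      congr 1
      field_simp) ℓ

theorem proj_mk (v : HilbNonzero) (w : Hilb) :
    proj (mk v) w = (inner ℂ v.1 w / inner ℂ v.1 v.1) • v.1 := rfl

theorem proj_mem (ℓ : BUOne) (w : Hilb) : proj ℓ w ∈ ℓ.line := by
  obtain ⟨v, rfl⟩ := mk_surjective ℓ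
  exact Submodule.smul_mem _ _ (mem_line v)

theorem proj_eq_self {ℓ : BUOne} {w : Hilb} (h : w ∈ ℓ.line) : proj ℓ w = w := by
  obtain ⟨v, rfl⟩ := mk_surjective ℓ
  obtain ⟨a, rfl⟩ := Submodule.mem_span_singleton.1 h
  have hv : inner ℂ v.1 v.1 ≠ 0 := inner_self_ne_zero.2 v.2
  rw [proj_mk, inner_smul_right, mul_div_assoc, div_self hv, mul_one]

theorem proj_smul (ℓ : BUOne) (a : ℂ) (w : Hilb) : proj ℓ (a • w) = a • proj ℓ w := by
  obtain ⟨v, rfl⟩ := mk_surjective ℓ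
  rw [proj_mk, proj_mk, inner_smul_right, smul_smul, mul_div_assoc]

theorem continuous_proj : Continuous fun p : BUOne × Hilb => proj p.1 p.2 := by
  have hq : IsOpenQuotientMap (Prod.map mk (id : Hilb → Hilb)) :=
    IsOpenQuotientMap.prodMap ⟨mk_surjective, continuous_mk, isOpenMap_mk⟩ .id
  refine hq.isQuotientMap.continuous_iff.2 ?_
  change Continuous fun p : HilbNonzero × Hilb =>
    (inner ℂ p.1.1 p.2 / inner ℂ p.1.1 p.1.1) • p.1.1
  have h₁ : Continuous fun p : HilbNonzero × Hilb => inner ℂ p.1.1 p.2 := by fun_prop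
  have h₂ : Continuous fun p : HilbNonzero × Hilb => inner ℂ p.1.1 p.1.1 := by fun_prop
  have h₃ : Continuous fun p : HilbNonzero × Hilb => p.1.1 := by fun_prop
  exact (h₁.div h₂ fun p => inner_self_ne_zero.2 p.1.2).smul h₃

/-- Pairs of lines which are not orthogonal, that is, such that the orthogonal projection to the
first line is injective on the second one. -/
def nonOrthogonal : Set (BUOne × BUOne) :=
  {p | ∀ w ∈ p.2.line, w ≠ 0 → proj p.1 w ≠ 0}

theorem isOpen_nonOrthogonal : IsOpen nonOrthogonal := by
  have hq : IsOpenQuotientMap (Prod.map (id : BUOne → BUOne) mk) :=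
    IsOpenQuotientMap.prodMap .id ⟨mk_surjective, continuous_mk, isOpenMap_mk⟩
  refine hq.isQuotientMap.isOpen_preimage.1 ?_
  have hopen : IsOpen {p : BUOne × HilbNonzero | proj p.1 p.2.1 ≠ 0} :=
    isOpen_ne.preimage (continuous_proj.comp
      (f := fun p : BUOne × HilbNonzero => (p.1, p.2.1)) (by fun_prop))
  convert hopen using 1
  refine Set.ext fun p => ⟨fun h => h p.2.1 (mem_line p.2) p.2.2, fun h w hw hw0 => ?_⟩
  obtain ⟨a, rfl⟩ := Submodule.mem_span_singleton.1 (show w ∈ Submodule.span ℂ {p.2.1} from hw)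
  change proj p.1 _ ≠ 0
  rw [proj_smul]
  exact smul_ne_zero (fun h => hw0 (by simp [h])) h

/-- Maps from a cube to `BU(1)` lift to nonzero vectors: the lift at `x` is obtained from a vector
of the line over `0` by projecting it successively to the lines over `x / N`, `2 x / N`, …, `x`,
where `N` is so large that consecutive lines are never orthogonal. -/
theorem exists_lift {n : ℕ} (g : C(Fin n → I, BUOne)) :
    ∃ s : C(Fin n → I, HilbNonzero), ∀ x, mk (s x) = g x := by
  have hO : IsOpen {p : (Fin n → I) × (Fin n → I) | (g p.1, g p.2) ∈ nonOrthogonal} :=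
    isOpen_nonOrthogonal.preimage (by fun_prop)
  have hdiag : {p : (Fin n → I) × (Fin n → I) | (g p.1, g p.2) ∈ nonOrthogonal} ∈
      uniformity (Fin n → I) := by
    rw [← nhdsSet_diagonal_eq_uniformity]
    refine hO.mem_nhdsSet.2 ?_
    rintro ⟨x, y⟩ hxy w hw hw0
    obtain rfl : x = y := hxy
    rwa [proj_eq_self hw]
  obtain ⟨ε, hε, hεO⟩ := Metric.mem_uniformity_dist.1 hdiag
  obtain ⟨N, hN⟩ := exists_nat_one_div_lt hε
  replace hN : 1 / ((N + 1 : ℕ) : ℝ) < ε := by exact_mod_cast hN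
  generalize hN' : N + 1 = N' at hN
  have hNpos : 0 < N' := by omega
  let sc : ℕ → (Fin n → I) → Fin n → I := fun k x i => slabPoint N' k 0 * x i
  have hsc : ∀ k, Continuous (sc k) := fun k => by fun_prop
  have hdist : ∀ k x, dist (sc (k + 1) x) (sc k x) < ε := by
    intro k x
    refine lt_of_le_of_lt ((dist_pi_le_iff (by positivity)).2 fun i => ?_) hN
    have h := dist_slabPoint_le (N := N') k 1 0
    rw [slabPoint_one] at h
    change |((slabPoint N' (k + 1) 0 : ℝ) * x i - (slabPoint N' k 0 : ℝ) * x i)| ≤ _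
    rw [← sub_mul, abs_mul]
    refine le_trans (mul_le_of_le_one_right (abs_nonneg _) ?_) h
    rw [abs_le]
    constructor <;> linarith [(x i).2.1, (x i).2.2]
  have key : ∀ k : ℕ, ∃ s : C(Fin n → I, HilbNonzero), ∀ x, mk (s x) = g (sc k x) := by
    intro k
    induction k with
    | zero =>
      obtain ⟨v, hv⟩ := mk_surjective (g 0)
      refine ⟨ContinuousMap.const _ v, fun x => hv.trans ?_⟩
      congr 1
      funext i
      refine Subtype.ext ?_
      simp [sc, slabPoint]
    | succ k ih =>
      obtain ⟨s, hs⟩ := ih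
      have hne : ∀ x, proj (g (sc (k + 1) x)) (s x) ≠ 0 := fun x =>
        hεO (hdist k x) _ (hs x ▸ mem_line (s x)) (s x).2
      refine ⟨⟨fun x => ⟨proj (g (sc (k + 1) x)) (s x), hne x⟩, ?_⟩, fun x => ?_⟩
      · refine Continuous.subtype_mk
          (continuous_proj.comp (f := fun x => (g (sc (k + 1) x), (s x : Hilb))) ?_) _
        exact (g.continuous.comp (hsc _)).prodMk (by fun_prop)
      · exact mk_eq_of_mem_line (proj_mem _ _)
  obtain ⟨s, hs⟩ := key N'
  refine ⟨s, fun x => (hs x).trans ?_⟩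
  congr 1
  funext i
  have : slabPoint N' N' 0 = 1 := by
    simp [slabPoint, div_self (show (N' : ℝ) ≠ 0 by positivity)]
  simp [sc, this]

/-- A sphere in `BU(1)` lifts to a cube in the contractible space of nonzero vectors. On the
boundary, the lift differs from a constant vector by a map to the nonzero complex numbers, which
extends to the cube. Dividing by the extension, the lift becomes a sphere of nonzero vectors. -/
theorem subsingleton_pi {n : ℕ} (hn : 3 ≤ n) (y : BUOne) :
    Subsingleton (HomotopyGroup.Pi n BUOne y) := by
  suffices h : ∀ g : GenLoop (Fin n) BUOne y, GenLoop.Homotopic g GenLoop.const by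
    refine ⟨fun a b => ?_⟩
    induction a using Quotient.inductionOn with | _ p => ?_
    induction b using Quotient.inductionOn with | _ q => ?_
    exact Quotient.sound ((h p).trans (h q).symm)
  intro g
  obtain ⟨v, rfl⟩ := mk_surjective y
  have hv : inner ℂ v.1 v.1 ≠ 0 := inner_self_ne_zero.2 v.2
  obtain ⟨s, hs⟩ := exists_lift g.1
  let u : (Fin n → I) → ℂ := fun x => inner ℂ v.1 (s x).1 / inner ℂ v.1 v.1
  have hu : Continuous u := Continuous.div (by fun_prop) (by fun_prop) fun _ => hv
  have hus : ∀ x ∈ Cube.boundary (Fin n), (s x).1 = u x • v.1 := by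
    intro x hx
    obtain ⟨a, ha⟩ := mk_eq_mk_iff.1 ((hs x).trans (g.2 x hx))
    simp only [u]
    rw [← ha, inner_smul_right, mul_div_assoc, div_self hv, mul_one]
  have hu0 : ∀ x ∈ Cube.boundary (Fin n), u x ≠ 0 := fun x hx h =>
    (s x).2 (by rw [hus x hx, h, zero_smul])
  -- the factor by which the lift has to be corrected extends from the boundary to the cube
  obtain ⟨U, hU⟩ := cubeExt_CNonzero hn
    (fun x => if h : u x ≠ 0 then ⟨u x, h⟩ else ⟨1, one_ne_zero⟩) (by
      refine Topology.IsInducing.subtypeVal.continuousOn_iff.2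
        (hu.continuousOn.congr fun x hx => ?_)
      simp [hu0 x hx])
  have hU' : ∀ x ∈ Cube.boundary (Fin n), (U x : ℂ) = u x := fun x hx => by
    rw [hU hx]
    simp [hu0 x hx]
  let s' : C(Fin n → I, HilbNonzero) :=
    ⟨fun x => ⟨(U x : ℂ)⁻¹ • (s x).1, smul_ne_zero (inv_ne_zero (U x).2) (s x).2⟩, by
      refine Continuous.subtype_mk (Continuous.smul (Continuous.inv₀ (by fun_prop) fun x => (U x).2)
        (by fun_prop)) _⟩
  have hs' : ∀ x, mk (s' x) = g x := fun x =>
    (mk_eq_mk_iff.2 ⟨(U x : ℂ)⁻¹, rfl⟩).trans (hs x)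
  have hs'b : ∀ x ∈ Cube.boundary (Fin n), s' x = v := fun x hx => Subtype.ext (by
    change (U x : ℂ)⁻¹ • (s x).1 = v.1
    rw [hU' x hx, hus x hx, smul_smul, inv_mul_cancel₀ (hu0 x hx), one_smul])
  obtain ⟨G, hG₀, hG₁, hG⟩ := Extends.exists_family_of_paths (isClosed_cube_boundary n)
    (Extends.of_contractible (isClosed_prism (isClosed_cube_boundary n)) (hasBoxRetraction_prism n))
    s' (ContinuousMap.const _ v) (fun _ => v) continuousOn_const
    (fun x hx => (hs'b x hx).symm) (fun x hx => rfl)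
  refine ⟨⟨⟨⟨fun p => mk (G (p.2, p.1)), continuous_mk.comp (by fun_prop)⟩, fun x => ?_,
    fun x => ?_⟩, ?_⟩⟩
  · exact (congrArg mk (hG₀ x)).trans (hs' x)
  · exact congrArg mk (hG₁ x)
  · intro t x hx
    exact (congrArg mk (hG x hx t)).trans (g.2 x hx).symm

theorem cubeExt {n : ℕ} (hn : 4 ≤ n) : CubeExt n BUOne := by
  obtain ⟨k, rfl⟩ : ∃ k, n = k + 1 := ⟨n - 1, by omega⟩
  exact CubeExt.of_subsingleton_pi fun y => subsingleton_pi (by omega) y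

end BUOne

/-! ### Interpolation of compatible complex structures -/

section Algebra

variable {R : Type*} [Ring R]

/-- The Cayley transform of the complex structure `b` relative to the complex structure `a`. It
anticommutes with `a`. -/
def cayley (a b : R) : R := Ring.inverse (b + a) * (b - a)

theorem cayley_anticomm {a b : R} (ha : a * a = -1) (hb : b * b = -1) (hu : IsUnit (b + a)) :
    cayley a b * a = -(a * cayley a b) := by
  have h₁ : (b + a) * a = b * (b + a) := by rw [add_mul, mul_add, ha, hb, add_comm]
  have h₂ : a * Ring.inverse (b + a) = Ring.inverse (b + a) * b := by
    have := congrArg (fun z => Ring.inverse (b + a) * z * Ring.inverse (b + a)) h₁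
    simpa [mul_assoc, Ring.mul_inverse_cancel _ hu, Ring.inverse_mul_cancel_left _ _ hu] using this
  rw [cayley, ← mul_assoc, h₂, mul_assoc, mul_assoc, ← mul_neg]
  congr 1
  rw [sub_mul, mul_sub, ha, hb]
  abel

theorem cayley_mul_add {a b : R} (ha : a * a = -1) (hb : b * b = -1) (hu : IsUnit (b + a)) :
    cayley a b * (b + a) = -(b - a) := by
  have : (b - a) * (b + a) = (b + a) * -(b - a) := by
    simp only [sub_mul, mul_add, add_mul, neg_sub, mul_sub, ha, hb]
    abel
  rw [cayley, mul_assoc, this, Ring.inverse_mul_cancel_left _ _ hu]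

theorem add_mul_cayley {a b : R} (hu : IsUnit (b + a)) : (b + a) * cayley a b = b - a :=
  Ring.mul_inverse_cancel_left _ _ hu

variable [Algebra ℝ R]

/-- For complex structures `a` and `b`, a path from `1` to an element which conjugates
`a` to `b`. -/
def shear (t : ℝ) (a b : R) : R := 1 - t • cayley a b

/-- A path of complex structures from `a` to `b`. -/
def interp (t : ℝ) (a b : R) : R := shear t a b * a * Ring.inverse (shear t a b)

/-- The intertwiner from `interp t a b` to `b`. -/
def intertwiner (t : ℝ) (a b : R) : R := shear 1 a b * Ring.inverse (shear t a b)

theorem shear_zero (a b : R) : shear 0 a b = 1 := by simp [shear]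

theorem interp_zero (a b : R) : interp 0 a b = a := by simp [interp, shear_zero]

theorem shear_one_mul {a b : R} (ha : a * a = -1) (hb : b * b = -1) (hu : IsUnit (b + a)) :
    shear 1 a b * a = b * shear 1 a b := by
  have h := add_mul_cayley hu
  rw [shear, one_smul, sub_mul, mul_sub, one_mul, mul_one, cayley_anticomm ha hb hu]
  rw [add_mul] at h
  have : b * cayley a b = b - a - a * cayley a b := by rw [← h]; abel
  rw [this]
  abel

theorem interp_mul_shear {a b : R} {t : ℝ} (hG : IsUnit (shear t a b)) :
    interp t a b * shear t a b = shear t a b * a := by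
  rw [interp, mul_assoc, Ring.inverse_mul_cancel _ hG, mul_one]

theorem interp_one {a b : R} (ha : a * a = -1) (hb : b * b = -1) (hu : IsUnit (b + a))
    (hG : IsUnit (shear 1 a b)) : interp 1 a b = b := by
  rw [interp, shear_one_mul ha hb hu, mul_assoc, Ring.mul_inverse_cancel _ hG, mul_one]

theorem interp_mul_self {a b : R} (ha : a * a = -1) {t : ℝ} (hG : IsUnit (shear t a b)) :
    interp t a b * interp t a b = -1 := by
  have : interp t a b * interp t a b =
      shear t a b * (a * a) * Ring.inverse (shear t a b) := by
    conv_lhs => rw [interp, mul_assoc, mul_assoc, ← mul_assoc (Ring.inverse _), ← mul_assoc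
      (Ring.inverse _), Ring.inverse_mul_cancel _ hG, one_mul]
    simp only [mul_assoc]
  rw [this, ha, mul_neg, mul_one, neg_mul, Ring.mul_inverse_cancel _ hG]

theorem intertwiner_mul_interp {a b : R} (ha : a * a = -1) (hb : b * b = -1) (hu : IsUnit (b + a))
    {t : ℝ} (hG : IsUnit (shear t a b)) :
    intertwiner t a b * interp t a b = b * intertwiner t a b := by
  rw [intertwiner, interp, mul_assoc, mul_assoc, ← mul_assoc (Ring.inverse _),
    Ring.inverse_mul_cancel _ hG, one_mul, ← mul_assoc, ← mul_assoc, shear_one_mul ha hb hu]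

theorem intertwiner_one {a b : R} (hG : IsUnit (shear 1 a b)) : intertwiner 1 a b = 1 :=
  Ring.mul_inverse_cancel _ hG

section Map

variable {R' : Type*} [Ring R'] [Algebra ℝ R'] (f : R ≃ₐ[ℝ] R')

theorem map_ringInverse_algEquiv (a : R) : f (Ring.inverse a) = Ring.inverse (f a) := by
  by_cases ha : IsUnit a
  · obtain ⟨u, rfl⟩ := ha
    rw [Ring.inverse_unit]
    have := Ring.inverse_unit (Units.map (f : R →* R') u)
    rw [Units.coe_map] at this
    exact this.symm
  · have : ¬IsUnit (f a) := fun h => ha (by simpa using h.map f.symm)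
    rw [Ring.inverse_non_unit _ ha, Ring.inverse_non_unit _ this, map_zero]

theorem map_shear (t : ℝ) (a b : R) : f (shear t a b) = shear t (f a) (f b) := by
  simp [shear, cayley, map_ringInverse_algEquiv]

theorem map_interp (t : ℝ) (a b : R) : f (interp t a b) = interp t (f a) (f b) := by
  simp [interp, map_shear, map_ringInverse_algEquiv]

theorem map_intertwiner (t : ℝ) (a b : R) : f (intertwiner t a b) = intertwiner t (f a) (f b) := by
  simp [intertwiner, map_shear, map_ringInverse_algEquiv]

end Map

end Algebra

section Smoothness

variable {R : Type*} [NormedRing R] [NormedAlgebra ℝ R] [CompleteSpace R]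

theorem contDiffAt_ring_inverse {a : R} (ha : IsUnit a) :
    ContDiffAt ℝ ∞ (Ring.inverse : R → R) a := by
  obtain ⟨u, rfl⟩ := ha
  exact contDiffAt_ringInverse ℝ u

theorem contDiffAt_shear {p : ℝ × R × R} (hu : IsUnit (p.2.2 + p.2.1)) :
    ContDiffAt ℝ ∞ (fun q : ℝ × R × R => shear q.1 q.2.1 q.2.2) p := by
  have h₁ : ContDiffAt ℝ ∞ (fun q : ℝ × R × R => q.1) p := contDiffAt_fst
  have h₂ : ContDiffAt ℝ ∞ (fun q : ℝ × R × R => q.2.1) p := by fun_prop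
  have h₃ : ContDiffAt ℝ ∞ (fun q : ℝ × R × R => q.2.2) p := by fun_prop
  have h₄ : ContDiffAt ℝ ∞ (fun q : ℝ × R × R => Ring.inverse (q.2.2 + q.2.1)) p :=
    ContDiffAt.comp p (contDiffAt_ring_inverse hu) (h₃.add h₂)
  exact contDiffAt_const.sub (h₁.smul (h₄.mul (h₃.sub h₂)))

theorem contDiffAt_interp {p : ℝ × R × R} (hu : IsUnit (p.2.2 + p.2.1))
    (hG : IsUnit (shear p.1 p.2.1 p.2.2)) :
    ContDiffAt ℝ ∞ (fun q : ℝ × R × R => interp q.1 q.2.1 q.2.2) p := by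
  have h₂ : ContDiffAt ℝ ∞ (fun q : ℝ × R × R => q.2.1) p := by fun_prop
  have h₃ := contDiffAt_shear hu
  have h₄ : ContDiffAt ℝ ∞ (fun q : ℝ × R × R => Ring.inverse (shear q.1 q.2.1 q.2.2)) p :=
    ContDiffAt.comp p (contDiffAt_ring_inverse hG) h₃
  exact (h₃.mul h₂).mul h₄

theorem continuousAt_intertwiner {p : ℝ × R × R} (hu : IsUnit (p.2.2 + p.2.1))
    (hG : IsUnit (shear p.1 p.2.1 p.2.2)) :
    ContinuousAt (fun q : ℝ × R × R => intertwiner q.1 q.2.1 q.2.2) p := by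
  have h₃ := (contDiffAt_shear hu).continuousAt
  have h₁ : ContinuousAt (fun q : ℝ × R × R => shear 1 q.2.1 q.2.2) p :=
    ContinuousAt.comp (g := fun q : ℝ × R × R => shear q.1 q.2.1 q.2.2)
      (f := fun q : ℝ × R × R => (1, q.2))
      (contDiffAt_shear (p := ((1 : ℝ), p.2)) hu).continuousAt (by fun_prop)
  have h₄ : ContinuousAt (fun q : ℝ × R × R => Ring.inverse (shear q.1 q.2.1 q.2.2)) p :=
    ContinuousAt.comp (f := fun q : ℝ × R × R => shear q.1 q.2.1 q.2.2)
      (contDiffAt_ring_inverse hG).continuousAt h₃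
  exact h₁.mul h₄

end Smoothness

section Symplectic

variable {V : Type*} [AddCommGroup V] [Module ℝ V] [TopologicalSpace V] [IsTopologicalAddGroup V]

/-- A complex structure compatible with the bilinear form `B`. -/
structure IsCompatible (B : LinearMap.BilinForm ℝ V) (J : V →L[ℝ] V) : Prop where
  sq : J * J = -1
  symplectic : ∀ v w, B (J v) (J w) = B v w
  pos : ∀ v, v ≠ 0 → 0 < B v (J v)

namespace IsCompatible

variable {B : LinearMap.BilinForm ℝ V} {a b : V →L[ℝ] V}

theorem apply_apply (ha : IsCompatible B a) (v : V) : a (a v) = -v :=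
  congrArg (fun A : V →L[ℝ] V => A v) ha.sq

theorem skew (ha : IsCompatible B a) (v w : V) : B (a v) w = -B v (a w) := by
  have := ha.symplectic v (a w)
  rw [ha.apply_apply, map_neg] at this
  linarith

end IsCompatible

variable [ContinuousSMul ℝ V] [T2Space V] [FiniteDimensional ℝ V]

theorem isUnit_of_injective (A : V →L[ℝ] V) (hA : ∀ v, A v = 0 → v = 0) : IsUnit A := by
  have hinj : Function.Injective (A : V →ₗ[ℝ] V) := (injective_iff_map_eq_zero _).2 hA
  let e := (LinearEquiv.ofInjectiveEndo (A : V →ₗ[ℝ] V) hinj).toContinuousLinearEquiv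
  refine ⟨⟨A, e.symm, ?_, ?_⟩, rfl⟩
  · ext v
    exact e.apply_symm_apply v
  · ext v
    exact e.symm_apply_apply v

namespace IsCompatible

variable {B : LinearMap.BilinForm ℝ V} {a b : V →L[ℝ] V}

theorem isUnit_add (ha : IsCompatible B a) (hb : IsCompatible B b) : IsUnit (b + a) := by
  refine isUnit_of_injective _ fun v hv => ?_
  by_contra hne
  have h := add_pos (hb.pos v hne) (ha.pos v hne)
  rw [← map_add] at h
  have : b v + a v = 0 := hv
  rw [this, map_zero] at h
  exact lt_irrefl _ h

theorem cayley_skew (ha : IsCompatible B a) (hb : IsCompatible B b) (v w : V) :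
    B (cayley a b v) w = -B v (cayley a b w) := by
  have hu := isUnit_add ha hb
  obtain ⟨z, rfl⟩ : ∃ z, (b + a) z = w :=
    ⟨Ring.inverse (b + a) w, congrArg (fun A : V →L[ℝ] V => A w) (Ring.mul_inverse_cancel _ hu)⟩
  have h₁ : cayley a b ((b + a) z) = -(b z - a z) :=
    congrArg (fun A : V →L[ℝ] V => A z) (cayley_mul_add ha.sq hb.sq hu)
  have h₂ : b (cayley a b v) + a (cayley a b v) = b v - a v :=
    congrArg (fun A : V →L[ℝ] V => A v) (add_mul_cayley hu)
  have h₃ : B (cayley a b v) ((b + a) z) = -B (b v - a v) z := by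
    rw [← h₂]
    simp only [_root_.add_apply, map_add, LinearMap.add_apply, ha.skew, hb.skew]
    ring
  rw [h₃, h₁]
  simp only [map_sub, map_neg, LinearMap.sub_apply, ha.skew, hb.skew]
  ring

theorem form_shear (ha : IsCompatible B a) (hb : IsCompatible B b) (t : ℝ) (v w : V) :
    B (shear t a b v) (shear t a b w) = B v w + t ^ 2 * B (cayley a b v) (cayley a b w) := by
  have h : ∀ u, shear t a b u = u - t • cayley a b u := fun u => rfl
  rw [h, h]
  simp only [map_sub, map_smul, LinearMap.sub_apply, LinearMap.smul_apply, smul_eq_mul,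
    cayley_skew ha hb v w]
  ring

theorem cayley_apply (ha : IsCompatible B a) (hb : IsCompatible B b) (v : V) :
    cayley a b (a v) = -a (cayley a b v) :=
  congrArg (fun A : V →L[ℝ] V => A v) (cayley_anticomm ha.sq hb.sq (isUnit_add ha hb))

theorem form_shear_pos (ha : IsCompatible B a) (hb : IsCompatible B b) {t : ℝ} (ht₀ : 0 ≤ t)
    (ht₁ : t ≤ 1) {v : V} (hv : v ≠ 0) : 0 < B (shear t a b v) (shear t a b (a v)) := by
  have key : ∀ s : ℝ, B (shear s a b v) (shear s a b (a v)) =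
      B v (a v) - s ^ 2 * B (cayley a b v) (a (cayley a b v)) := fun s => by
    rw [form_shear ha hb, cayley_apply ha hb, map_neg]
    ring
  have hpos := ha.pos v hv
  have hu := isUnit_add ha hb
  -- the case `t = 1` is the positivity of `b`, and implies the others
  have h₁ : 0 < B (shear 1 a b v) (shear 1 a b (a v)) := by
    have hcomm : shear 1 a b (a v) = b (shear 1 a b v) :=
      congrArg (fun A : V →L[ℝ] V => A v) (shear_one_mul ha.sq hb.sq hu)
    rw [hcomm]
    refine hb.pos _ fun h0 => ?_
    have h2 : cayley a b v = v := by
      have : v - (1 : ℝ) • cayley a b v = 0 := h0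
      rw [one_smul, sub_eq_zero] at this
      exact this.symm
    have h3 : b v + a v = b v - a v := by
      conv_lhs => rw [← h2]
      exact congrArg (fun A : V →L[ℝ] V => A v) (add_mul_cayley hu)
    have h4 : a v = 0 := by
      have : (2 : ℝ) • a v = 0 := by
        rw [two_smul]
        have := congrArg (fun z => z - b v + a v) h3
        simpa using this
      exact (smul_eq_zero.1 this).resolve_left two_ne_zero
    rw [h4, map_zero] at hpos
    exact lt_irrefl _ hpos
  rw [key] at h₁ ⊢
  by_cases hc : 0 ≤ B (cayley a b v) (a (cayley a b v))
  · nlinarith [mul_le_mul_of_nonneg_right (show t ^ 2 ≤ 1 by nlinarith) hc]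
  · nlinarith [sq_nonneg t]

theorem isUnit_shear (ha : IsCompatible B a) (hb : IsCompatible B b) {t : ℝ} (ht₀ : 0 ≤ t)
    (ht₁ : t ≤ 1) : IsUnit (shear t a b) := by
  refine isUnit_of_injective _ fun v hv => ?_
  by_contra hne
  have := form_shear_pos ha hb ht₀ ht₁ hne
  rw [hv, map_zero] at this
  exact lt_irrefl _ this

theorem interp (ha : IsCompatible B a) (hb : IsCompatible B b) {t : ℝ} (ht₀ : 0 ≤ t)
    (ht₁ : t ≤ 1) : IsCompatible B (interp t a b) := by
  have hG := isUnit_shear ha hb ht₀ ht₁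
  have hsurj : ∀ v, ∃ u, shear t a b u = v := fun v =>
    ⟨Ring.inverse (shear t a b) v,
      congrArg (fun A : V →L[ℝ] V => A v) (Ring.mul_inverse_cancel _ hG)⟩
  have hJ : ∀ u, Liouville.interp t a b (shear t a b u) = shear t a b (a u) := fun u =>
    congrArg (fun A : V →L[ℝ] V => A u) (interp_mul_shear hG)
  refine ⟨interp_mul_self ha.sq hG, fun v w => ?_, fun v hv => ?_⟩
  · obtain ⟨v, rfl⟩ := hsurj v
    obtain ⟨w, rfl⟩ := hsurj w
    rw [hJ, hJ, form_shear ha hb, form_shear ha hb, cayley_apply ha hb, cayley_apply ha hb,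
      ha.symplectic, map_neg, map_neg, LinearMap.neg_apply, neg_neg, ha.symplectic]
  · obtain ⟨v, rfl⟩ := hsurj v
    rw [hJ]
    exact form_shear_pos ha hb ht₀ ht₁ fun h => hv (by rw [h, map_zero])

end IsCompatible

end Symplectic

/-! ### Families of linear maps between tangent spaces -/

section Coordinates

open Bundle ContinuousLinearMap

variable {E : Type*} [NormedAddCommGroup E] [NormedSpace ℝ E] {H : Type*}
  [TopologicalSpace H] {J : ModelWithCorners ℝ E H} {M : Type*} [TopologicalSpace M]
  [ChartedSpace H M]

theorem contMDiffAt_clm_of_apply [FiniteDimensional ℝ E] {f : M → E →L[ℝ] E} {x₀ : M}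
    (h : ∀ e, ContMDiffAt J 𝓘(ℝ, E) ∞ (fun x => f x e) x₀) :
    ContMDiffAt J 𝓘(ℝ, E →L[ℝ] E) ∞ f x₀ := by
  let e : (E →L[ℝ] E) ≃L[ℝ] Fin (Module.finrank ℝ E) → E :=
    ((ContinuousLinearEquiv.ofFinrankEq (Module.finrank_fin_fun ℝ).symm).arrowCongr
      (1 : E ≃L[ℝ] E)).trans (ContinuousLinearEquiv.piRing _)
  have h₁ : ContMDiffAt J 𝓘(ℝ, Fin (Module.finrank ℝ E) → E) ∞ (fun x => e (f x)) x₀ :=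
    contMDiffAt_pi_space.2 fun i => h _
  have h₂ := (e.symm.contDiff (n := ∞)).contMDiff.contMDiffAt.comp x₀ h₁
  refine h₂.congr_of_eventuallyEq (Filter.Eventually.of_forall fun x => ?_)
  exact (e.symm_apply_apply (f x)).symm

variable [IsManifold J ∞ M]

/-- The vector field near `x₀` which is constant in the trivialization at `x₀`. -/
def localFrame (J : ModelWithCorners ℝ E H) [IsManifold J ∞ M] (x₀ : M) (e : E) (x : M) :
    TangentSpace J x :=
  (trivializationAt E (TangentSpace J) x₀).symmL ℝ x e

theorem mem_baseSet_self (x₀ : M) : x₀ ∈ (trivializationAt E (TangentSpace J) x₀).baseSet :=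
  FiberBundle.mem_baseSet_trivializationAt' x₀

theorem baseSet_mem_nhds (x₀ : M) : (trivializationAt E (TangentSpace J) x₀).baseSet ∈ 𝓝 x₀ :=
  (trivializationAt E (TangentSpace J) x₀).open_baseSet.mem_nhds (mem_baseSet_self x₀)

theorem trivializationAt_localFrame {x₀ x : M}
    (hx : x ∈ (trivializationAt E (TangentSpace J) x₀).baseSet) (e : E) :
    (trivializationAt E (TangentSpace J) x₀
      (⟨x, localFrame J x₀ e x⟩ : TangentBundle J M)).2 = e := by
  rw [localFrame, Trivialization.symmL_apply _ hx, Trivialization.apply_mk_symm _ hx]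

theorem continuousAt_localFrame {P : Type*} [TopologicalSpace P] {f : P → M} {p₀ : P}
    (hf : ContinuousAt f p₀) (e : E) :
    ContinuousAt (fun p => (⟨f p, localFrame J (f p₀) e (f p)⟩ : TangentBundle J M)) p₀ := by
  rw [FiberBundle.continuousAt_totalSpace]
  refine ⟨hf, (continuousAt_const (y := e)).congr ?_⟩
  filter_upwards [hf (baseSet_mem_nhds (J := J) (f p₀))] with p hp
  exact (trivializationAt_localFrame hp e).symm

theorem contMDiffAt_localFrame (x₀ : M) (e : E) :
    ContMDiffAt J J.tangent ∞ (fun x => (⟨x, localFrame J x₀ e x⟩ : TangentBundle J M)) x₀ := by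
  rw [contMDiffAt_totalSpace]
  refine ⟨contMDiffAt_id, (contMDiffAt_const (c := e)).congr_of_eventuallyEq ?_⟩
  filter_upwards [baseSet_mem_nhds (J := J) x₀] with x hx
  exact trivializationAt_localFrame hx e

theorem inCoordinates_apply {x₀ y₀ x y : M} (A : TangentSpace J x →L[ℝ] TangentSpace J y)
    (hy : y ∈ (trivializationAt E (TangentSpace J) y₀).baseSet) (e : E) :
    inCoordinates E (TangentSpace J) E (TangentSpace J) x₀ x y₀ y A e =
      (trivializationAt E (TangentSpace J) y₀
        (⟨y, A (localFrame J x₀ e x)⟩ : TangentBundle J M)).2 := by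
  change (trivializationAt E (TangentSpace J) y₀).continuousLinearMapAt ℝ y
    (A (localFrame J x₀ e x)) = _
  rw [Trivialization.continuousLinearMapAt_apply, Trivialization.coe_linearMapAt_of_mem _ hy]

/-- A family of linear maps of tangent spaces is continuous in coordinates if its values on the
vector fields which are constant in a trivialization are continuous. -/
theorem continuousAt_inCoordinates [FiniteDimensional ℝ E] {P : Type*} [TopologicalSpace P]
    {f g : P → M} {A : ∀ p, TangentSpace J (f p) →L[ℝ] TangentSpace J (g p)} {p₀ : P}
    (h : ∀ e : E, ContinuousAt
      (fun p => (⟨g p, A p (localFrame J (f p₀) e (f p))⟩ : TangentBundle J M)) p₀) :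
    ContinuousAt (fun p => inCoordinates E (TangentSpace J) E (TangentSpace J)
      (f p₀) (f p) (g p₀) (g p) (A p)) p₀ := by
  refine continuousAt_clm_apply.2 fun e => ?_
  obtain ⟨hg, h₂⟩ := (FiberBundle.continuousAt_totalSpace E _).1 (h e)
  refine h₂.congr ?_
  filter_upwards [hg (baseSet_mem_nhds (J := J) (g p₀))] with p hp
  exact (inCoordinates_apply (A p) hp e).symm

theorem contMDiffAt_inCoordinates [FiniteDimensional ℝ E]
    {A : ∀ x : M, TangentSpace J x →L[ℝ] TangentSpace J x} {x₀ : M}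
    (h : ∀ e : E, ContMDiffAt J J.tangent ∞
      (fun x => (⟨x, A x (localFrame J x₀ e x)⟩ : TangentBundle J M)) x₀) :
    ContMDiffAt J 𝓘(ℝ, E →L[ℝ] E) ∞ (fun x => inCoordinates E (TangentSpace J) E (TangentSpace J)
      x₀ x x₀ x (A x)) x₀ := by
  refine contMDiffAt_clm_of_apply fun e => ?_
  obtain ⟨-, h₂⟩ := contMDiffAt_totalSpace.1 (h e)
  refine h₂.congr_of_eventuallyEq ?_
  filter_upwards [baseSet_mem_nhds (J := J) x₀] with x hx
  exact inCoordinates_apply (A x) hx e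

/-- Conjugation with a trivialization of the tangent bundle. -/
def coordAlgEquiv {x₀ x : M} (hx : x ∈ (trivializationAt E (TangentSpace J) x₀).baseSet) :
    (TangentSpace J x →L[ℝ] TangentSpace J x) ≃ₐ[ℝ] (E →L[ℝ] E) :=
  let e := (trivializationAt E (TangentSpace J) x₀).continuousLinearEquivAt ℝ x hx
  AlgEquiv.ofLinearEquiv
    { toFun := fun A => (e : _ →L[ℝ] E) ∘L A ∘L (e.symm : E →L[ℝ] _)
      invFun := fun A => (e.symm : E →L[ℝ] _) ∘L A ∘L (e : _ →L[ℝ] E)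
      map_add' := fun A B => by ext; simp
      map_smul' := fun c A => by ext; simp
      left_inv := fun A => by ext; simp
      right_inv := fun A => by ext; simp }
    (by ext v; exact e.apply_symm_apply v)
    (fun A B => by
      ext v
      change e (A (B (e.symm v))) = e (A (e.symm (e (B (e.symm v)))))
      rw [e.symm_apply_apply])

theorem coordAlgEquiv_apply {x₀ x : M}
    (hx : x ∈ (trivializationAt E (TangentSpace J) x₀).baseSet)
    (A : TangentSpace J x →L[ℝ] TangentSpace J x) :
    coordAlgEquiv hx A = inCoordinates E (TangentSpace J) E (TangentSpace J) x₀ x x₀ x A :=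
  (inCoordinates_eq hx hx).symm

variable {P : Type*} [TopologicalSpace P] [FiniteDimensional ℝ E]

/-- Pointwise continuity on the total space of a continuous family of interpolations. -/
theorem continuousAt_interp_apply {f : P → M} {p₀ : P} (hf : ContinuousAt f p₀) {t : P → ℝ}
    (ht : ContinuousAt t p₀) {a b : ∀ p, TangentSpace J (f p) →L[ℝ] TangentSpace J (f p)}
    (ha : ∀ e : E, ContinuousAt
      (fun p => (⟨f p, a p (localFrame J (f p₀) e (f p))⟩ : TangentBundle J M)) p₀)
    (hb : ∀ e : E, ContinuousAt
      (fun p => (⟨f p, b p (localFrame J (f p₀) e (f p))⟩ : TangentBundle J M)) p₀)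
    (hu : IsUnit (b p₀ + a p₀)) (hG : IsUnit (shear (t p₀) (a p₀) (b p₀)))
    {v : ∀ p, TangentSpace J (f p)}
    (hv : ContinuousAt (fun p => (⟨f p, v p⟩ : TangentBundle J M)) p₀) :
    ContinuousAt (fun p => (⟨f p, interp (t p) (a p) (b p) (v p)⟩ : TangentBundle J M)) p₀ ∧
    ContinuousAt (fun p =>
      (⟨f p, intertwiner (t p) (a p) (b p) (v p)⟩ : TangentBundle J M)) p₀ := by
  let A' := fun p => inCoordinates E (TangentSpace J) E (TangentSpace J)
    (f p₀) (f p) (f p₀) (f p) (a p)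
  let B' := fun p => inCoordinates E (TangentSpace J) E (TangentSpace J)
    (f p₀) (f p) (f p₀) (f p) (b p)
  have hab : ContinuousAt (fun p => (t p, A' p, B' p)) p₀ := ht.prodMk
    ((continuousAt_inCoordinates ha).prodMk (continuousAt_inCoordinates hb))
  let F := coordAlgEquiv (mem_baseSet_self (J := J) (f p₀))
  have hu' := hu.map F
  have hG' := hG.map F
  rw [map_add, coordAlgEquiv_apply, coordAlgEquiv_apply] at hu'
  rw [map_shear, coordAlgEquiv_apply, coordAlgEquiv_apply] at hG'
  constructor
  · refine ContinuousAt.clm_apply_of_inCoordinates ?_ hv hf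
    refine ContinuousAt.congr (ContinuousAt.comp (f := fun p => (t p, A' p, B' p))
      (contDiffAt_interp (p := (t p₀, A' p₀, B' p₀)) hu' hG').continuousAt hab) ?_
    filter_upwards [hf (baseSet_mem_nhds (J := J) (f p₀))] with p hp
    simp only [Function.comp_apply, A', B']
    rw [← coordAlgEquiv_apply hp, ← coordAlgEquiv_apply hp, ← coordAlgEquiv_apply hp, map_interp]
  · refine ContinuousAt.clm_apply_of_inCoordinates ?_ hv hf
    refine ContinuousAt.congr (ContinuousAt.comp (f := fun p => (t p, A' p, B' p))
      (continuousAt_intertwiner (p := (t p₀, A' p₀, B' p₀)) hu' hG') hab) ?_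
    filter_upwards [hf (baseSet_mem_nhds (J := J) (f p₀))] with p hp
    simp only [Function.comp_apply, A', B']
    rw [← coordAlgEquiv_apply hp, ← coordAlgEquiv_apply hp, ← coordAlgEquiv_apply hp,
      map_intertwiner]

theorem contMDiff_interp (t : ℝ) {a b : ∀ x : M, TangentSpace J x →L[ℝ] TangentSpace J x}
    (ha : ContMDiff J.tangent J.tangent ∞
      (fun p : TangentBundle J M => (⟨p.proj, a p.proj p.snd⟩ : TangentBundle J M)))
    (hb : ContMDiff J.tangent J.tangent ∞
      (fun p : TangentBundle J M => (⟨p.proj, b p.proj p.snd⟩ : TangentBundle J M)))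
    (hu : ∀ x, IsUnit (b x + a x)) (hG : ∀ x, IsUnit (shear t (a x) (b x))) :
    ContMDiff J.tangent J.tangent ∞
      (fun p : TangentBundle J M =>
        (⟨p.proj, interp t (a p.proj) (b p.proj) p.snd⟩ : TangentBundle J M)) := by
  intro p₀
  have hproj : ContMDiffAt J.tangent J ∞ (fun p : TangentBundle J M => p.proj) p₀ :=
    contMDiffAt_proj (TangentSpace J)
  let F := coordAlgEquiv (mem_baseSet_self (J := J) p₀.proj)
  have hu' := (hu p₀.proj).map F
  have hG' := (hG p₀.proj).map F
  rw [map_add, coordAlgEquiv_apply, coordAlgEquiv_apply] at hu'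
  rw [map_shear, coordAlgEquiv_apply, coordAlgEquiv_apply] at hG'
  refine ContMDiffAt.clm_apply_of_inCoordinates (b₁ := fun p : TangentBundle J M => p.proj)
    (b₂ := fun p : TangentBundle J M => p.proj) (v := fun p => p.snd)
    (ϕ := fun p => interp t (a p.proj) (b p.proj)) ?_ contMDiffAt_id hproj
  have ha' := contMDiffAt_inCoordinates (x₀ := p₀.proj) (A := a) fun e =>
    ha.contMDiffAt.comp p₀.proj (contMDiffAt_localFrame p₀.proj e)
  have hb' := contMDiffAt_inCoordinates (x₀ := p₀.proj) (A := b) fun e =>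
    hb.contMDiffAt.comp p₀.proj (contMDiffAt_localFrame p₀.proj e)
  have key : ContMDiffAt J 𝓘(ℝ, E →L[ℝ] E) ∞ (fun x => inCoordinates E (TangentSpace J) E
      (TangentSpace J) p₀.proj x p₀.proj x (interp t (a x) (b x))) p₀.proj := by
    have h₁ : ContMDiffAt J 𝓘(ℝ, ℝ × (E →L[ℝ] E) × (E →L[ℝ] E)) ∞ (fun x => (t,
        inCoordinates E (TangentSpace J) E (TangentSpace J) p₀.proj x p₀.proj x (a x),
        inCoordinates E (TangentSpace J) E (TangentSpace J) p₀.proj x p₀.proj x (b x))) p₀.proj :=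
      contMDiffAt_const.prodMk_space (ha'.prodMk_space hb')
    have h₂ := (contDiffAt_interp (p := (t, _, _)) hu' hG').contMDiffAt.comp p₀.proj h₁
    refine h₂.congr_of_eventuallyEq ?_
    filter_upwards [baseSet_mem_nhds (J := J) p₀.proj] with p hp
    simp only [Function.comp_apply]
    rw [← coordAlgEquiv_apply hp, ← coordAlgEquiv_apply hp, ← coordAlgEquiv_apply hp, map_interp]
  exact key.comp p₀ hproj

end Coordinates

/-! ### Naturality of the exterior derivative -/

section Naturality

open Filter

theorem differentiableWithinAt_clm_of_apply {E F D : Type*} [NormedAddCommGroup E]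
    [NormedSpace ℝ E] [FiniteDimensional ℝ E] [NormedAddCommGroup F] [NormedSpace ℝ F]
    [NormedAddCommGroup D] [NormedSpace ℝ D] {f : D → E →L[ℝ] F} {s : Set D} {z : D}
    (h : ∀ e, DifferentiableWithinAt ℝ (fun y => f y e) s z) : DifferentiableWithinAt ℝ f s z := by
  let e : (E →L[ℝ] F) ≃L[ℝ] Fin (Module.finrank ℝ E) → F :=
    ((ContinuousLinearEquiv.ofFinrankEq (Module.finrank_fin_fun ℝ).symm).arrowCongr
      (1 : F ≃L[ℝ] F)).trans (ContinuousLinearEquiv.piRing _)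
  rw [← e.comp_differentiableWithinAt_iff]
  exact differentiableWithinAt_pi.2 fun i => h _

variable {E : Type*} [NormedAddCommGroup E] [NormedSpace ℝ E]

/-- If `g^* α = β + df`, then the exterior derivatives of the one-forms `α` and `β` correspond under
`g`. This is the chain rule, together with the symmetry of the second derivatives of `g` and `f`. -/
theorem antisymm_fderivWithin_of_pullback_eq {s : Set E} (hs : UniqueDiffOn ℝ s) {z : E}
    (hz : z ∈ s) (hzc : z ∈ closure (interior s)) {α β : E → E →L[ℝ] ℝ} {g : E → E} {f : E → ℝ}
    (hg : ContDiffWithinAt ℝ 2 g s z) (hf : ContDiffWithinAt ℝ 2 f s z) (hgs : Set.MapsTo g s s)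
    (hα : DifferentiableWithinAt ℝ α s (g z)) (hβ : DifferentiableWithinAt ℝ β s z)
    (h : ∀ᶠ y in 𝓝[s] z, (α (g y)).comp (fderivWithin ℝ g s y) = β y + fderivWithin ℝ f s y)
    (v w : E) :
    fderivWithin ℝ α s (g z) (fderivWithin ℝ g s z v) (fderivWithin ℝ g s z w) -
      fderivWithin ℝ α s (g z) (fderivWithin ℝ g s z w) (fderivWithin ℝ g s z v) =
    fderivWithin ℝ β s z v w - fderivWithin ℝ β s z w v := by
  have hdg : HasFDerivWithinAt g (fderivWithin ℝ g s z) s z :=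
    (hg.differentiableWithinAt two_ne_zero).hasFDerivWithinAt
  have hddg := ((hg.fderivWithin_right (m := 1) hs le_rfl hz).differentiableWithinAt
    one_ne_zero).hasFDerivWithinAt
  have hddf := ((hf.fderivWithin_right (m := 1) hs le_rfl hz).differentiableWithinAt
    one_ne_zero).hasFDerivWithinAt
  have hl := (hα.hasFDerivWithinAt.comp z hdg hgs).clm_comp hddg
  have hr := hβ.hasFDerivWithinAt.add hddf
  have hl' := hr.congr_of_eventuallyEq h (h.self_of_nhdsWithin hz)
  have key := (hs z hz).eq hl hl'
  have hsg : ∀ v w, fderivWithin ℝ (fderivWithin ℝ g s) s z v w =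
      fderivWithin ℝ (fderivWithin ℝ g s) s z w v :=
    (hg.isSymmSndFDerivWithinAt (by simp) hs hzc hz).eq
  have hsf : ∀ v w, fderivWithin ℝ (fderivWithin ℝ f s) s z v w =
      fderivWithin ℝ (fderivWithin ℝ f s) s z w v :=
    (hf.isSymmSndFDerivWithinAt (by simp) hs hzc hz).eq
  have h₁ := congrArg (fun L : E →L[ℝ] E →L[ℝ] ℝ => L v w) key
  have h₂ := congrArg (fun L : E →L[ℝ] E →L[ℝ] ℝ => L w v) key
  simp at h₁ h₂
  rw [hsg w v, hsf w v] at h₂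
  linarith

variable {H : Type*} [TopologicalSpace H] {J : ModelWithCorners ℝ E H} {M : Type*}
  [TopologicalSpace M] [ChartedSpace H M] [IsManifold J ∞ M]

theorem localFrame_eq_mfderivWithin {x₀ x : M} (hx : x ∈ (chartAt H x₀).source) (e : E) :
    localFrame J x₀ e x =
      mfderivWithin 𝓘(ℝ, E) J (extChartAt J x₀).symm (Set.range J) (extChartAt J x₀ x) e := by
  have : IsManifold J 1 M := .of_le (n := ∞) (by simp)
  rw [localFrame, TangentBundle.symmL_trivializationAt hx]
  rfl

theorem OneForm.inChart_eq_localFrame (θ : OneForm J M) {x : M} {y : E}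
    (hy : y ∈ (extChartAt J x).target) (e : E) :
    θ.inChart x y e =
      θ ((extChartAt J x).symm y) (localFrame J x e ((extChartAt J x).symm y)) := by
  have hy' : (extChartAt J x).symm y ∈ (chartAt H x).source := by
    rw [← extChartAt_source J]; exact (extChartAt J x).map_target hy
  have h := congrArg (fun z => (show E from
    mfderivWithin 𝓘(ℝ, E) J (extChartAt J x).symm (Set.range J) z e))
    ((extChartAt J x).right_inv hy)
  exact congrArg (θ ((extChartAt J x).symm y))
    (h.symm.trans (localFrame_eq_mfderivWithin hy' e).symm)

theorem OneForm.IsSmooth.differentiableWithinAt_inChart [FiniteDimensional ℝ E] {θ : OneForm J M}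
    (hθ : θ.IsSmooth) (x : M) :
    DifferentiableWithinAt ℝ (θ.inChart x) (Set.range J) (extChartAt J x x) := by
  refine differentiableWithinAt_clm_of_apply fun e => ?_
  have h₁ : ContMDiffAt J 𝓘(ℝ, ℝ) ∞ (fun y => θ y (localFrame J x e y)) x :=
    hθ.contMDiffAt.comp x (contMDiffAt_localFrame x e)
  have h₂ : ContMDiffWithinAt 𝓘(ℝ, E) 𝓘(ℝ, ℝ) ∞ ((fun y => θ y (localFrame J x e y)) ∘
      (extChartAt J x).symm) (Set.range J) (extChartAt J x x) := by
    refine ContMDiffAt.comp_contMDiffWithinAt _ ?_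
      (contMDiffWithinAt_extChartAt_symm_range x (mem_extChartAt_target x))
    rwa [extChartAt_to_inv]
  refine ((contMDiffWithinAt_iff_contDiffWithinAt.1 h₂).differentiableWithinAt
    (by simp)).congr_of_eventuallyEq ?_ (θ.inChart_eq_localFrame (mem_extChartAt_target x) e)
  filter_upwards [(extChartAt_target_mem_nhdsWithin x : _ ∈ 𝓝[Set.range J] _)] with y hy
  exact θ.inChart_eq_localFrame hy e

/-- A smooth map which preserves a one-form up to an exact form preserves its exterior
derivative. -/
theorem OneForm.IsSmooth.d_mfderiv [FiniteDimensional ℝ E] {θ : OneForm J M} (hθ : θ.IsSmooth)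
    {φ : M → M} (hφ : ContMDiff J J ∞ φ) {f : M → ℝ} (hf : ContMDiff J 𝓘(ℝ, ℝ) ∞ f)
    (h : ∀ (x : M) (v : TangentSpace J x),
      θ (φ x) (mfderiv J J φ x v) = θ x v + dFun J f x v)
    (x : M) (v w : TangentSpace J x) :
    θ.d (φ x) (mfderiv J J φ x v) (mfderiv J J φ x w) = θ.d x v w := by
  let a := extChartAt J x
  let b := extChartAt J (φ x)
  let g : E → E := writtenInExtChartAt J J x φ
  have hza : a.symm (a x) = x := extChartAt_to_inv x
  have hgz : g (a x) = b (φ x) := by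
    simp only [g, writtenInExtChartAt, Function.comp_apply, hza, b, a]
  have hg : ContDiffWithinAt ℝ 2 g (Set.range J) (a x) :=
    (contMDiffAt_iff.1 (hφ x)).2.of_le ENat.LEInfty.out
  have hf' : ContDiffWithinAt ℝ 2 (f ∘ a.symm) (Set.range J) (a x) :=
    (contMDiffAt_iff.1 (hf x)).2.of_le ENat.LEInfty.out
  have hderiv : fderivWithin ℝ g (Set.range J) (a x) = mfderiv J J φ x := by
    exact ((hφ.mdifferentiableAt (by simp)).mfderiv (x := x)).symm
  have key := antisymm_fderivWithin_of_pullback_eq (J.uniqueDiffOn) (z := a x)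
    (extChartAt_target_subset_range x (mem_extChartAt_target x))
    (J.range_subset_closure_interior (extChartAt_target_subset_range x (mem_extChartAt_target x)))
    (α := θ.inChart (φ x)) (β := θ.inChart x) hg hf' ?_ ?_ (hθ.differentiableWithinAt_inChart x)
    ?_ v w
  · rw [hderiv, hgz] at key
    exact key
  · intro y _
    exact Set.mem_range_self _
  · rw [hgz]
    exact hθ.differentiableWithinAt_inChart (φ x)
  · have hc : ContinuousWithinAt (φ ∘ a.symm) (Set.range J) (a x) := by
      refine ContinuousAt.comp_continuousWithinAt ?_
        (continuousAt_extChartAt_symm x).continuousWithinAt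
      exact hφ.continuous.continuousAt
    have hmem : ∀ᶠ y in 𝓝[Set.range J] (a x), φ (a.symm y) ∈ (chartAt H (φ x)).source := by
      refine hc.eventually ?_
      simp only [Function.comp_apply, hza]
      exact chart_source_mem_nhds H (φ x)
    filter_upwards [(extChartAt_target_mem_nhdsWithin x : _ ∈ 𝓝[Set.range J] _), hmem] with y hy hy'
    have hy'' : φ (a.symm y) ∈ (extChartAt J (φ x)).source := by rwa [extChartAt_source]
    have : IsManifold J 1 M := .of_le (n := ∞) (by simp)
    have hyr := extChartAt_target_subset_range x hy
    have hu : UniqueMDiffWithinAt 𝓘(ℝ, E) (Set.range J) y :=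
      (J.uniqueDiffOn y hyr).uniqueMDiffWithinAt
    have hya : MDifferentiableWithinAt 𝓘(ℝ, E) J a.symm (Set.range J) y :=
      mdifferentiableWithinAt_extChartAt_symm hy
    have hφy : MDifferentiableAt J J φ (a.symm y) := hφ.mdifferentiableAt (by simp)
    have hby : MDifferentiableAt J 𝓘(ℝ, E) b (φ (a.symm y)) := mdifferentiableAt_extChartAt hy'
    have hfy : MDifferentiableAt J 𝓘(ℝ, ℝ) f (a.symm y) := hf.mdifferentiableAt (by simp)
    have e₁ : fderivWithin ℝ g (Set.range J) y = (mfderiv J 𝓘(ℝ, E) b (φ (a.symm y))).comp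
        ((mfderiv J J φ (a.symm y)).comp
          (mfderivWithin 𝓘(ℝ, E) J a.symm (Set.range J) y)) := by
      rw [← mfderivWithin_eq_fderivWithin]
      rw [← mfderiv_comp_mfderivWithin y hφy hya hu]
      exact mfderiv_comp_mfderivWithin y (f := φ ∘ a.symm) hby
        (hφy.comp_mdifferentiableWithinAt y hya) hu
    have e₂ : fderivWithin ℝ (f ∘ a.symm) (Set.range J) y =
        (mfderiv J 𝓘(ℝ, ℝ) f (a.symm y)).comp
          (mfderivWithin 𝓘(ℝ, E) J a.symm (Set.range J) y) := by
      rw [← mfderivWithin_eq_fderivWithin]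
      exact mfderiv_comp_mfderivWithin y hfy hya hu
    have hbb : ∀ u : TangentSpace J (φ (a.symm y)),
        mfderivWithin 𝓘(ℝ, E) J b.symm (Set.range J) (b (φ (a.symm y)))
          (mfderiv J 𝓘(ℝ, E) b (φ (a.symm y)) u) = u := by
      intro u
      have := mfderivWithin_extChartAt_symm_comp_mfderiv_extChartAt' (x := φ x) hy''
      exact congrArg (fun L : TangentSpace J (φ (a.symm y)) →L[ℝ] TangentSpace J (φ (a.symm y)) =>
        L u) this
    ext e
    rw [e₂]
    change θ.inChart (φ x) (g y) (fderivWithin ℝ g (Set.range J) y e) = _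
    rw [e₁]
    have hgb : b.symm (g y) = φ (a.symm y) := b.left_inv hy''
    have := h (a.symm y) (mfderivWithin 𝓘(ℝ, E) J a.symm (Set.range J) y e)
    refine Eq.trans ?_ this
    change θ (b.symm (b (φ (a.symm y))))
      (mfderivWithin 𝓘(ℝ, E) J b.symm (Set.range J) (b (φ (a.symm y)))
        (mfderiv J 𝓘(ℝ, E) b (φ (a.symm y)) _)) = _
    rw [hbb]
    exact congrArg (fun q => (show E →L[ℝ] ℝ from θ q) _) hgb

end Naturality

/-! ### Families of maps which are continuous for the weak Whitney topology -/

section WhitneyFamilies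

open Filter Bundle ContinuousLinearMap

/-- A family of functions which converges uniformly on a neighbourhood of a point is jointly
continuous there. -/
theorem continuousAt_prod_of_eventually_dist_lt {P X Z : Type*} [TopologicalSpace P]
    [TopologicalSpace X] [PseudoMetricSpace Z] {g : P → X → Z} {p₀ : P} {x₀ : X} {K : Set X}
    (hK : K ∈ 𝓝 x₀) (hg : ContinuousAt (g p₀) x₀)
    (h : ∀ ε > 0, ∀ᶠ p in 𝓝 p₀, ∀ x ∈ K, dist (g p x) (g p₀ x) < ε) :
    ContinuousAt (fun q : P × X => g q.1 q.2) (p₀, x₀) := by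
  rw [Metric.continuousAt_iff']
  intro ε hε
  have h₁ := (h (ε / 2) (half_pos hε)).prod_inl_nhds x₀
  have h₂ := (Filter.Eventually.and hK
    (Metric.continuousAt_iff'.1 hg (ε / 2) (half_pos hε))).prod_inr_nhds p₀
  filter_upwards [h₁, h₂] with q hq hq'
  calc dist (g q.1 q.2) (g p₀ x₀) ≤ dist (g q.1 q.2) (g p₀ q.2) + dist (g p₀ q.2) (g p₀ x₀) :=
        dist_triangle _ _ _
    _ < ε := by linarith [hq _ hq'.1, hq'.2]

variable {E : Type*} [NormedAddCommGroup E] [NormedSpace ℝ E] {H : Type*} [TopologicalSpace H]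
  {J : ModelWithCorners ℝ E H} {M : Type*} [TopologicalSpace M] [ChartedSpace H M]
  [IsManifold J ∞ M]

/-- The derivative of a smooth map in the coordinates at `x₀` and `y₀`. -/
def coordDeriv (J : ModelWithCorners ℝ E H) [IsManifold J ∞ M] (x₀ y₀ : M) (φ : M → M) (x : M) :
    E →L[ℝ] E :=
  inCoordinates E (TangentSpace J) E (TangentSpace J) x₀ x y₀ (φ x) (mfderiv J J φ x)

theorem coordDeriv_eq_fderivWithin {φ : M → M} (hφ : ContMDiff J J ∞ φ) {x₀ y₀ x : M}
    (hx : x ∈ (chartAt H x₀).source) (hy : φ x ∈ (chartAt H y₀).source) :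
    coordDeriv J x₀ y₀ φ x = fderivWithin ℝ
      ((chartAt H y₀).extend J ∘ φ ∘ ((chartAt H x₀).extend J).symm) (Set.range J)
      ((chartAt H x₀).extend J x) := by
  have : IsManifold J 1 M := .of_le (n := ∞) (by simp)
  let a := extChartAt J x₀
  let b := extChartAt J y₀
  have hxs : x ∈ a.source := by rwa [extChartAt_source]
  have hxa : a.symm (a x) = x := a.left_inv hxs
  have hya : MDifferentiableWithinAt 𝓘(ℝ, E) J a.symm (Set.range J) (a x) :=
    mdifferentiableWithinAt_extChartAt_symm (a.map_source hxs)
  have hu : UniqueMDiffWithinAt 𝓘(ℝ, E) (Set.range J) (a x) :=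
    (J.uniqueDiffOn _ (extChartAt_target_subset_range x₀ (a.map_source hxs))).uniqueMDiffWithinAt
  have hφa : MDifferentiableAt J J φ (a.symm (a x)) := hφ.mdifferentiableAt (by simp)
  have hb : MDifferentiableAt J 𝓘(ℝ, E) b (φ (a.symm (a x))) := by
    rw [hxa]; exact mdifferentiableAt_extChartAt hy
  have e₁ : fderivWithin ℝ (b ∘ φ ∘ a.symm) (Set.range J) (a x) =
      (mfderiv J 𝓘(ℝ, E) b (φ (a.symm (a x)))).comp
        ((mfderiv J J φ (a.symm (a x))).comp
          (mfderivWithin 𝓘(ℝ, E) J a.symm (Set.range J) (a x))) := by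
    rw [← mfderivWithin_eq_fderivWithin]
    rw [← mfderiv_comp_mfderivWithin (a x) hφa hya hu]
    exact mfderiv_comp_mfderivWithin (a x) (f := φ ∘ a.symm) hb
      (hφa.comp_mdifferentiableWithinAt (a x) hya) hu
  refine Eq.trans ?_ e₁.symm
  -- `inTangentCoordinates` uses the coordinates at the values of two functions at a base parameter;
  -- the parameter `(x₀, false)` serves to obtain the coordinates at `x₀` and `y₀`.
  let f' : M × Bool → M := fun p => if p.2 then p.1 else x₀
  let g' : M × Bool → M := fun p => if p.2 then φ p.1 else y₀
  have h : inTangentCoordinates J J f' g' (fun p => mfderiv J J φ p.1) (x₀, false) (x, true) = _ :=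
    inTangentCoordinates_eq_mfderiv_comp (f := f') (g := g') hx hy
  refine h.trans ?_
  refine congrArg₂ (fun (L : E →L[ℝ] E) (L' : E →L[ℝ] E) => L.comp
    (L'.comp (mfderivWithin 𝓘(ℝ, E) J a.symm (Set.range J) (a x) : E →L[ℝ] E))) ?_ ?_
  · exact congrArg (fun z => (show E →L[ℝ] E from mfderiv J 𝓘(ℝ, E) b (φ z))) hxa.symm
  · exact congrArg (fun z => (show E →L[ℝ] E from mfderiv J J φ z)) hxa.symm

variable {P : Type*} [TopologicalSpace P] {F : P → M → M}

section

variable (hF : @Continuous P (M → M) _ (weakWhitney J J) F) (hs : ∀ p, ContMDiff J J ∞ (F p))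
  {p₀ : P} {x₀ : M} {K : Set M} (hK : IsCompact K) (hKs : K ⊆ (chartAt H x₀).source)
  (hKF : Set.MapsTo (F p₀) K (chartAt H (F p₀ x₀)).source)
include hF hs hK hKs hKF

theorem eventually_mem_whitneyBasic {ε : ℝ} (hε : 0 < ε) :
    ∀ᶠ p in 𝓝 p₀, F p ∈ whitneyBasic J J (F p₀) (chartAt H x₀) (chartAt H (F p₀ x₀)) K 1 ε := by
  have hopen : @IsOpen _ (weakWhitney J J)
      (whitneyBasic J J (F p₀) (chartAt H x₀) (chartAt H (F p₀ x₀)) K 1 ε) :=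
    TopologicalSpace.isOpen_generateFrom_of_mem ⟨F p₀, _, _, K, 1, ε, hs p₀,
      IsManifold.chart_mem_maximalAtlas x₀, IsManifold.chart_mem_maximalAtlas _, hK, hKs, hKF, hε,
      rfl⟩
  refine (@IsOpen.preimage _ _ _ (weakWhitney J J) _ hF _ hopen).mem_nhds ?_
  exact ⟨hKF, fun x _ k _ => by rw [sub_self, norm_zero]; exact hε⟩

theorem eventually_mapsTo_chart_source :
    ∀ᶠ p in 𝓝 p₀, Set.MapsTo (F p) K (chartAt H (F p₀ x₀)).source :=
  (eventually_mem_whitneyBasic hF hs hK hKs hKF one_pos).mono fun _ h => h.1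

theorem eventually_dist_extChartAt_lt {ε : ℝ} (hε : 0 < ε) : ∀ᶠ p in 𝓝 p₀, ∀ x ∈ K,
    dist (extChartAt J (F p₀ x₀) (F p x)) (extChartAt J (F p₀ x₀) (F p₀ x)) < ε := by
  filter_upwards [eventually_mem_whitneyBasic hF hs hK hKs hKF hε] with p hp x hx
  have h := hp.2 x hx 0 zero_le_one
  rw [iteratedFDerivWithin_zero_eq_comp, iteratedFDerivWithin_zero_eq_comp] at h
  simp only [Function.comp_apply] at h
  rw [← map_sub, LinearIsometryEquiv.norm_map,
    (chartAt H x₀).extend_left_inv (hKs hx), ← dist_eq_norm] at h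
  exact h

theorem eventually_dist_coordDeriv_lt {ε : ℝ} (hε : 0 < ε) : ∀ᶠ p in 𝓝 p₀, ∀ x ∈ K,
    dist (coordDeriv J x₀ (F p₀ x₀) (F p) x) (coordDeriv J x₀ (F p₀ x₀) (F p₀) x) < ε := by
  filter_upwards [eventually_mem_whitneyBasic hF hs hK hKs hKF (half_pos hε)] with p hp x hx
  have h := hp.2 x hx 1 le_rfl
  rw [coordDeriv_eq_fderivWithin (hs p) (hKs hx) (hp.1 hx),
    coordDeriv_eq_fderivWithin (hs p₀) (hKs hx) (hKF hx), dist_eq_norm]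
  have hu : UniqueDiffWithinAt ℝ (Set.range J) ((chartAt H x₀).extend J x) :=
    J.uniqueDiffOn _ (Set.mem_range_self _)
  refine lt_of_le_of_lt (ContinuousLinearMap.opNorm_le_bound _ (half_pos hε).le fun v => ?_)
    (half_lt_self hε)
  have h₁ := (ContinuousMultilinearMap.le_opNorm (iteratedFDerivWithin ℝ 1
      ((chartAt H (F p₀ x₀)).extend J ∘ F p ∘ ((chartAt H x₀).extend J).symm) (Set.range J)
      ((chartAt H x₀).extend J x) - iteratedFDerivWithin ℝ 1
      ((chartAt H (F p₀ x₀)).extend J ∘ F p₀ ∘ ((chartAt H x₀).extend J).symm) (Set.range J)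
      ((chartAt H x₀).extend J x)) fun _ => v)
  rw [_root_.sub_apply, iteratedFDerivWithin_one_apply hu,
    iteratedFDerivWithin_one_apply hu, Finset.prod_const, Finset.card_univ, Fintype.card_fin,
    pow_one] at h₁
  exact h₁.trans (mul_le_mul_of_nonneg_right h.le (norm_nonneg v))

end

/-- A family of smooth maps which is continuous for the weak Whitney topology is jointly
continuous. -/
theorem continuous_uncurry_of_weakWhitney [LocallyCompactSpace M]
    (hF : @Continuous P (M → M) _ (weakWhitney J J) F) (hs : ∀ p, ContMDiff J J ∞ (F p)) :
    Continuous fun q : P × M => F q.1 q.2 := by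
  rw [continuous_iff_continuousAt]
  rintro ⟨p₀, x₀⟩
  obtain ⟨K, hKx, hKs, hK⟩ := local_compact_nhds (Filter.inter_mem (chart_source_mem_nhds H x₀)
    ((hs p₀).continuous.continuousAt (chart_source_mem_nhds H (F p₀ x₀))))
  have hKF : Set.MapsTo (F p₀) K (chartAt H (F p₀ x₀)).source := fun x hx => (hKs hx).2
  have hKs' : K ⊆ (chartAt H x₀).source := fun x hx => (hKs hx).1
  have h := continuousAt_prod_of_eventually_dist_lt
    (g := fun p x => extChartAt J (F p₀ x₀) (F p x)) hKx
    ((continuousAt_extChartAt (F p₀ x₀)).comp (hs p₀).continuous.continuousAt)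
    fun ε hε => eventually_dist_extChartAt_lt hF hs hK hKs' hKF hε
  have h' := ContinuousAt.comp (f := fun q : P × M => extChartAt J (F p₀ x₀) (F q.1 q.2))
    (x := (p₀, x₀)) (continuousAt_extChartAt_symm (F p₀ x₀)) h
  have hmaps := eventually_mapsTo_chart_source hF hs hK hKs' hKF
  refine h'.congr ?_
  filter_upwards [(hmaps.prod_inl_nhds x₀), (show ∀ᶠ x in 𝓝 x₀, x ∈ K from hKx).prod_inr_nhds p₀]
    with q hq hq'
  exact (extChartAt J (F p₀ x₀)).left_inv (by rw [extChartAt_source]; exact hq hq')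

theorem continuousAt_coordDeriv_of_weakWhitney [LocallyCompactSpace M]
    (hF : @Continuous P (M → M) _ (weakWhitney J J) F) (hs : ∀ p, ContMDiff J J ∞ (F p))
    (p₀ : P) (x₀ : M) :
    ContinuousAt (fun q : P × M => coordDeriv J x₀ (F p₀ x₀) (F q.1) q.2) (p₀, x₀) := by
  obtain ⟨K, hKx, hKs, hK⟩ := local_compact_nhds (Filter.inter_mem (chart_source_mem_nhds H x₀)
    ((hs p₀).continuous.continuousAt (chart_source_mem_nhds H (F p₀ x₀))))
  refine continuousAt_prod_of_eventually_dist_lt hKx ?_ fun ε hε =>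
    eventually_dist_coordDeriv_lt hF hs hK (fun x hx => (hKs hx).1) (fun x hx => (hKs hx).2) hε
  exact ((hs p₀ x₀).mfderiv_const (m := 0) (by simp)).continuousAt

end WhitneyFamilies

/-! ### The action of Liouville automorphisms on classified almost complex structures -/

section Pullback

open Filter Bundle ContinuousLinearMap

universe u v

theorem inCoordinates_mul_inCoordinates {E : Type*} [NormedAddCommGroup E] [NormedSpace ℝ E]
    {H : Type*} [TopologicalSpace H] {J : ModelWithCorners ℝ E H} {M : Type*} [TopologicalSpace M]
    [ChartedSpace H M] [IsManifold J ∞ M] {x₀ y₀ x y : M}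
    (hx : x ∈ (trivializationAt E (TangentSpace J) x₀).baseSet)
    (hy : y ∈ (trivializationAt E (TangentSpace J) y₀).baseSet)
    (A : TangentSpace J x →L[ℝ] TangentSpace J y) (B : TangentSpace J y →L[ℝ] TangentSpace J x)
    (h : ∀ v, B (A v) = v) :
    inCoordinates E (TangentSpace J) E (TangentSpace J) y₀ y x₀ x B *
      inCoordinates E (TangentSpace J) E (TangentSpace J) x₀ x y₀ y A = 1 := by
  rw [inCoordinates_eq hx hy, inCoordinates_eq hy hx]
  ext1 v
  change (trivializationAt E (TangentSpace J) x₀).continuousLinearEquivAt ℝ x hx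
    (B (((trivializationAt E (TangentSpace J) y₀).continuousLinearEquivAt ℝ y hy).symm
      ((trivializationAt E (TangentSpace J) y₀).continuousLinearEquivAt ℝ y hy (A
        (((trivializationAt E (TangentSpace J) x₀).continuousLinearEquivAt ℝ x hx).symm v))))) = v
  rw [ContinuousLinearEquiv.symm_apply_apply, h, ContinuousLinearEquiv.apply_symm_apply]

variable {m : ℕ} {M : Type u} [TopologicalSpace M]
  [ChartedSpace (EuclideanHalfSpace (2 * m + 2)) M] [IsManifold (𝓡∂ (2 * m + 2)) ∞ M]
  {Y : Type v} [TopologicalSpace Y] [ChartedSpace (EuclideanHalfSpace (2 * m + 1)) Y]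
  [IsManifold (𝓡∂ (2 * m + 1)) ∞ Y] {S : LiouvilleSector m M Y}

theorem locallyCompactSpace_of_halfSpace {n : ℕ} [NeZero n] (M : Type*) [TopologicalSpace M]
    [ChartedSpace (EuclideanHalfSpace n) M] : LocallyCompactSpace M :=
  Manifold.locallyCompact_of_finiteDimensional (𝓡∂ n)

namespace LiouAut

theorem contMDiff (φ : LiouAut S) :
    ContMDiff (𝓡∂ (2 * m + 2)) (𝓡∂ (2 * m + 2)) ∞ φ.toDiffeo :=
  φ.toDiffeo.contMDiff_toFun

theorem continuous_toDiffeo : @Continuous (LiouAut S) (M → M) _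
    (weakWhitney (𝓡∂ (2 * m + 2)) (𝓡∂ (2 * m + 2))) fun φ => (φ.toDiffeo : M → M) :=
  (@continuous_iff_le_induced _ _ _ _ (weakWhitney (𝓡∂ (2 * m + 2)) (𝓡∂ (2 * m + 2)))).2 inf_le_left

theorem continuous_eval : Continuous fun q : LiouAut S × M => q.1.toDiffeo q.2 :=
  have := locallyCompactSpace_of_halfSpace M (n := 2 * m + 2)
  continuous_uncurry_of_weakWhitney continuous_toDiffeo fun φ => φ.contMDiff

theorem continuous_toMap : Continuous (toMap : LiouAut S → C(M, M)) :=
  ContinuousMap.continuous_of_continuous_uncurry _ continuous_eval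

/-- The derivative of a Liouville automorphism, as an isomorphism of tangent spaces. -/
def derivEquiv (φ : LiouAut S) (x : M) :
    TangentSpace (𝓡∂ (2 * m + 2)) x ≃L[ℝ] TangentSpace (𝓡∂ (2 * m + 2)) (φ.toDiffeo x) :=
  φ.toDiffeo.mfderivToContinuousLinearEquiv (by simp) x

theorem derivEquiv_apply (φ : LiouAut S) (x : M) (v : TangentSpace (𝓡∂ (2 * m + 2)) x) :
    φ.derivEquiv x v = φ.deriv x v := rfl

section Families

variable {P : Type*} [TopologicalSpace P] {φ : P → LiouAut S} (hφ : Continuous φ) {x : P → M}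
include hφ

theorem continuousAt_coordDeriv (hx : Continuous x) (p₀ : P) :
    ContinuousAt (fun p => coordDeriv (𝓡∂ (2 * m + 2)) (x p₀) ((φ p₀).toDiffeo (x p₀))
      (φ p).toDiffeo (x p)) p₀ :=
  have := locallyCompactSpace_of_halfSpace M (n := 2 * m + 2)
  ContinuousAt.comp (f := fun p => (φ p, x p)) (x := p₀)
    (continuousAt_coordDeriv_of_weakWhitney (continuous_toDiffeo (S := S)) (fun φ => φ.contMDiff)
      (φ p₀) (x p₀)) (hφ.prodMk hx).continuousAt

theorem continuous_deriv_apply {v : ∀ p, TangentSpace (𝓡∂ (2 * m + 2)) (x p)}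
    (hv : Continuous fun p => (⟨x p, v p⟩ : TangentBundle (𝓡∂ (2 * m + 2)) M)) :
    Continuous fun p => (⟨(φ p).toDiffeo (x p), (φ p).deriv (x p) (v p)⟩ :
      TangentBundle (𝓡∂ (2 * m + 2)) M) := by
  have hx : Continuous x := (FiberBundle.continuous_proj _ _).comp hv
  rw [continuous_iff_continuousAt]
  intro p₀
  exact ContinuousAt.clm_apply_of_inCoordinates (continuousAt_coordDeriv hφ hx p₀)
    hv.continuousAt (continuous_eval.comp (hφ.prodMk hx)).continuousAt

theorem continuous_derivEquiv_symm_apply (hx : Continuous x)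
    {w : ∀ p, TangentSpace (𝓡∂ (2 * m + 2)) ((φ p).toDiffeo (x p))}
    (hw : Continuous fun p => (⟨(φ p).toDiffeo (x p), w p⟩ : TangentBundle (𝓡∂ (2 * m + 2)) M)) :
    Continuous fun p => (⟨x p, ((φ p).derivEquiv (x p)).symm (w p)⟩ :
      TangentBundle (𝓡∂ (2 * m + 2)) M) := by
  rw [continuous_iff_continuousAt]
  intro p₀
  have hy : Continuous fun p => (φ p).toDiffeo (x p) := continuous_eval.comp (hφ.prodMk hx)
  refine ContinuousAt.clm_apply_of_inCoordinates (F₁ := EuclideanSpace ℝ (Fin (2 * m + 2)))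
    (F₂ := EuclideanSpace ℝ (Fin (2 * m + 2))) (E₁ := TangentSpace (𝓡∂ (2 * m + 2)))
    (E₂ := TangentSpace (𝓡∂ (2 * m + 2))) (b₁ := fun p : P => (φ p).toDiffeo (x p))
    (ϕ := fun p => (((φ p).derivEquiv (x p)).symm :
      TangentSpace (𝓡∂ (2 * m + 2)) ((φ p).toDiffeo (x p)) →L[ℝ]
        TangentSpace (𝓡∂ (2 * m + 2)) (x p))) ?_ hw.continuousAt hx.continuousAt
  -- In coordinates, the family of inverses is the inverse of a continuous family of units.
  have hunit : ∀ p, x p ∈ (trivializationAt (EuclideanSpace ℝ (Fin (2 * m + 2)))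
        (TangentSpace (𝓡∂ (2 * m + 2))) (x p₀)).baseSet →
      (φ p).toDiffeo (x p) ∈ (trivializationAt (EuclideanSpace ℝ (Fin (2 * m + 2)))
        (TangentSpace (𝓡∂ (2 * m + 2))) ((φ p₀).toDiffeo (x p₀))).baseSet →
      ∃ U : (EuclideanSpace ℝ (Fin (2 * m + 2)) →L[ℝ] EuclideanSpace ℝ (Fin (2 * m + 2)))ˣ,
        (U : _ →L[ℝ] _) = coordDeriv (𝓡∂ (2 * m + 2)) (x p₀) ((φ p₀).toDiffeo (x p₀))
          (φ p).toDiffeo (x p) ∧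
        ((U⁻¹ : Units _) : _ →L[ℝ] _) = inCoordinates (EuclideanSpace ℝ (Fin (2 * m + 2)))
          (TangentSpace (𝓡∂ (2 * m + 2))) (EuclideanSpace ℝ (Fin (2 * m + 2)))
          (TangentSpace (𝓡∂ (2 * m + 2))) ((φ p₀).toDiffeo (x p₀)) ((φ p).toDiffeo (x p)) (x p₀)
          (x p) (((φ p).derivEquiv (x p)).symm : _ →L[ℝ] _) := by
    intro p h₁ h₂
    exact ⟨⟨coordDeriv (𝓡∂ (2 * m + 2)) (x p₀) ((φ p₀).toDiffeo (x p₀)) (φ p).toDiffeo (x p), _,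
      inCoordinates_mul_inCoordinates h₂ h₁ (((φ p).derivEquiv (x p)).symm : _ →L[ℝ] _) _
        ((φ p).derivEquiv (x p)).apply_symm_apply,
      inCoordinates_mul_inCoordinates h₁ h₂ _ _
        ((φ p).derivEquiv (x p)).symm_apply_apply⟩, rfl, rfl⟩
  obtain ⟨U, hU, -⟩ := hunit p₀ (mem_baseSet_self _) (mem_baseSet_self _)
  have h := NormedRing.inverse_continuousAt U
  rw [hU] at h
  refine (ContinuousAt.comp (x := p₀) h (continuousAt_coordDeriv hφ hx p₀)).congr ?_
  filter_upwards [hx.continuousAt (baseSet_mem_nhds (J := 𝓡∂ (2 * m + 2)) (x p₀)),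
    hy.continuousAt (baseSet_mem_nhds (J := 𝓡∂ (2 * m + 2)) ((φ p₀).toDiffeo (x p₀)))] with p h₁ h₂
  obtain ⟨U, hU, hU'⟩ := hunit p h₁ h₂
  rw [Function.comp_apply, ← hU, Ring.inverse_unit, hU']

end Families

theorem d_deriv (φ : LiouAut S) (x : M) (v w : TangentSpace (𝓡∂ (2 * m + 2)) x) :
    S.form.d (φ.toDiffeo x) (φ.deriv x v) (φ.deriv x w) = S.form.d x v w := by
  obtain ⟨f, hf, -, h⟩ := φ.pullback_form
  exact S.form_smooth.d_mfderiv φ.contMDiff hf h x v w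

theorem derivEquiv_symm_apply (φ : LiouAut S) (x : M)
    (w : TangentSpace (𝓡∂ (2 * m + 2)) (φ.toDiffeo x)) :
    (φ.derivEquiv x).symm w =
      mfderiv (𝓡∂ (2 * m + 2)) (𝓡∂ (2 * m + 2)) φ.toDiffeo.symm (φ.toDiffeo x) w := by
  obtain ⟨v, rfl⟩ := (φ.derivEquiv x).surjective w
  rw [ContinuousLinearEquiv.symm_apply_apply]
  have h := mfderiv_comp x
    (φ.toDiffeo.symm.contMDiff_toFun.mdifferentiableAt (x := φ.toDiffeo x) (by simp))
    (φ.contMDiff.mdifferentiableAt (x := x) (by simp))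
  have hid : φ.toDiffeo.symm ∘ φ.toDiffeo = id := funext φ.toDiffeo.symm_apply_apply
  have h' : mfderiv (𝓡∂ (2 * m + 2)) (𝓡∂ (2 * m + 2)) (φ.toDiffeo.symm ∘ φ.toDiffeo) x v = v := by
    rw [hid, mfderiv_id]
    rfl
  exact h'.symm.trans (congrArg (fun L : EuclideanSpace ℝ (Fin (2 * m + 2)) →L[ℝ]
    EuclideanSpace ℝ (Fin (2 * m + 2)) => L v) h)

end LiouAut

/-- Two points of the tangent bundle agree if their base points do, and their vectors agree in the
model space. -/
theorem totalSpace_mk_eq {m : ℕ} {M : Type u} [TopologicalSpace M]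
    [ChartedSpace (EuclideanHalfSpace (2 * m + 2)) M] {x y : M} (h : x = y)
    (v : EuclideanSpace ℝ (Fin (2 * m + 2))) :
    (⟨x, v⟩ : TangentBundle (𝓡∂ (2 * m + 2)) M) = ⟨y, v⟩ := by
  subst h
  rfl

theorem FramePair.continuous_mk {P : Type*} [TopologicalSpace P] {x : P → M}
    {u w : ∀ p, Fin (m + 1) → TangentSpace (𝓡∂ (2 * m + 2)) (x p)}
    (hu : ∀ i, Continuous fun p => (⟨x p, u p i⟩ : TangentBundle (𝓡∂ (2 * m + 2)) M))
    (hw : ∀ i, Continuous fun p => (⟨x p, w p i⟩ : TangentBundle (𝓡∂ (2 * m + 2)) M)) :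
    Continuous fun p => (⟨x p, u p, w p⟩ : FramePair m M) :=
  continuous_induced_rng.2 ((continuous_pi hu).prodMk (continuous_pi hw))

theorem FramePair.continuous_fst (i : Fin (m + 1)) : Continuous fun p : FramePair m M =>
    (⟨p.pt, p.fst i⟩ : TangentBundle (𝓡∂ (2 * m + 2)) M) :=
  (continuous_apply i).comp (_root_.continuous_fst.comp
    (continuous_induced_dom : Continuous fun p : FramePair m M =>
      ((fun i => ⟨p.pt, p.fst i⟩, fun i => ⟨p.pt, p.snd i⟩) :
        (Fin (m + 1) → TangentBundle (𝓡∂ (2 * m + 2)) M) ×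
          (Fin (m + 1) → TangentBundle (𝓡∂ (2 * m + 2)) M))))

theorem FramePair.continuous_snd (i : Fin (m + 1)) : Continuous fun p : FramePair m M =>
    (⟨p.pt, p.snd i⟩ : TangentBundle (𝓡∂ (2 * m + 2)) M) :=
  (continuous_apply i).comp (_root_.continuous_snd.comp
    (continuous_induced_dom : Continuous fun p : FramePair m M =>
      ((fun i => ⟨p.pt, p.fst i⟩, fun i => ⟨p.pt, p.snd i⟩) :
        (Fin (m + 1) → TangentBundle (𝓡∂ (2 * m + 2)) M) ×
          (Fin (m + 1) → TangentBundle (𝓡∂ (2 * m + 2)) M))))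

namespace ClassifiedACS

/-- The pullback of an almost complex structure. -/
def pullbackJ (c : ClassifiedACS S) (φ : LiouAut S) (x : M) :
    TangentSpace (𝓡∂ (2 * m + 2)) x →L[ℝ] TangentSpace (𝓡∂ (2 * m + 2)) x :=
  ((φ.derivEquiv x).symm : _ →L[ℝ] TangentSpace (𝓡∂ (2 * m + 2)) x) ∘L
    c.J (φ.toDiffeo x) ∘L φ.deriv x

theorem deriv_pullbackJ (c : ClassifiedACS S) (φ : LiouAut S) (x : M)
    (v : TangentSpace (𝓡∂ (2 * m + 2)) x) :
    φ.deriv x (c.pullbackJ φ x v) = c.J (φ.toDiffeo x) (φ.deriv x v) :=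
  (φ.derivEquiv x).apply_symm_apply _

/-- The pullback of the map of bundles from `det² TM` to the tautological bundle. -/
def pullbackBundleMap (c : ClassifiedACS S) (φ : LiouAut S) (x : M) :
    TangentSpace (𝓡∂ (2 * m + 2)) x [⋀^Fin (m + 1)]→ₗ[ℝ]
      (TangentSpace (𝓡∂ (2 * m + 2)) x [⋀^Fin (m + 1)]→ₗ[ℝ] Hilb) :=
  (AlternatingMap.domLCongr ℝ Hilb (Fin (m + 1)) ℝ
      (φ.derivEquiv x).symm.toLinearEquiv).toLinearMap.compAlternatingMap
    ((c.bundleMap (φ.toDiffeo x)).compLinearMap (φ.derivEquiv x).toLinearEquiv.toLinearMap)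

theorem pullbackBundleMap_apply (c : ClassifiedACS S) (φ : LiouAut S) (x : M)
    (u w : Fin (m + 1) → TangentSpace (𝓡∂ (2 * m + 2)) x) :
    c.pullbackBundleMap φ x u w =
      c.bundleMap (φ.toDiffeo x) (fun i => φ.deriv x (u i)) (fun i => φ.deriv x (w i)) :=
  rfl

/-- The pullback of an almost complex structure with a classifying map. -/
def pullback (c : ClassifiedACS S) (φ : LiouAut S) : ClassifiedACS S where
  J := c.pullbackJ φ
  J_smooth := by
    have h := (φ.toDiffeo.symm.contMDiff_toFun.contMDiff_tangentMap (m := ∞) le_rfl).comp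
      (c.J_smooth.comp (φ.contMDiff.contMDiff_tangentMap (m := ∞) le_rfl))
    convert h using 1
    funext p
    refine (congrArg (fun w => (⟨p.proj, w⟩ : TangentBundle (𝓡∂ (2 * m + 2)) M))
      (φ.derivEquiv_symm_apply p.proj _)).trans ?_
    exact totalSpace_mk_eq (φ.toDiffeo.symm_apply_apply p.proj).symm _
  J_sq x v := by
    refine (φ.derivEquiv x).injective ?_
    rw [φ.derivEquiv_apply, deriv_pullbackJ, deriv_pullbackJ, c.J_sq, map_neg, φ.derivEquiv_apply]
  J_symplectic x v w := by
    rw [← φ.d_deriv x v w, ← c.J_symplectic (φ.toDiffeo x), ← φ.d_deriv, deriv_pullbackJ,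
      deriv_pullbackJ]
  J_positive x v hv := by
    have h : φ.deriv x v ≠ 0 := fun h => hv ((φ.derivEquiv x).injective
      (h.trans (map_zero (φ.derivEquiv x)).symm))
    rw [← φ.d_deriv x, deriv_pullbackJ]
    exact c.J_positive _ _ h
  cls := c.cls.comp φ.toMap
  bundleMap := c.pullbackBundleMap φ
  bundleMap_continuous := by
    simp only [pullbackBundleMap_apply]
    exact c.bundleMap_continuous.comp (FramePair.continuous_mk
      (fun i => LiouAut.continuous_deriv_apply (continuous_const (y := φ))
        (FramePair.continuous_fst i))
      (fun i => LiouAut.continuous_deriv_apply (continuous_const (y := φ))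
        (FramePair.continuous_snd i)))
  bundleMap_J_left x u w i := by
    rw [pullbackBundleMap_apply, pullbackBundleMap_apply, ← c.bundleMap_J_left _ _ _ i]
    congr 2
    funext j
    rcases eq_or_ne j i with rfl | h
    · simp [deriv_pullbackJ]
    · simp [h]
  bundleMap_J_right x u w i := by
    rw [pullbackBundleMap_apply, pullbackBundleMap_apply, ← c.bundleMap_J_right _ _ _ i]
    congr 1
    funext j
    rcases eq_or_ne j i with rfl | h
    · simp [deriv_pullbackJ]
    · simp [h]
  bundleMap_mem x u w := c.bundleMap_mem _ _ _
  bundleMap_ne_zero x := by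
    obtain ⟨u, w, h⟩ := c.bundleMap_ne_zero (φ.toDiffeo x)
    refine ⟨fun i => (φ.derivEquiv x).symm (u i), fun i => (φ.derivEquiv x).symm (w i), ?_⟩
    rw [pullbackBundleMap_apply]
    simp only [← φ.derivEquiv_apply, ContinuousLinearEquiv.apply_symm_apply]
    exact h

theorem isPullback_pullback (c : ClassifiedACS S) (φ : LiouAut S) :
    IsPullback φ c (c.pullback φ) where
  J_eq := c.deriv_pullbackJ φ
  cls_eq := rfl
  bundleMap_eq _ _ _ := rfl

theorem IsPullback.eq_pullback {φ : LiouAut S} {c c' : ClassifiedACS S} (h : IsPullback φ c c') :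
    c' = c.pullback φ := by
  refine ClassifiedACS.ext ?_ h.cls_eq ?_
  · funext x
    ext1 v
    exact (φ.derivEquiv x).injective ((h.J_eq x v).trans (c.deriv_pullbackJ φ x v).symm)
  · funext x
    ext1 u
    ext1 w
    exact h.bundleMap_eq x u w

theorem continuous_pullback (c : ClassifiedACS S) : Continuous c.pullback := by
  refine continuous_induced_rng.2 (.prodMk ?_ (.prodMk ?_ ?_))
  · refine ContinuousMap.continuous_of_continuous_uncurry _ ?_
    have h₁ : Continuous fun q : LiouAut S × TangentBundle (𝓡∂ (2 * m + 2)) M =>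
        (⟨q.1.toDiffeo q.2.proj, q.1.deriv q.2.proj q.2.snd⟩ :
          TangentBundle (𝓡∂ (2 * m + 2)) M) :=
      LiouAut.continuous_deriv_apply continuous_fst continuous_snd
    exact LiouAut.continuous_derivEquiv_symm_apply continuous_fst
      ((FiberBundle.continuous_proj _ _).comp continuous_snd) (c.toEnd.continuous.comp h₁)
  · exact (c.cls.continuous_postcomp).comp LiouAut.continuous_toMap
  · refine ContinuousMap.continuous_of_continuous_uncurry _ ?_
    exact c.bundleMap_continuous.comp (FramePair.continuous_mk
      (fun i => LiouAut.continuous_deriv_apply continuous_fst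
        ((FramePair.continuous_fst i).comp continuous_snd))
      (fun i => LiouAut.continuous_deriv_apply continuous_fst
        ((FramePair.continuous_snd i).comp continuous_snd)))

end ClassifiedACS

end Pullback

/-! ### Complex determinants -/

section Determinant

theorem real_smul_hilb (r : ℝ) (h : Hilb) : r • h = (r : ℂ) • h := by
  ext n
  change r • (h n) = (r : ℂ) * h n
  exact Complex.real_smul

/-- The space of alternating complex multilinear forms of top degree is one-dimensional: such a
form is determined by its value on a complex basis `e`. -/
theorem exists_frame {V : Type*} [AddCommGroup V] [Module ℝ V] [FiniteDimensional ℝ V] {k : ℕ}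
    (hV : Module.finrank ℝ V = 2 * k) (A : V →ₗ[ℝ] V) (hA : ∀ v, A (A v) = -v) :
    ∃ (e : Fin k → V) (d : (Fin k → V) → ℂ), ∀ g : V [⋀^Fin k]→ₗ[ℝ] Hilb,
      (∀ u i, g (Function.update u i (A (u i))) = Complex.I • g u) → ∀ u, g u = d u • g e := by
  let ρ : ℂ →ₐ[ℝ] Module.End ℝ V := Complex.lift ⟨A, by ext v; exact hA v⟩
  have hρ : ∀ (z : ℂ) (v : V), ρ z v = z.re • v + z.im • A v := fun z v => by
    simp [ρ, Complex.liftAux_apply, Algebra.algebraMap_eq_smul_one]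
  let _ : Module ℂ V := Module.compHom V ρ.toRingHom
  have hsmul : ∀ (z : ℂ) (v : V), z • v = z.re • v + z.im • A v := hρ
  have : IsScalarTower ℝ ℂ V := ⟨fun r z v => by
    simp only [hsmul, Complex.smul_re, Complex.smul_im, smul_add, smul_smul, smul_eq_mul]⟩
  have : FiniteDimensional ℂ V := FiniteDimensional.right ℝ ℂ V
  have hfin : Module.finrank ℂ V = k := by
    have := Module.finrank_mul_finrank ℝ ℂ V
    rw [Complex.finrank_real_complex, hV] at this
    omega
  let e := Module.finBasisOfFinrankEq ℂ V hfin
  refine ⟨e, e.det, fun g hg => ?_⟩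
  let g' : V [⋀^Fin k]→ₗ[ℂ] Hilb :=
    { toFun := g
      map_update_add' := fun {_} u i x y => by
        convert g.map_update_add u i x y
      map_update_smul' := fun {hd} u i z x => by
        obtain rfl : hd = instDecidableEqFin k := Subsingleton.elim _ _
        have h₁ := hg (Function.update u i x) i
        simp only [Function.update_self, Function.update_idem] at h₁
        have h₂ : g (Function.update u i (z • x)) = z • g (Function.update u i x) := by
          rw [hsmul, g.map_update_add, g.map_update_smul, g.map_update_smul, h₁, real_smul_hilb,
            real_smul_hilb, smul_smul, ← add_smul, Complex.re_add_im]
        exact h₂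
      map_eq_zero_of_eq' := g.map_eq_zero_of_eq' }
  have key : g' = (LinearMap.toSpanSingleton ℂ Hilb (g e)).compAlternatingMap e.det := by
    refine Module.Basis.ext_alternating e fun v hv => ?_
    let τ : Equiv.Perm (Fin k) := Equiv.ofBijective v (Finite.injective_iff_bijective.1 hv)
    change g' (e ∘ τ) = (LinearMap.toSpanSingleton ℂ Hilb (g e)).compAlternatingMap e.det (e ∘ τ)
    rw [AlternatingMap.map_perm, AlternatingMap.map_perm]
    congr 1
    simp [Module.Basis.det_self, g']
  intro u
  exact congrArg (fun G : V [⋀^Fin k]→ₗ[ℂ] Hilb => G u) key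

end Determinant

/-! ### The topology of the space of classified almost complex structures -/

section ClassifiedTopology

open Filter Bundle

universe u v

/-- A map to `BU(1)` is continuous if the lines have nonvanishing continuous local sections. -/
theorem BUOne.continuous_of_local_sections {X : Type*} [TopologicalSpace X] {ℓ : X → BUOne}
    (h : ∀ x₀, ∃ s : X → Hilb, ContinuousAt s x₀ ∧ s x₀ ≠ 0 ∧ ∀ x, s x ∈ (ℓ x).line) :
    Continuous ℓ := by
  classical
  rw [continuous_iff_continuousAt]
  intro x₀
  obtain ⟨s, hs, h₀, hmem⟩ := h x₀
  let s' : X → HilbNonzero := fun x => if hx : s x ≠ 0 then ⟨s x, hx⟩ else ⟨s x₀, h₀⟩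
  have hne : ∀ᶠ x in 𝓝 x₀, s x ≠ 0 := hs.eventually_ne h₀
  have hs' : ContinuousAt s' x₀ := by
    refine (Topology.IsInducing.subtypeVal (t := {v : Hilb | v ≠ 0})).continuousAt_iff.2 ?_
    refine hs.congr (hne.mono fun x hx => ?_)
    simp only [Function.comp_apply, s', dif_pos hx]
  refine ((continuous_mk.continuousAt (x := s' x₀)).comp hs').congr (hne.mono fun x hx => ?_)
  refine mk_eq_of_mem_line ?_
  simp only [s', dif_pos hx]
  exact hmem x

variable {m : ℕ} {M : Type u} [TopologicalSpace M]
  [ChartedSpace (EuclideanHalfSpace (2 * m + 2)) M] [IsManifold (𝓡∂ (2 * m + 2)) ∞ M]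
  {Y : Type v} [TopologicalSpace Y] [ChartedSpace (EuclideanHalfSpace (2 * m + 1)) Y]
  [IsManifold (𝓡∂ (2 * m + 1)) ∞ Y] {S : LiouvilleSector m M Y}

theorem exists_localFrame_eq (x₀ : M) (v : TangentSpace (𝓡∂ (2 * m + 2)) x₀) :
    ∃ e, localFrame (𝓡∂ (2 * m + 2)) x₀ e x₀ = v :=
  ⟨_, (trivializationAt _ (TangentSpace (𝓡∂ (2 * m + 2))) x₀).symmL_continuousLinearMapAt
    (mem_baseSet_self x₀) v⟩

/-- A continuous function on pairs of frames, depending on a parameter, has a continuous extension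
from one pair of frames to a function of the parameter and the base point. -/
theorem exists_local_section {P : Type*} [TopologicalSpace P] {B : P → FramePair m M → Hilb}
    (hB : Continuous (Function.uncurry B)) (p₀ : P) (q : FramePair m M) :
    ∃ u w : ∀ x : M, Fin (m + 1) → TangentSpace (𝓡∂ (2 * m + 2)) x,
      ContinuousAt (fun z : P × M => B z.1 ⟨z.2, u z.2, w z.2⟩) (p₀, q.pt) ∧
      B p₀ ⟨q.pt, u q.pt, w q.pt⟩ = B p₀ q := by
  choose e he using fun i => exists_localFrame_eq q.pt (q.fst i)
  choose e' he' using fun i => exists_localFrame_eq q.pt (q.snd i)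
  refine ⟨fun x i => localFrame (𝓡∂ (2 * m + 2)) q.pt (e i) x,
    fun x i => localFrame (𝓡∂ (2 * m + 2)) q.pt (e' i) x, ?_, ?_⟩
  · refine ContinuousAt.comp (g := Function.uncurry B) (f := fun z : P × M => (z.1,
      (⟨z.2, fun i => localFrame (𝓡∂ (2 * m + 2)) q.pt (e i) z.2,
        fun i => localFrame (𝓡∂ (2 * m + 2)) q.pt (e' i) z.2⟩ : FramePair m M)))
      hB.continuousAt (continuousAt_fst.prodMk ?_)
    refine (Topology.IsInducing.continuousAt_iff ⟨rfl⟩).2 (.prodMk ?_ ?_) <;>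
      refine continuousAt_pi.2 fun i => ?_
    · exact continuousAt_localFrame (f := fun z : P × M => z.2) (p₀ := (p₀, q.pt))
        continuousAt_snd (e i)
    · exact continuousAt_localFrame (f := fun z : P × M => z.2) (p₀ := (p₀, q.pt))
        continuousAt_snd (e' i)
  · simp only [he, he']

namespace ClassifiedACS

theorem cls_eq_mk (c : ClassifiedACS S) {x : M}
    {u w : Fin (m + 1) → TangentSpace (𝓡∂ (2 * m + 2)) x} (h : c.bundleMap x u w ≠ 0) :
    c.cls x = BUOne.mk ⟨c.bundleMap x u w, h⟩ :=
  (BUOne.mk_eq_of_mem_line (c.bundleMap_mem x u w)).symm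

/-- The classifying map is determined by the bundle map. -/
theorem ext_of_bundleMap {c c' : ClassifiedACS S} (hJ : c.J = c'.J)
    (h : ∀ x u w, c.bundleMap x u w = c'.bundleMap x u w) : c = c' := by
  refine ClassifiedACS.ext hJ ?_ ?_
  · ext1 x
    obtain ⟨u, w, hne⟩ := c.bundleMap_ne_zero x
    have hne' := hne
    rw [h] at hne'
    rw [c.cls_eq_mk hne, c'.cls_eq_mk hne']
    simp only [h]
  · funext x
    ext1 u
    ext1 w
    exact h x u w

theorem continuous_of_bundleMap {P : Type*} [TopologicalSpace P] {F : P → ClassifiedACS S}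
    (hJ : Continuous fun q : P × TangentBundle (𝓡∂ (2 * m + 2)) M =>
      (⟨q.2.proj, (F q.1).J q.2.proj q.2.snd⟩ : TangentBundle (𝓡∂ (2 * m + 2)) M))
    (hB : Continuous fun q : P × FramePair m M => (F q.1).bundleMap q.2.pt q.2.fst q.2.snd) :
    Continuous F := by
  refine continuous_induced_rng.2 (.prodMk
    (ContinuousMap.continuous_of_continuous_uncurry _ hJ) (.prodMk
      (ContinuousMap.continuous_of_continuous_uncurry _ (BUOne.continuous_of_local_sections ?_))
      (ContinuousMap.continuous_of_continuous_uncurry _ hB)))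
  rintro ⟨p₀, x₀⟩
  obtain ⟨u₀, w₀, hne⟩ := (F p₀).bundleMap_ne_zero x₀
  obtain ⟨u, w, hc, h₀⟩ := exists_local_section
    (B := fun p q => (F p).bundleMap q.pt q.fst q.snd) hB p₀ ⟨x₀, u₀, w₀⟩
  exact ⟨_, hc, h₀.trans_ne hne, fun z => (F z.1).bundleMap_mem _ _ _⟩

theorem _root_.Liouville.locallyCompactSpace_tangentBundle :
    LocallyCompactSpace (TangentBundle (𝓡∂ (2 * m + 2)) M) :=
  Manifold.locallyCompact_of_finiteDimensional (𝓡∂ (2 * m + 2)).tangent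

theorem continuous_J : Continuous fun q : ClassifiedACS S × TangentBundle (𝓡∂ (2 * m + 2)) M =>
    (⟨q.2.proj, q.1.J q.2.proj q.2.snd⟩ : TangentBundle (𝓡∂ (2 * m + 2)) M) := by
  have := locallyCompactSpace_tangentBundle (m := m) (M := M)
  have h : Continuous fun c : ClassifiedACS S => (c.toEnd, c.cls, c.toBundleMap) :=
    continuous_induced_dom
  exact ContinuousEval.continuous_eval.comp ((continuous_fst.comp h).prodMap continuous_id)

section LocallyCompact

variable [T2Space M]

theorem _root_.Liouville.locallyCompactSpace_framePair : LocallyCompactSpace (FramePair m M) := by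
  have := locallyCompactSpace_tangentBundle (m := m) (M := M)
  let ι : FramePair m M → (Fin (m + 1) → TangentBundle (𝓡∂ (2 * m + 2)) M) ×
      (Fin (m + 1) → TangentBundle (𝓡∂ (2 * m + 2)) M) :=
    fun p => (fun i => ⟨p.pt, p.fst i⟩, fun i => ⟨p.pt, p.snd i⟩)
  have hπ : Continuous (TotalSpace.proj : TangentBundle (𝓡∂ (2 * m + 2)) M → M) :=
    FiberBundle.continuous_proj _ _
  have hrange : Set.range ι =
      {z | ∀ i, (z.1 i).proj = (z.1 0).proj ∧ (z.2 i).proj = (z.1 0).proj} := by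
    ext z
    constructor
    · rintro ⟨p, rfl⟩ i
      exact ⟨rfl, rfl⟩
    · rintro hz
      refine ⟨⟨(z.1 0).proj, fun i => (show EuclideanSpace ℝ (Fin (2 * m + 2)) from (z.1 i).snd),
        fun i => (show EuclideanSpace ℝ (Fin (2 * m + 2)) from (z.2 i).snd)⟩, ?_⟩
      exact Prod.ext (funext fun i => totalSpace_mk_eq (hz i).1.symm _)
        (funext fun i => totalSpace_mk_eq (hz i).2.symm _)
  have hclosed : IsClosed (Set.range ι) := by
    rw [hrange, Set.ofPred_forall]
    refine isClosed_iInter fun i => ?_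
    exact (isClosed_eq (by fun_prop) (by fun_prop)).inter (isClosed_eq (by fun_prop) (by fun_prop))
  have hinj : Function.Injective ι := by
    rintro ⟨x, u, w⟩ ⟨x', u', w'⟩ h
    have h₁ := congrFun (congrArg Prod.fst h)
    have h₂ := congrFun (congrArg Prod.snd h)
    obtain rfl : x = x' := congrArg TotalSpace.proj (h₁ 0)
    congr
    · funext i
      exact TotalSpace.mk_injective x (h₁ i)
    · funext i
      exact TotalSpace.mk_injective x (h₂ i)
  exact Topology.IsClosedEmbedding.locallyCompactSpace (f := ι) ⟨⟨⟨rfl⟩, hinj⟩, hclosed⟩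

theorem continuous_bundleMap : Continuous fun q : ClassifiedACS S × FramePair m M =>
    q.1.bundleMap q.2.pt q.2.fst q.2.snd := by
  have := locallyCompactSpace_framePair (m := m) (M := M)
  have h : Continuous fun c : ClassifiedACS S => (c.toEnd, c.cls, c.toBundleMap) :=
    continuous_induced_dom
  exact ContinuousEval.continuous_eval.comp
    ((continuous_snd.comp (continuous_snd.comp h)).prodMap continuous_id)

end LocallyCompact

/-! ### Changing the bundle map -/

/-- A bundle map from `det² (TM, J)` to the trivial bundle with fibre `Hilb` which vanishes
nowhere. -/
structure IsBundleMap (A : ∀ x : M, TangentSpace (𝓡∂ (2 * m + 2)) x →L[ℝ]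
      TangentSpace (𝓡∂ (2 * m + 2)) x)
    (f : ∀ x : M, TangentSpace (𝓡∂ (2 * m + 2)) x [⋀^Fin (m + 1)]→ₗ[ℝ]
      (TangentSpace (𝓡∂ (2 * m + 2)) x [⋀^Fin (m + 1)]→ₗ[ℝ] Hilb)) : Prop where
  continuous : Continuous fun p : FramePair m M => f p.pt p.fst p.snd
  left : ∀ x u w i, f x (Function.update u i (A x (u i))) w = Complex.I • f x u w
  right : ∀ x u w i, f x u (Function.update w i (A x (w i))) = Complex.I • f x u w
  ne_zero : ∀ x, ∃ u w, f x u w ≠ 0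

theorem isBundleMap (c : ClassifiedACS S) : IsBundleMap c.J c.bundleMap :=
  ⟨c.bundleMap_continuous, c.bundleMap_J_left, c.bundleMap_J_right, c.bundleMap_ne_zero⟩

/-- In each tangent space, bundle maps are multiples of a fixed function by their value at a fixed
pair of frames. -/
theorem exists_common_frame (c : ClassifiedACS S) (x : M) :
    ∃ (e : Fin (m + 1) → TangentSpace (𝓡∂ (2 * m + 2)) x)
      (d : (Fin (m + 1) → TangentSpace (𝓡∂ (2 * m + 2)) x) → ℂ),
      ∀ f, IsBundleMap c.J f → f x e e ≠ 0 ∧ ∀ u w, f x u w = (d u * d w) • f x e e := by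
  have : FiniteDimensional ℝ (TangentSpace (𝓡∂ (2 * m + 2)) x) :=
    inferInstanceAs (FiniteDimensional ℝ (EuclideanSpace ℝ (Fin (2 * m + 2))))
  have hV : Module.finrank ℝ (TangentSpace (𝓡∂ (2 * m + 2)) x) = 2 * (m + 1) :=
    (finrank_euclideanSpace_fin (𝕜 := ℝ) (n := 2 * m + 2)).trans (by ring)
  obtain ⟨e, d, h⟩ := exists_frame hV (c.J x : _ →ₗ[ℝ] _) (c.J_sq x)
  refine ⟨e, d, fun f hf => ?_⟩
  have key : ∀ u w, f x u w = (d u * d w) • f x e e := fun u w => by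
    let g : TangentSpace (𝓡∂ (2 * m + 2)) x [⋀^Fin (m + 1)]→ₗ[ℝ] Hilb :=
      ({ toFun := fun k => k e, map_add' := fun _ _ => rfl, map_smul' := fun _ _ => rfl } :
        (TangentSpace (𝓡∂ (2 * m + 2)) x [⋀^Fin (m + 1)]→ₗ[ℝ] Hilb) →ₗ[ℝ] Hilb).compAlternatingMap
        (f x)
    have h₁ : f x u w = d w • f x u e := h (f x u) (fun w i => hf.right x u w i) w
    have h₂ : f x u e = d u • f x e e := h g (fun u i => hf.left x u e i) u
    rw [h₁, h₂, smul_smul, mul_comm]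
  refine ⟨fun h₀ => ?_, key⟩
  obtain ⟨u, w, hne⟩ := hf.ne_zero x
  exact hne (by rw [key, h₀, smul_zero])

theorem IsBundleMap.mem_span {c : ClassifiedACS S} {f} (hf : IsBundleMap c.J f) {x : M} {u₀ w₀}
    (h₀ : f x u₀ w₀ ≠ 0) (u w) : f x u w ∈ Submodule.span ℂ {f x u₀ w₀} := by
  obtain ⟨e, d, h⟩ := c.exists_common_frame x
  have hk := (h f hf).2
  have hd : d u₀ * d w₀ ≠ 0 := fun h => h₀ (by rw [hk, h, zero_smul])
  refine Submodule.mem_span_singleton.2 ⟨d u * d w / (d u₀ * d w₀), ?_⟩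
  rw [hk u₀, hk u, smul_smul, div_mul_cancel₀ _ hd]

/-- Replace the bundle map, and accordingly the classifying map. -/
def withBundleMap (c : ClassifiedACS S) (f) (hf : IsBundleMap c.J f) : ClassifiedACS S where
  __ := c
  cls :=
    { toFun := fun x => BUOne.mk ⟨f x (hf.ne_zero x).choose (hf.ne_zero x).choose_spec.choose,
        (hf.ne_zero x).choose_spec.choose_spec⟩
      continuous_toFun := by
        refine BUOne.continuous_of_local_sections fun x₀ => ?_
        obtain ⟨u₀, w₀, hne⟩ := hf.ne_zero x₀
        obtain ⟨u, w, hc, h₀⟩ := exists_local_section (P := Unit)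
          (B := fun _ q => f q.pt q.fst q.snd) (hf.continuous.comp continuous_snd) ()
          ⟨x₀, u₀, w₀⟩
        refine ⟨fun x => f x (u x) (w x), ContinuousAt.comp (x := x₀) hc
          (f := fun x => ((), x)) (by fun_prop), h₀.trans_ne hne, fun x => ?_⟩
        exact hf.mem_span (hf.ne_zero x).choose_spec.choose_spec _ _ }
  bundleMap := f
  bundleMap_continuous := hf.continuous
  bundleMap_J_left := hf.left
  bundleMap_J_right := hf.right
  bundleMap_mem x u w := hf.mem_span (hf.ne_zero x).choose_spec.choose_spec u w
  bundleMap_ne_zero := hf.ne_zero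

end ClassifiedACS

end ClassifiedTopology

/-! ### The space of classified almost complex structures is contractible -/

section AlternatingPairs

variable {V V' : Type*} [AddCommGroup V] [Module ℝ V] [AddCommGroup V'] [Module ℝ V'] {k : ℕ}

/-- Precompose both groups of variables of a form with a linear map. -/
def precompBoth (f : V' [⋀^Fin k]→ₗ[ℝ] (V' [⋀^Fin k]→ₗ[ℝ] Hilb)) (A : V →ₗ[ℝ] V') :
    V [⋀^Fin k]→ₗ[ℝ] (V [⋀^Fin k]→ₗ[ℝ] Hilb) :=
  ({ toFun := fun g => g.compLinearMap A
     map_add' := fun _ _ => rfl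
     map_smul' := fun _ _ => rfl } :
    (V' [⋀^Fin k]→ₗ[ℝ] Hilb) →ₗ[ℝ] (V [⋀^Fin k]→ₗ[ℝ] Hilb)).compAlternatingMap
    (f.compLinearMap A)

theorem precompBoth_apply (f : V' [⋀^Fin k]→ₗ[ℝ] (V' [⋀^Fin k]→ₗ[ℝ] Hilb)) (A : V →ₗ[ℝ] V')
    (u w : Fin k → V) : precompBoth f A u w = f (fun i => A (u i)) (fun i => A (w i)) := rfl

/-- Postcompose a form in two groups of variables with a linear map. -/
def postcomp (L : Hilb →L[ℂ] Hilb) (f : V [⋀^Fin k]→ₗ[ℝ] (V [⋀^Fin k]→ₗ[ℝ] Hilb)) :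
    V [⋀^Fin k]→ₗ[ℝ] (V [⋀^Fin k]→ₗ[ℝ] Hilb) :=
  let L' : Hilb →ₗ[ℝ] Hilb :=
    { toFun := L
      map_add' := map_add L
      map_smul' := fun r v => by simp only [real_smul_hilb, map_smul, RingHom.id_apply] }
  ({ toFun := fun g => L'.compAlternatingMap g
     map_add' := fun _ _ => by ext1; simp
     map_smul' := fun _ _ => by ext1; simp } :
    (V [⋀^Fin k]→ₗ[ℝ] Hilb) →ₗ[ℝ] (V [⋀^Fin k]→ₗ[ℝ] Hilb)).compAlternatingMap f

/-- The straight line from `L ∘ f` to `L' ∘ g`. -/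
def blend (t : ℝ) (L L' : Hilb →L[ℂ] Hilb) (f g : V [⋀^Fin k]→ₗ[ℝ] (V [⋀^Fin k]→ₗ[ℝ] Hilb)) :
    V [⋀^Fin k]→ₗ[ℝ] (V [⋀^Fin k]→ₗ[ℝ] Hilb) :=
  (1 - t) • postcomp L f + t • postcomp L' g

theorem blend_apply (t : ℝ) (L L' : Hilb →L[ℂ] Hilb)
    (f g : V [⋀^Fin k]→ₗ[ℝ] (V [⋀^Fin k]→ₗ[ℝ] Hilb)) (u w : Fin k → V) :
    blend t L L' f g u w = ((1 - t : ℝ) : ℂ) • L (f u w) + (t : ℂ) • L' (g u w) := by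
  rw [← real_smul_hilb, ← real_smul_hilb]
  rfl

end AlternatingPairs

section Contractible

open Filter Bundle

universe u v

variable {m : ℕ} {M : Type u} [TopologicalSpace M]
  [ChartedSpace (EuclideanHalfSpace (2 * m + 2)) M] [IsManifold (𝓡∂ (2 * m + 2)) ∞ M]
  {Y : Type v} [TopologicalSpace Y] [ChartedSpace (EuclideanHalfSpace (2 * m + 1)) Y]
  [IsManifold (𝓡∂ (2 * m + 1)) ∞ Y] {S : LiouvilleSector m M Y}

instance (x : M) : FiniteDimensional ℝ (TangentSpace (𝓡∂ (2 * m + 2)) x) :=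
  inferInstanceAs (FiniteDimensional ℝ (EuclideanSpace ℝ (Fin (2 * m + 2))))

instance (x : M) : T2Space (TangentSpace (𝓡∂ (2 * m + 2)) x) :=
  inferInstanceAs (T2Space (EuclideanSpace ℝ (Fin (2 * m + 2))))

/-- The antisymmetrization of a bilinear form. -/
def antisymmetrization {E : Type*} [NormedAddCommGroup E] [NormedSpace ℝ E]
    (D : E →L[ℝ] E →L[ℝ] ℝ) : LinearMap.BilinForm ℝ E :=
  LinearMap.mk₂ ℝ (fun v w => D v w - D w v)
    (fun u v w => by simp only [map_add, _root_.add_apply]; ring)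
    (fun a u w => by simp only [map_smul, _root_.smul_apply, smul_eq_mul]; ring)
    (fun u v w => by simp only [map_add, _root_.add_apply]; ring)
    (fun a u w => by simp only [map_smul, _root_.smul_apply, smul_eq_mul]; ring)

/-- The symplectic form at a point, as a bilinear form. -/
def LiouvilleSector.bilinForm (S : LiouvilleSector m M Y) (x : M) :
    LinearMap.BilinForm ℝ (TangentSpace (𝓡∂ (2 * m + 2)) x) :=
  (antisymmetrization (fderivWithin ℝ (S.form.inChart x) (Set.range (𝓡∂ (2 * m + 2)))
    (extChartAt (𝓡∂ (2 * m + 2)) x x)) :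
      LinearMap.BilinForm ℝ (EuclideanSpace ℝ (Fin (2 * m + 2))))

namespace ClassifiedACS

theorem isCompatible (c : ClassifiedACS S) (x : M) : IsCompatible (S.bilinForm x) (c.J x) where
  sq := ContinuousLinearMap.ext (c.J_sq x)
  symplectic := c.J_symplectic x
  pos := c.J_positive x

theorem isUnit_J_add (c₀ c : ClassifiedACS S) (x : M) : IsUnit (c.J x + c₀.J x) :=
  (c₀.isCompatible x).isUnit_add (c.isCompatible x)

theorem isUnit_shear_J (c₀ c : ClassifiedACS S) (t : I) (x : M) :
    IsUnit (shear (t : ℝ) (c₀.J x) (c.J x)) :=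
  (c₀.isCompatible x).isUnit_shear (c.isCompatible x) t.2.1 t.2.2

section Families

variable (c₀ : ClassifiedACS S) {P : Type*} [TopologicalSpace P] {t : P → I} (ht : Continuous t)
  {c : P → ClassifiedACS S} (hc : Continuous c) {x : P → M}
  {v : ∀ p, TangentSpace (𝓡∂ (2 * m + 2)) (x p)}
  (hv : Continuous fun p => (⟨x p, v p⟩ : TangentBundle (𝓡∂ (2 * m + 2)) M))
include ht hc hv

theorem continuousAt_interp_and_intertwiner (p₀ : P) :
    ContinuousAt (fun p => (⟨x p, interp (t p : ℝ) (c₀.J (x p)) ((c p).J (x p)) (v p)⟩ :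
      TangentBundle (𝓡∂ (2 * m + 2)) M)) p₀ ∧
    ContinuousAt (fun p => (⟨x p, intertwiner (t p : ℝ) (c₀.J (x p)) ((c p).J (x p)) (v p)⟩ :
      TangentBundle (𝓡∂ (2 * m + 2)) M)) p₀ := by
  have hx : Continuous x := (FiberBundle.continuous_proj _ _).comp hv
  have hfr := continuousAt_localFrame (J := 𝓡∂ (2 * m + 2)) (hx.continuousAt (x := p₀))
  refine continuousAt_interp_apply (t := fun p => (t p : ℝ)) (a := fun p => c₀.J (x p))
    (b := fun p => (c p).J (x p)) hx.continuousAt (continuous_subtype_val.comp ht).continuousAt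
    (fun e => ?_) (fun e => ?_) (isUnit_J_add _ _ _) (isUnit_shear_J _ _ _ _) hv.continuousAt
  · exact ContinuousAt.comp (x := p₀) c₀.toEnd.continuous.continuousAt (hfr e)
  · exact ContinuousAt.comp (x := p₀) (g := fun q : ClassifiedACS S ×
      TangentBundle (𝓡∂ (2 * m + 2)) M => (⟨q.2.proj, q.1.J q.2.proj q.2.snd⟩ :
        TangentBundle (𝓡∂ (2 * m + 2)) M)) continuous_J.continuousAt
      (hc.continuousAt.prodMk (hfr e))

theorem continuous_interp_J : Continuous fun p => (⟨x p, interp (t p : ℝ) (c₀.J (x p))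
    ((c p).J (x p)) (v p)⟩ : TangentBundle (𝓡∂ (2 * m + 2)) M) :=
  continuous_iff_continuousAt.2 fun p => (continuousAt_interp_and_intertwiner c₀ ht hc hv p).1

theorem continuous_intertwiner_J : Continuous fun p => (⟨x p, intertwiner (t p : ℝ) (c₀.J (x p))
    ((c p).J (x p)) (v p)⟩ : TangentBundle (𝓡∂ (2 * m + 2)) M) :=
  continuous_iff_continuousAt.2 fun p => (continuousAt_interp_and_intertwiner c₀ ht hc hv p).2

end Families

theorem intertwiner_J_apply (c₀ c : ClassifiedACS S) (t : I) (x : M)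
    (v : TangentSpace (𝓡∂ (2 * m + 2)) x) :
    intertwiner (t : ℝ) (c₀.J x) (c.J x) (interp (t : ℝ) (c₀.J x) (c.J x) v) =
      c.J x (intertwiner (t : ℝ) (c₀.J x) (c.J x) v) :=
  congrArg (fun A : TangentSpace (𝓡∂ (2 * m + 2)) x →L[ℝ] TangentSpace (𝓡∂ (2 * m + 2)) x => A v)
    (intertwiner_mul_interp (c₀.isCompatible x).sq (c.isCompatible x).sq (isUnit_J_add c₀ c x)
      (isUnit_shear_J c₀ c t x))

theorem intertwiner_J_surjective (c₀ c : ClassifiedACS S) (t : I) (x : M)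
    (v : TangentSpace (𝓡∂ (2 * m + 2)) x) :
    ∃ w, intertwiner (t : ℝ) (c₀.J x) (c.J x) w = v := by
  have h₁ := isUnit_shear_J c₀ c 1 x
  rw [Set.Icc.coe_one] at h₁
  obtain ⟨U, hU⟩ : IsUnit (intertwiner (t : ℝ) (c₀.J x) (c.J x)) :=
    h₁.mul (isUnit_shear_J c₀ c t x).ringInverse
  refine ⟨(U⁻¹ : Units _).1 v, ?_⟩
  rw [← hU]
  exact congrArg (fun A : TangentSpace (𝓡∂ (2 * m + 2)) x →L[ℝ] TangentSpace (𝓡∂ (2 * m + 2)) x =>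
    A v) U.mul_inv

/-- The path from an almost complex structure with the complex structure of `c₀` at time `0` to `c`
at time `1`, along which the classifying map is constant. -/
def straighten (c₀ c : ClassifiedACS S) (t : I) : ClassifiedACS S where
  J x := interp (t : ℝ) (c₀.J x) (c.J x)
  J_smooth := contMDiff_interp (t : ℝ) c₀.J_smooth c.J_smooth (isUnit_J_add c₀ c)
    (isUnit_shear_J c₀ c t)
  J_sq x := ((c₀.isCompatible x).interp (c.isCompatible x) t.2.1 t.2.2).apply_apply
  J_symplectic x := ((c₀.isCompatible x).interp (c.isCompatible x) t.2.1 t.2.2).symplectic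
  J_positive x := ((c₀.isCompatible x).interp (c.isCompatible x) t.2.1 t.2.2).pos
  cls := c.cls
  bundleMap x := precompBoth (c.bundleMap x) (intertwiner (t : ℝ) (c₀.J x) (c.J x) :
    TangentSpace (𝓡∂ (2 * m + 2)) x →L[ℝ] TangentSpace (𝓡∂ (2 * m + 2)) x).toLinearMap
  bundleMap_continuous := by
    simp only [precompBoth_apply]
    exact c.bundleMap_continuous.comp (FramePair.continuous_mk
      (fun i => continuous_intertwiner_J c₀ continuous_const continuous_const
        (FramePair.continuous_fst i))
      (fun i => continuous_intertwiner_J c₀ continuous_const continuous_const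
        (FramePair.continuous_snd i)))
  bundleMap_J_left x u w i := by
    rw [precompBoth_apply, precompBoth_apply, ← c.bundleMap_J_left _ _ _ i]
    congr 2
    funext j
    rcases eq_or_ne j i with rfl | h
    · simp [intertwiner_J_apply]
    · simp [h]
  bundleMap_J_right x u w i := by
    rw [precompBoth_apply, precompBoth_apply, ← c.bundleMap_J_right _ _ _ i]
    congr 1
    funext j
    rcases eq_or_ne j i with rfl | h
    · simp [intertwiner_J_apply]
    · simp [h]
  bundleMap_mem x u w := c.bundleMap_mem _ _ _
  bundleMap_ne_zero x := by
    obtain ⟨u, w, h⟩ := c.bundleMap_ne_zero x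
    choose u' hu' using fun i => intertwiner_J_surjective c₀ c t x (u i)
    choose w' hw' using fun i => intertwiner_J_surjective c₀ c t x (w i)
    refine ⟨u', w', ?_⟩
    rw [precompBoth_apply]
    simp only [ContinuousLinearMap.coe_coe, hu', hw']
    exact h

theorem straighten_zero_J (c₀ c : ClassifiedACS S) : (straighten c₀ c 0).J = c₀.J :=
  funext fun _ => interp_zero _ _

theorem straighten_one (c₀ c : ClassifiedACS S) : straighten c₀ c 1 = c := by
  have h₁ : ∀ x, IsUnit (shear 1 (c₀.J x) (c.J x)) := fun x => by
    have h := isUnit_shear_J c₀ c 1 x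
    rwa [Set.Icc.coe_one] at h
  refine ext_of_bundleMap (funext fun x => ?_) fun x u w => ?_
  · exact interp_one (c₀.isCompatible x).sq (c.isCompatible x).sq (isUnit_J_add c₀ c x) (h₁ x)
  · change c.bundleMap x (fun i => intertwiner 1 (c₀.J x) (c.J x) (u i))
      (fun i => intertwiner 1 (c₀.J x) (c.J x) (w i)) = _
    rw [intertwiner_one (h₁ x)]
    rfl

theorem isBundleMap_straighten_zero (c₀ c : ClassifiedACS S) :
    IsBundleMap c₀.J (straighten c₀ c 0).bundleMap :=
  straighten_zero_J c₀ c ▸ (straighten c₀ c 0).isBundleMap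

theorem IsBundleMap.blend {A} {f g} (hf : IsBundleMap (M := M) (m := m) A f) (hg : IsBundleMap A g)
    {t : ℝ} {L L' : Hilb →L[ℂ] Hilb}
    (h : ∀ x, ∃ u w, Liouville.blend t L L' (f x) (g x) u w ≠ 0) :
    IsBundleMap A fun x => Liouville.blend t L L' (f x) (g x) where
  continuous := by
    simp only [blend_apply]
    exact ((L.continuous.comp hf.continuous).const_smul ((1 - t : ℝ) : ℂ)).add
      ((L'.continuous.comp hg.continuous).const_smul (t : ℂ))
  left x u w i := by
    simp only [blend_apply, hf.left, hg.left, map_smul, smul_add, smul_comm Complex.I]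
  right x u w i := by
    simp only [blend_apply, hf.right, hg.right, map_smul, smul_add, smul_comm Complex.I]
  ne_zero := h

/-- Move the values of the bundle map into the span of the odd basis vectors. -/
def toOdd (c₀ c : ClassifiedACS S) (t : I) : ClassifiedACS S :=
  c₀.withBundleMap (fun x => Liouville.blend (t : ℝ) (.id ℂ Hilb) oddShift
      ((straighten c₀ c 0).bundleMap x) ((straighten c₀ c 0).bundleMap x))
    ((isBundleMap_straighten_zero c₀ c).blend (isBundleMap_straighten_zero c₀ c) fun x => by
      obtain ⟨u, w, h⟩ := (straighten c₀ c 0).bundleMap_ne_zero x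
      refine ⟨u, w, ?_⟩
      rw [blend_apply]
      exact line_oddShift_ne_zero h t)

/-- Move the odd bundle map to the even bundle map of `c₀`. It does not vanish on the way, because
both bundle maps have the same zeros and the odd and the even vectors are independent. -/
def toEven (c₀ c : ClassifiedACS S) (t : I) : ClassifiedACS S :=
  c₀.withBundleMap (fun x => Liouville.blend (t : ℝ) oddShift evenShift
      ((straighten c₀ c 0).bundleMap x) (c₀.bundleMap x))
    ((isBundleMap_straighten_zero c₀ c).blend c₀.isBundleMap fun x => by
      obtain ⟨e, _, h⟩ := c₀.exists_common_frame x
      refine ⟨e, e, ?_⟩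
      rw [blend_apply]
      exact line_odd_even_ne_zero (h _ (isBundleMap_straighten_zero c₀ c)).1
        (h _ c₀.isBundleMap).1 t)

section Continuity

variable [T2Space M]

theorem continuous_straighten (c₀ : ClassifiedACS S) :
    Continuous fun p : I × ClassifiedACS S => straighten c₀ p.2 p.1 := by
  refine continuous_of_bundleMap ?_ ?_
  · exact continuous_interp_J c₀ (continuous_fst.comp continuous_fst)
      (continuous_snd.comp continuous_fst) continuous_snd
  · exact continuous_bundleMap.comp ((continuous_snd.comp continuous_fst).prodMk
      (FramePair.continuous_mk
        (fun i => continuous_intertwiner_J c₀ (continuous_fst.comp continuous_fst)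
          (continuous_snd.comp continuous_fst) ((FramePair.continuous_fst i).comp continuous_snd))
        (fun i => continuous_intertwiner_J c₀ (continuous_fst.comp continuous_fst)
          (continuous_snd.comp continuous_fst)
          ((FramePair.continuous_snd i).comp continuous_snd))))

theorem continuous_withBundleMap_blend (c₀ : ClassifiedACS S) {P : Type*} [TopologicalSpace P]
    {t : P → I} (ht : Continuous t) {L L' : Hilb →L[ℂ] Hilb} {c c' : P → ClassifiedACS S}
    (hc : Continuous c) (hc' : Continuous c')
    (h : ∀ p, IsBundleMap c₀.J fun x => Liouville.blend (t p : ℝ) L L' ((c p).bundleMap x)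
      ((c' p).bundleMap x)) :
    Continuous fun p => c₀.withBundleMap _ (h p) := by
  refine continuous_of_bundleMap (c₀.toEnd.continuous.comp continuous_snd) ?_
  simp only [withBundleMap, blend_apply]
  have h₁ := continuous_bundleMap.comp (hc.prodMap (continuous_id (X := FramePair m M)))
  have h₂ := continuous_bundleMap.comp (hc'.prodMap (continuous_id (X := FramePair m M)))
  have h₃ : Continuous fun q : P × FramePair m M => ((t q.1 : ℝ) : ℂ) :=
    Complex.continuous_ofReal.comp (continuous_subtype_val.comp (ht.comp continuous_fst))
  have h₄ : Continuous fun q : P × FramePair m M => ((1 - (t q.1 : ℝ) : ℝ) : ℂ) :=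
    Complex.continuous_ofReal.comp (continuous_const.sub
      (continuous_subtype_val.comp (ht.comp continuous_fst)))
  exact (h₄.smul (L.continuous.comp h₁)).add (h₃.smul (L'.continuous.comp h₂))

theorem continuous_toOdd (c₀ : ClassifiedACS S) :
    Continuous fun p : I × ClassifiedACS S => toOdd c₀ p.2 p.1 := by
  have hr : Continuous fun p : I × ClassifiedACS S => straighten c₀ p.2 0 :=
    (continuous_straighten c₀).comp (f := fun p : I × ClassifiedACS S => ((0 : I), p.2))
      (continuous_const.prodMk continuous_snd)
  unfold toOdd
  exact continuous_withBundleMap_blend c₀ continuous_fst hr hr _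

theorem continuous_toEven (c₀ : ClassifiedACS S) :
    Continuous fun p : I × ClassifiedACS S => toEven c₀ p.2 p.1 := by
  have hr : Continuous fun p : I × ClassifiedACS S => straighten c₀ p.2 0 :=
    (continuous_straighten c₀).comp (f := fun p : I × ClassifiedACS S => ((0 : I), p.2))
      (continuous_const.prodMk continuous_snd)
  unfold toEven
  exact continuous_withBundleMap_blend c₀ continuous_fst hr continuous_const _

end Continuity

theorem toOdd_J (c₀ c : ClassifiedACS S) (t : I) : (toOdd c₀ c t).J = c₀.J := rfl

theorem toEven_J (c₀ c : ClassifiedACS S) (t : I) : (toEven c₀ c t).J = c₀.J := rfl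

theorem toOdd_bundleMap (c₀ c : ClassifiedACS S) (t : I) (x : M)
    (u w : Fin (m + 1) → TangentSpace (𝓡∂ (2 * m + 2)) x) :
    (toOdd c₀ c t).bundleMap x u w = ((1 - (t : ℝ) : ℝ) : ℂ) • (straighten c₀ c 0).bundleMap x u w +
      ((t : ℝ) : ℂ) • oddShift ((straighten c₀ c 0).bundleMap x u w) :=
  blend_apply _ _ _ _ _ _ _

theorem toEven_bundleMap (c₀ c : ClassifiedACS S) (t : I) (x : M)
    (u w : Fin (m + 1) → TangentSpace (𝓡∂ (2 * m + 2)) x) :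
    (toEven c₀ c t).bundleMap x u w =
      ((1 - (t : ℝ) : ℝ) : ℂ) • oddShift ((straighten c₀ c 0).bundleMap x u w) +
      ((t : ℝ) : ℂ) • evenShift (c₀.bundleMap x u w) :=
  blend_apply _ _ _ _ _ _ _

theorem toOdd_zero (c₀ c : ClassifiedACS S) : toOdd c₀ c 0 = straighten c₀ c 0 := by
  refine ext_of_bundleMap ((toOdd_J c₀ c 0).trans (straighten_zero_J c₀ c).symm) fun x u w => ?_
  rw [toOdd_bundleMap]
  simp

theorem toEven_zero (c₀ c : ClassifiedACS S) : toEven c₀ c 0 = toOdd c₀ c 1 := by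
  refine ext_of_bundleMap ((toEven_J c₀ c 0).trans (toOdd_J c₀ c 1).symm) fun x u w => ?_
  rw [toOdd_bundleMap, toEven_bundleMap]
  simp

theorem toEven_one (c₀ c c' : ClassifiedACS S) : toEven c₀ c 1 = toEven c₀ c' 1 := by
  refine ext_of_bundleMap ((toEven_J c₀ c 1).trans (toEven_J c₀ c' 1).symm) fun x u w => ?_
  rw [toEven_bundleMap, toEven_bundleMap]
  simp

theorem _root_.Liouville.homotopic_of_continuous {X : Type*} [TopologicalSpace X]
    {F : X → I → X} (h : Continuous fun p : I × X => F p.2 p.1) {f₀ f₁ : C(X, X)}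
    (h₀ : ∀ x, F x 0 = f₀ x) (h₁ : ∀ x, F x 1 = f₁ x) : f₀.Homotopic f₁ :=
  ⟨⟨⟨_, h⟩, h₀, h₁⟩⟩

/-- The almost complex structures are moved to that of `c₀` by means of the Cayley transform. The
bundle maps are then moved to the odd vectors, and from there to the bundle map of `c₀`, shifted to
the even vectors. -/
theorem contractibleSpace [T2Space M] (c₀ : ClassifiedACS S) :
    ContractibleSpace (ClassifiedACS S) := by
  rw [contractible_iff_id_nullhomotopic]
  have slice : ∀ {F : ClassifiedACS S → I → ClassifiedACS S}
      (_ : Continuous fun p : I × ClassifiedACS S => F p.2 p.1) (t : I),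
      Continuous fun c => F c t := fun h t =>
    h.comp (f := fun c => (t, c)) (continuous_const.prodMk continuous_id)
  have g₁ := homotopic_of_continuous (continuous_straighten c₀)
    (f₀ := ⟨_, slice (continuous_straighten c₀) 0⟩) (f₁ := .id _) (fun _ => rfl)
    (straighten_one c₀)
  have g₂ := homotopic_of_continuous (continuous_toOdd c₀)
    (f₀ := ⟨_, slice (continuous_straighten c₀) 0⟩) (f₁ := ⟨_, slice (continuous_toOdd c₀) 1⟩)
    (toOdd_zero c₀) (fun _ => rfl)
  have g₃ := homotopic_of_continuous (continuous_toEven c₀)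
    (f₀ := ⟨_, slice (continuous_toOdd c₀) 1⟩) (f₁ := .const _ (toEven c₀ c₀ 1))
    (toEven_zero c₀) (fun c => toEven_one c₀ c c₀)
  exact ⟨_, (g₁.symm.trans g₂).trans g₃⟩

end ClassifiedACS

end Contractible

/-! ### Lifting along the forgetful maps -/

section ContinuityCriteria

variable {P : Type*} [TopologicalSpace P]

section

variable {A B C : Type*} [TopologicalSpace A] [TopologicalSpace B] [TopologicalSpace C]
  {f : A → C} {g : B → C}

theorem HomotopyPullback.continuous_iff {F : P → HomotopyPullback f g} :
    Continuous F ↔ Continuous (fun p => (F p).fst) ∧ Continuous (fun p => (F p).snd) ∧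
      Continuous fun p => (F p).path := by
  rw [continuous_induced_rng, continuous_prodMk, continuous_prodMk]
  rfl

theorem HomotopyPullback.continuousOn_components {S : Set P} {F : P → HomotopyPullback f g}
    (hF : ContinuousOn F S) : ContinuousOn (fun p => (F p).fst) S ∧
      ContinuousOn (fun p => (F p).snd) S ∧ ContinuousOn (fun p => (F p).path) S := by
  have h := HomotopyPullback.continuous_iff.1 (continuous_id (X := HomotopyPullback f g))
  exact ⟨h.1.comp_continuousOn hF, h.2.1.comp_continuousOn hF, h.2.2.comp_continuousOn hF⟩

end

variable {X B : Type*} [TopologicalSpace X] [TopologicalSpace B] {p : C(X, B)}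

theorem SliceEnd.continuous_iff {F : P → SliceEnd p} :
    Continuous F ↔ Continuous (fun q => (F q).map) ∧ Continuous fun q => (F q).homotopy := by
  rw [continuous_induced_rng, continuous_prodMk]
  rfl

theorem SliceEnd.continuousOn_components {S : Set P} {F : P → SliceEnd p}
    (hF : ContinuousOn F S) : ContinuousOn (fun q => (F q).map) S ∧
      ContinuousOn (fun q => (F q).homotopy) S := by
  have h := SliceEnd.continuous_iff.1 (continuous_id (X := SliceEnd p))
  exact ⟨h.1.comp_continuousOn hF, h.2.comp_continuousOn hF⟩

/-- A continuous family of paths, as a function of the parameter and the time. -/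
theorem continuousOn_path_eval {Z : Type*} [TopologicalSpace Z] {S : Set P} {γ : P → C(I, Z)}
    (h : ContinuousOn γ S) :
    ContinuousOn (fun q : P × I => γ q.1 q.2) (S ×ˢ Set.univ) :=
  ContinuousOn.eval (h.comp continuous_fst.continuousOn fun _ hq => hq.1)
    continuous_snd.continuousOn

theorem continuous_path_curry {Z : Type*} [TopologicalSpace Z] (G : C(P × I, Z)) :
    Continuous fun q => (⟨fun t => G (q, t), by fun_prop⟩ : C(I, Z)) :=
  G.curry.continuous

end ContinuityCriteria

section Forgetful

universe u v w

variable {m : ℕ} {M : Type u} [TopologicalSpace M]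
  [ChartedSpace (EuclideanHalfSpace (2 * m + 2)) M] [IsManifold (𝓡∂ (2 * m + 2)) ∞ M]
  {Y : Type v} [TopologicalSpace Y] [ChartedSpace (EuclideanHalfSpace (2 * m + 1)) Y]
  [IsManifold (𝓡∂ (2 * m + 1)) ∞ Y] {S : LiouvilleSector m M Y} {c : ClassifiedACS S}

theorem LiouAutComp.ext' {z z' : LiouAutComp c} (h₁ : z.aut = z'.aut)
    (h₂ : ∀ t, z.homotopy t = z'.homotopy t) : z = z' := by
  obtain ⟨φ, γ, _, _⟩ := z
  obtain ⟨φ', γ', _, _⟩ := z'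
  obtain rfl : φ = φ' := h₁
  obtain rfl : γ = γ' := ContinuousMap.ext h₂
  rfl

theorem LiouAutComp.continuous_homotopy :
    Continuous (homotopy : LiouAutComp c → C(I, ClassifiedACS S)) :=
  have h : Continuous fun z : LiouAutComp c => (z.aut, z.homotopy) := continuous_induced_dom
  continuous_snd.comp h

/-- The forgetful map from automorphisms with a path of classified almost complex structures. -/
def LiouAutComp.forget (c : ClassifiedACS S) : C(LiouAutComp c, LiouAut S) :=
  ⟨aut, continuous_aut⟩

/-- The lifting problem amounts to extending a family of paths of classified almost complex
structures, since the pullback of `c` depends continuously on the automorphism. -/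
theorem LiouAutComp.hasLifting_forget [T2Space M] (c : ClassifiedACS S) (n : ℕ) :
    HasLifting (Cube.boundary (Fin n)) (forget c) := by
  intro h l hl hlS
  have := c.contractibleSpace
  obtain ⟨G, hG₀, hG₁, hG⟩ := Extends.exists_family_of_paths (isClosed_cube_boundary n)
    (Extends.of_contractible (isClosed_prism (isClosed_cube_boundary n)) (hasBoxRetraction_prism n))
    ⟨fun x => c.pullback (h x), c.continuous_pullback.comp h.continuous⟩ (.const _ c)
    (fun q => (l q.1).homotopy q.2)
    (continuousOn_path_eval (continuous_homotopy.comp_continuousOn hl))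
    (fun x hx => (l x).homotopy_zero.eq_pullback.trans (congrArg c.pullback (hlS x hx)))
    (fun x _ => (l x).homotopy_one)
  refine ⟨⟨fun x =>
    { aut := h x
      homotopy := ⟨fun t => G (x, t), by fun_prop⟩
      homotopy_zero := by
        change ClassifiedACS.IsPullback (h x) c (G (x, 0))
        rw [hG₀]
        exact c.isPullback_pullback (h x)
      homotopy_one := hG₁ x },
    continuous_induced_rng.2 (h.continuous.prodMk (continuous_path_curry G))⟩, fun x => rfl,
    fun x hx => ext' (hlS x hx).symm fun t => hG x hx t⟩

instance {B : Type*} [TopologicalSpace B] (pt : B) : ContractibleSpace (PathsTo pt) := by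
  rw [contractible_iff_id_nullhomotopic]
  -- The contraction runs each path from later and later starting points.
  let H : I × PathsTo pt → PathsTo pt := fun q =>
    ⟨⟨fun s => q.2.1 (max s q.1), by fun_prop⟩, by
      change q.2.1 (max 1 q.1) = pt
      rw [max_eq_left (unitInterval.le_one' : q.1 ≤ 1)]
      exact q.2.2⟩
  have hH : Continuous H := by
    refine Continuous.subtype_mk (ContinuousMap.continuous_of_continuous_uncurry _ ?_) _
    change Continuous fun r : (I × PathsTo pt) × I => r.1.2.1 (max r.2 r.1.1)
    fun_prop
  refine ⟨⟨.const _ pt, rfl⟩, ⟨⟨⟨H, hH⟩, fun γ => ?_, fun γ => ?_⟩⟩⟩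
  · refine Subtype.ext (ContinuousMap.ext fun s => ?_)
    change γ.1 (max s 0) = γ.1 s
    rw [max_eq_left (unitInterval.nonneg' : 0 ≤ s)]
  · refine Subtype.ext (ContinuousMap.ext fun s => ?_)
    change γ.1 (max s 1) = pt
    rw [max_eq_right (unitInterval.le_one' : s ≤ 1)]
    exact γ.2

theorem contractibleSpace_continuousMap (X : Type*) [TopologicalSpace X] (Z : Type*)
    [TopologicalSpace Z] [ContractibleSpace Z] : ContractibleSpace C(X, Z) := by
  obtain ⟨z, ⟨F⟩⟩ := id_nullhomotopic Z
  rw [contractible_iff_id_nullhomotopic]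
  refine ⟨.const X z, ⟨⟨⟨fun q => ⟨fun x => F (q.1, q.2 x), by fun_prop⟩, ?_⟩, fun f => ?_,
    fun f => ?_⟩⟩⟩
  · have : Continuous fun q : I × C(X, Z) => (F : C(I × Z, Z)).comp
        ((ContinuousMap.const X q.1).prodMk q.2) :=
      (ContinuousMap.continuous_postcomp F.toContinuousMap).comp
        ContinuousMap.continuous_prodMk_const
    exact this
  · ext x; simp
  · ext x; simp

/-- The forgetful map from graded automorphisms. -/
def LiouAutGr.fstMap (gr : Grading c) : C(LiouAutGr gr, LiouAutComp c) :=
  ⟨HomotopyPullback.fst, HomotopyPullback.continuous_fst _ _⟩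

/-- A lift consists of a path of self-maps of `M`, of a homotopy of maps to the path space of
`BU(1)`, and of a square of maps to `BU(1)`. -/
theorem LiouAutGr.hasLifting_fstMap {n : ℕ}
    (hZ : CubeExt (n + 2) C(M, BUOne)) (gr : Grading c) :
    HasLifting (Cube.boundary (Fin n)) (fstMap gr) := by
  intro h l hl hlS
  have hc := isClosed_cube_boundary n
  have hl' := HomotopyPullback.continuousOn_components hl
  have hs := SliceEnd.continuousOn_components hl'.2.1
  have hp := SliceEnd.continuousOn_components (continuousOn_path_eval hl'.2.2)
  have haut : Continuous fun x => (h x).aut.toMap :=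
    LiouAut.continuous_toMap.comp (LiouAutComp.continuous_aut.comp h.continuous)
  -- the path of self-maps of `M`
  obtain ⟨μ, hμ₀, hμ⟩ := (hasBoxRetraction_cube n).exists_extension_of_homotopy hc
    ⟨fun x => (h x).aut.toMap, haut⟩ (fun q => ((l q.1).path q.2).map) hp.1 fun x hx => by
      rw [(l x).path_zero]
      exact congrArg (fun z : LiouAutComp c => z.aut.toMap) (hlS x hx)
  -- the homotopy of maps to the path space
  have := contractibleSpace_continuousMap M (PathsTo gr.basepoint)
  obtain ⟨ν, hν₀, hν₁, hν⟩ := Extends.exists_family_of_paths hc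
    (Extends.of_contractible (isClosed_prism hc) (hasBoxRetraction_prism n))
    ⟨fun x => gr.nullHomotopy.comp (μ (x, 1)), by fun_prop⟩ (.const _ gr.nullHomotopy)
    (fun q => (l q.1).snd.homotopy q.2) (continuousOn_path_eval hs.2)
    (fun x hx => by
      rw [(l x).snd.homotopy_zero]
      change _ = gr.nullHomotopy.comp (μ (x, 1))
      rw [hμ x hx, (l x).path_one]
      rfl)
    (fun x _ => (l x).snd.homotopy_one)
  -- the square of maps to `BU(1)`
  have hcls : Continuous fun q : (Fin n → I) × I => ((h q.1).homotopy q.2).cls :=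
    ClassifiedACS.continuous_cls.comp (ContinuousEval.continuous_eval.comp
      ((LiouAutComp.continuous_homotopy.comp h.continuous).prodMap continuous_id))
  obtain ⟨η, hη₀, hη₁, hη₀', hη₁', hη⟩ := hZ.prism_prism.exists_family_of_squares hc
    ⟨fun q => c.cls.comp (μ q), by fun_prop⟩ (.const _ c.cls)
    ⟨fun q => ((h q.1).homotopy q.2).cls, hcls⟩
    ⟨fun q => (PathsTo.start gr.basepoint).comp (ν q), by fun_prop⟩
    (fun q => ((l q.1.1).path q.1.2).homotopy q.2)
    (continuousOn_path_eval hp.2)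
    (fun x => by
      refine ⟨?_, ?_, ?_, ?_⟩
      · change c.cls.comp (μ (x, 0)) = ((h x).homotopy 0).cls
        rw [hμ₀]
        exact ((h x).homotopy_zero.cls_eq).symm
      · change c.cls.comp (μ (x, 1)) = (PathsTo.start gr.basepoint).comp (ν (x, 0))
        rw [hν₀, ← gr.start_eq]
        rfl
      · exact (congrArg ClassifiedACS.cls (h x).homotopy_one).symm
      · change c.cls = (PathsTo.start gr.basepoint).comp (ν (x, 1))
        rw [hν₁]
        exact gr.start_eq.symm)
    (fun x hx s => by
      rw [((l x).path s).homotopy_zero]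
      exact congrArg c.cls.comp (hμ x hx s).symm)
    (fun x hx s => ((l x).path s).homotopy_one)
    (fun x hx t => by
      rw [(l x).path_zero]
      exact congrArg (fun z : LiouAutComp c => (z.homotopy t).cls) (hlS x hx))
    (fun x hx t => by
      rw [(l x).path_one]
      exact congrArg (PathsTo.start gr.basepoint).comp (hν x hx t).symm)
  refine ⟨⟨fun x =>
    { fst := h x
      snd :=
        { map := μ (x, 1)
          homotopy := ⟨fun t => ν (x, t), by fun_prop⟩
          homotopy_zero := hν₀ x
          homotopy_one := hν₁ x }
      path := ⟨fun s =>
        { map := μ (x, s)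
          homotopy := ⟨fun t => η ((x, s), t), by fun_prop⟩
          homotopy_zero := hη₀ x s
          homotopy_one := hη₁ x s }, SliceEnd.continuous_iff.2 ⟨by fun_prop,
            (continuous_path_curry η).comp (by fun_prop : Continuous fun s => (x, s))⟩⟩
      path_zero := SliceEnd.ext (hμ₀ x) (ContinuousMap.ext (hη₀' x))
      path_one := SliceEnd.ext rfl (ContinuousMap.ext (hη₁' x)) }, ?_⟩, fun x => rfl,
    fun x hx => HomotopyPullback.ext (hlS x hx).symm
      (SliceEnd.ext ?_ (ContinuousMap.ext fun t => hν x hx t))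
      (ContinuousMap.ext fun s => SliceEnd.ext (hμ x hx s)
        (ContinuousMap.ext fun t => hη x hx s t))⟩
  · refine HomotopyPullback.continuous_iff.2 ⟨h.continuous, SliceEnd.continuous_iff.2
      ⟨by fun_prop, continuous_path_curry ν⟩, ContinuousMap.continuous_of_continuous_uncurry _ ?_⟩
    exact SliceEnd.continuous_iff.2 ⟨μ.continuous, continuous_path_curry η⟩
  · change μ (x, 1) = _
    rw [hμ x hx, (l x).path_one]
    rfl

/-- The forgetful map from graded automorphisms with a compatibility with the background class. -/
def LiouAutGrB.fstMap (gr : Grading c) {K : Type w} [TopologicalSpace K] (b : C(M, K)) :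
    C(LiouAutGrB gr b, LiouAutGr gr) :=
  ⟨HomotopyPullback.fst, HomotopyPullback.continuous_fst _ _⟩

/-- A lift consists of a path of automorphisms, of a path of self-maps of `M`, and of a homotopy of
maps to `K`. -/
theorem LiouAutGrB.hasLifting_fstMap {n : ℕ} (gr : Grading c) {K : Type w} [TopologicalSpace K]
    (hZ : CubeExt (n + 1) C(M, K)) (b : C(M, K)) :
    HasLifting (Cube.boundary (Fin n)) (fstMap gr b) := by
  intro h l hl hlS
  have hc := isClosed_cube_boundary n
  have hl₁ := HomotopyPullback.continuousOn_components hl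
  have hl₂ := HomotopyPullback.continuousOn_components hl₁.2.1
  have hs := SliceEnd.continuousOn_components hl₂.2.1
  obtain ⟨α, hα₀, hα⟩ := (hasBoxRetraction_cube n).exists_extension_of_homotopy hc
    ((LiouAutGr.forget gr).comp h) (fun q => (l q.1).path q.2)
    (continuousOn_path_eval hl₁.2.2) fun x hx =>
      (l x).path_zero.trans (congrArg (LiouAutGr.forget gr) (hlS x hx))
  have hα₁ : ∀ x ∈ Cube.boundary (Fin n), α (x, 1) = (l x).snd.fst := fun x hx =>
    (hα x hx 1).trans (l x).path_one
  obtain ⟨β, hβ₀, hβ⟩ := (hasBoxRetraction_cube n).exists_extension_of_homotopy hc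
    ⟨fun x => (α (x, 1)).toMap, LiouAut.continuous_toMap.comp (by fun_prop)⟩
    (fun q => (l q.1).snd.path q.2) (continuousOn_path_eval hl₂.2.2) fun x hx =>
      (l x).snd.path_zero.trans (congrArg LiouAut.toMap (hα₁ x hx).symm)
  have hβ₁ : ∀ x ∈ Cube.boundary (Fin n), β (x, 1) = (l x).snd.snd.map := fun x hx =>
    (hβ x hx 1).trans (l x).snd.path_one
  obtain ⟨κ, hκ₀, hκ₁, hκ⟩ := hZ.prism.exists_family_of_paths hc
    ⟨fun x => b.comp (β (x, 1)), by fun_prop⟩ (.const _ b)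
    (fun q => (l q.1).snd.snd.homotopy q.2) (continuousOn_path_eval hs.2)
    (fun x hx => (l x).snd.snd.homotopy_zero.trans (congrArg b.comp (hβ₁ x hx).symm))
    (fun x _ => (l x).snd.snd.homotopy_one)
  refine ⟨⟨fun x =>
    { fst := h x
      snd :=
        { fst := α (x, 1)
          snd :=
            { map := β (x, 1)
              homotopy := ⟨fun t => κ (x, t), by fun_prop⟩
              homotopy_zero := hκ₀ x
              homotopy_one := hκ₁ x }
          path := ⟨fun t => β (x, t), by fun_prop⟩
          path_zero := hβ₀ x
          path_one := rfl }
      path := ⟨fun t => α (x, t), by fun_prop⟩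
      path_zero := hα₀ x
      path_one := rfl }, ?_⟩, fun x => rfl,
    fun x hx => HomotopyPullback.ext (hlS x hx).symm
      (HomotopyPullback.ext (hα₁ x hx)
        (SliceEnd.ext (hβ₁ x hx) (ContinuousMap.ext fun t => hκ x hx t))
        (ContinuousMap.ext fun t => hβ x hx t))
      (ContinuousMap.ext fun t => hα x hx t)⟩
  refine HomotopyPullback.continuous_iff.2 ⟨h.continuous, HomotopyPullback.continuous_iff.2
    ⟨by fun_prop, SliceEnd.continuous_iff.2 ⟨by fun_prop, continuous_path_curry κ⟩,
      continuous_path_curry β⟩, continuous_path_curry α⟩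

/-- Maps to an Eilenberg–MacLane space of type `2` extend over cubes of dimension at least `4`. -/
theorem IsEilenbergMacLane.cubeExt {A : Type*} [Group A] {K : Type*} [TopologicalSpace K]
    (hK : IsEilenbergMacLane A 2 K) {k : ℕ} (hk : 4 ≤ k) : CubeExt k K := by
  obtain ⟨j, rfl⟩ : ∃ j, k = j + 1 := ⟨k - 1, by omega⟩
  exact CubeExt.of_subsingleton_pi (hK.pi_ne j (by omega))

/-- The only obstructions to lifting come from the homotopy groups of `K` and of `BU(1)` of degree
at least `3`, which vanish. -/
theorem LiouAutGrB.hasLifting_forget [T2Space M] [SecondCountableTopology M] (gr : Grading c)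
    {A : Type*} [Group A] {K : Type w} [TopologicalSpace K] (hK : IsEilenbergMacLane A 2 K)
    (b : C(M, K)) {n : ℕ} (hn : 3 ≤ n) :
    HasLifting (Cube.boundary (Fin n)) (LiouAutGrB.forget gr b) := by
  have := locallyCompactSpace_of_halfSpace M (n := 2 * m + 2)
  have hM : HasCubeNhds (2 * m + 2) M := hasCubeNhds_of_halfSpace
  have h₁ := LiouAutComp.hasLifting_forget c n
  have h₂ := LiouAutGr.hasLifting_fstMap (n := n)
    (CubeExt.continuousMap hM (fun k hk => BUOne.cubeExt hk) (by omega)) gr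
  have h₃ := LiouAutGrB.hasLifting_fstMap (n := n) gr
    (CubeExt.continuousMap hM (fun k hk => hK.cubeExt hk) (by omega)) b
  exact (h₁.comp h₂).comp h₃

end Forgetful

end Liouville

end

open Liouville in
theorem mainTheorem10 (m : ℕ)
    {M : Type*} [TopologicalSpace M] [T2Space M] [SecondCountableTopology M]
    [ChartedSpace (EuclideanHalfSpace (2 * m + 2)) M] [IsManifold (𝓡∂ (2 * m + 2)) ∞ M]
    {Y : Type*} [TopologicalSpace Y] [T2Space Y] [CompactSpace Y]
    [ChartedSpace (EuclideanHalfSpace (2 * m + 1)) Y] [IsManifold (𝓡∂ (2 * m + 1)) ∞ Y]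
    (S : LiouvilleSector m M Y) (c : ClassifiedACS S) (gr : Grading c)
    {K : Type*} [TopologicalSpace K]
    (hK : IsEilenbergMacLane (Multiplicative (ZMod 2)) 2 K) (b : C(M, K))
    (x : LiouAutGrB gr b) :
    (∀ k : ℕ, 3 ≤ k → Function.Bijective (piMap k (LiouAutGrB.forget gr b) x)) ∧
      Function.Injective (piMap 2 (LiouAutGrB.forget gr b) x) :=
  ⟨fun _ hk => ⟨piMap_injective x (LiouAutGrB.hasLifting_forget gr hK b (by omega)),
      piMap_surjective x (LiouAutGrB.hasLifting_forget gr hK b hk)⟩,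
    piMap_injective x (LiouAutGrB.hasLifting_forget gr hK b le_rfl)⟩
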